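/- \textbf{Setting.} Let $\mathcal X$ be the set of locally finite subsets $X\subset\mathbb R^2$, with the $\sigma$-algebra $\mathcal F$ generated by the counting variables $X\mapsto \#(X\cap\Lambda')$, $\Lambda'\subset\mathbb R^2$ Borel. Let $\mathcal X^h=\{X\in\mathcal X:\ |x-y|_2>1 \text{ for all distinct } x,y\in X\}$ be the set of hard-core configurations, $e_1=(1,0)$, and $\Lambda_r=[-r,r]^2$ for $r\ge 0$. For $Y\in\mathcal X$ and bounded Borel $\Lambda\subset\mathbb R^2$ let $\nu_\Lambda(\cdot|Y)$ be the law of the Poisson point process of intensity $1$ in $\Lambda$ completed by $Y\setminus\Lambda$ outside $\Lambda$, i.e. $$\int f\,d\nu_\Lambda(\cdot|Y)=e^{-|\Lambda|}\sum_{k\ge0}\frac1{k!}\int_{\Lambda^k}f\big(\{x_1,\dots,x_k\}\cup(Y\setminus\Lambda)\big)\,dx_1\cdots dx_k$$ for measurable $f\ge 0$. For $z>0$ and $Y\in\mathcal X^h$ the hard-disk Gibbs distribution in $\Lambda_n$ is the probability measure $$\mu_n^z(dX|Y)=\frac1{Z_n^z(Y)}\,1_{\mathcal X^h}(X)\,z^{\#(X\cap\Lambda_n)}\,\nu_{\Lambda_n}(dX|Y),$$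 where $Z_n^z(Y)$ is the normalizing constant. \textbf{Theorem.} Let $z>0$, $\epsilon=\min\{\frac1{48z},\frac14\}$, $\delta\in(0,\frac12]$, and let $n\ge200$ be an integer. There are functions $t_{n,X}:\mathbb R^2\to[0,\infty)$ ($X\in\mathcal X$), a set $G_n\in\mathcal F$ and measurable functions $\varphi_n,\bar\varphi_n:\mathcal X\to[0,\infty)$ such that $$\mathfrak T_n(X)=\{x+t_{n,X}(x)e_1: x\in X\},\qquad \bar{\mathfrak T}_n(X)=\{x-t_{n,X}(x)e_1: x\in X\}$$ define measurable maps $\mathfrak T_n,\bar{\mathfrak T}_n:\mathcal X\to\mathcal X$ and the following hold. \begin{enumerate} \item[(1)] $t_{n,X}(x)=0$ for all $X\in\mathcal X$ and $x\notin\Lambda_n$. \item[(2)] $t_{n,X}(x)=\delta\epsilon\sqrt{\log n}$ for all $X\in G_n$ and $x\in X\cap\Lambda_{\sqrt n}$. \item[(3)] $|t_{n,X}(x)-t_{n,X}(y)|\le\delta|x-y|_2$ for all $X\in\mathcal X$ and $x,y\in X$. \item[(4)] $\mu_n^z(G_n^c|Y)\le\frac1n$ for all $Y\in\mathcal X^h$.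 \item[(5)] $\mathfrak T_n$ and $\bar{\mathfrak T}_n$ are bijections of $\mathcal X$, and $\mathfrak T_n(\mathcal X^h)=\mathcal X^h=\bar{\mathfrak T}_n(\mathcal X^h)$. \item[(6)] For every $Y\in\mathcal X^h$, $\mu_n^z(\cdot|Y)$ has a density $g_n$ with respect to $\mu_n^z(\cdot|Y)\circ\mathfrak T_n^{-1}$ and a density $\bar g_n$ with respect to $\mu_n^z(\cdot|Y)\circ\bar{\mathfrak T}_n^{-1}$, where $g_n,\bar g_n:\mathcal X\to[0,\infty)$ are measurable and $\varphi_n=g_n\circ\mathfrak T_n$, $\bar\varphi_n=\bar g_n\circ\bar{\mathfrak T}_n$. In particular $\int f(\mathfrak T_n(X))\,\varphi_n(X)\,\mu_n^z(dX|Y)=\int f(X)\,\mu_n^z(dX|Y)$ for all measurable $f\ge0$, and likewise for $\bar{\mathfrak T}_n,\bar\varphi_n$. \item[(7)] For every $Y\in\mathcal X^h$, $\varphi_n\bar\varphi_n>0$ holds $\mu_n^z(\cdot|Y)$-almost surely and $$\int\big|\log\big(\varphi_n(X)\,\bar\varphi_n(X)\big)\big|\,\mu_n^z(dX|Y)\le120\,\delta^2.$$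 \end{enumerate} -/

import Mathlib

open MeasureTheory Set
open scoped ENNReal

noncomputable section

namespace HardDisk

/-- The plane with the Euclidean norm; its `volume` is Lebesgue measure. -/
abbrev Plane : Type := EuclideanSpace ℝ (Fin 2)

/-- The unit vector `(1, 0)`. -/
def e₁ : Plane := EuclideanSpace.single 0 1

/-- The square `[-r, r]²`. -/
def box (r : ℝ) : Set Plane := {x | ∀ i, |x i| ≤ r}

/-- Particle configurations: locally finite subsets of the plane. -/
@[ext]
structure Config where
  carrier : Set Plane
  finite_inter : ∀ Λ : Set Plane, Bornology.IsBounded Λ → (carrier ∩ Λ).Finite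

/-- The number of particles of `X` in `Λ`. -/
def Config.count (Λ : Set Plane) (X : Config) : ℕ∞ := (X.carrier ∩ Λ).encard

/-- The σ-algebra generated by the counting variables of Borel sets. -/
instance : MeasurableSpace Config :=
  ⨆ (Λ : Set Plane) (_ : MeasurableSet Λ), MeasurableSpace.comap (Config.count Λ) ⊤

/-- The configuration with particles `x i` together with the particles of `Y` outside `Λ`. -/
def Config.glue (Λ : Set Plane) (Y : Config) {k : ℕ} (x : Fin k → Plane) : Config where
  carrier := range x ∪ (Y.carrier \ Λ)
  finite_inter := fun Λ' h => by
    rw [union_inter_distrib_right]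
    exact ((finite_range x).inter_of_left _).union
      ((Y.finite_inter Λ' h).subset (inter_subset_inter_left _ sdiff_subset))

/-- The law of the Poisson point process of intensity one in `Λ`, together with the
deterministic configuration `Y` outside `Λ`. -/
def poisson (Λ : Set Plane) (Y : Config) : Measure Config :=
  ENNReal.ofReal (Real.exp (-(volume Λ).toReal)) •
    Measure.sum fun k : ℕ =>
      ((k.factorial : ℝ≥0∞)⁻¹) •
        (Measure.pi fun _ : Fin k => (volume : Measure Plane).restrict Λ).map (Config.glue Λ Y)

/-- Hard-core configurations (disks of diameter one). -/
def hardCore : Set Config :=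
  {X | ∀ x ∈ X.carrier, ∀ y ∈ X.carrier, x ≠ y → 1 < dist x y}

/-- The unnormalized weight `1_{hard core}(X) z ^ #(X ∩ Λ)`. -/
def weight (z : ℝ) (Λ : Set Plane) : Config → ℝ≥0∞ :=
  hardCore.indicator fun X => ENNReal.ofReal z ^ (X.carrier ∩ Λ).ncard

/-- The partition function. -/
def partitionFn (z : ℝ) (Λ : Set Plane) (Y : Config) : ℝ≥0∞ :=
  ∫⁻ X, weight z Λ X ∂(poisson Λ Y)

/-- The finite-volume Gibbs distribution of the hard-disk model in `Λ` with activity `z` and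
boundary configuration `Y`. -/
def gibbs (z : ℝ) (Λ : Set Plane) (Y : Config) : Measure Config :=
  (partitionFn z Λ Y)⁻¹ • (poisson Λ Y).withDensity (weight z Λ)

/-- `μ` has the density `g` with respect to the image measure `μ ∘ T⁻¹`, and `φ` is this density
evaluated at the transformed configuration, `φ = g ∘ T`. Consequently
`∫ f (T X) φ(X) μ(dX) = ∫ f dμ` for measurable `f ≥ 0`. -/
def IsImageDensity (μ : Measure Config) (T : Config → Config) (φ : Config → ℝ) : Prop :=
  ∃ g : Config → ℝ, Measurable g ∧ (∀ X, 0 ≤ g X) ∧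
    μ = (μ.map T).withDensity (fun X => ENNReal.ofReal (g X)) ∧ ∀ X, φ X = g (T X)

end HardDisk

end

/-!
Each particle starts with a base shift that is constant near the origin and decreases
logarithmically to zero towards the boundary of the box. A particle at `y` with shift `t` forces
every other particle `x` to move by at most `t + F y x`, where the slack `F y x` vanishes when the
two disks touch and is Lipschitz. Moving all particles by the largest amounts compatible with these
constraints preserves the hard core, and the inverse is a shift of the same kind in the opposite
direction.

When the particles are ordered by their shifts the derivative is triangular, so the Jacobian is the
product of the factors `1 + s x`, where `s x` is a directional derivative of a base shift or of a
slack. Reversing the direction changes the sign of all `s x`, and the logarithm of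
`∏ x, (1 - s x ^ 2)` is quadratic in the slopes. These are of order `σ / ‖x‖`; since hard disks
cannot accumulate, `∑ x, 1 / ‖x‖ ^ 2` is at most of order `log n`, while `σ ^ 2` is of order
`δ ^ 2 / log n`.

A particle near the origin that does not move by the full amount is the start of a chain of order
`log n` particles whose consecutive gaps have average at most `ε`. As `z * ε` is small, the expected
number of such chains decays exponentially in their length.
-/

noncomputable section

namespace HardDisk

open ProbabilityTheory

/-! ### Freezing times -/

section Freeze

variable {E α : Type*} [ConditionallyCompleteLinearOrder α]

section Defs

variable (τ : E → α) (Φ : E → α → E → α) (S : Set E)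

/-- Iterates of the relaxation step `t x ↦ min (t x) (min_{y ∈ S} Φ y (t y) x)`, started
from `τ`. -/
def relax : ℕ → E → α
  | 0 => τ
  | m + 1 => fun x => sInf (insert (relax m x) ((fun y => Φ y (relax m y) x) '' S))

/-- The limit of the relaxation iterates, that is the largest `t ≤ τ` such that
`t x ≤ Φ y (t y) x` for all `y ∈ S`; for finite `S` it is reached after `S.ncard` steps. -/
def freeze (x : E) : α := relax τ Φ S S.ncard x

end Defs

variable {τ : E → α} {Φ : E → α → E → α} {S : Set E}

variable (τ Φ) in
theorem relax_succ_eq_or (hS : S.Finite) (m : ℕ) (x : E) :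
    relax τ Φ S (m + 1) x = relax τ Φ S m x ∨
      ∃ y ∈ S, relax τ Φ S (m + 1) x = Φ y (relax τ Φ S m y) x := by
  have hmem : relax τ Φ S (m + 1) x ∈
      insert (relax τ Φ S m x) ((fun y => Φ y (relax τ Φ S m y) x) '' S) :=
    (insert_nonempty _ _).csInf_mem ((hS.image _).insert _)
  exact hmem.imp_right fun ⟨y, hy, hyx⟩ => ⟨y, hy, hyx.symm⟩

theorem relax_succ_le (hS : S.Finite) (m : ℕ) (x : E) :
    relax τ Φ S (m + 1) x ≤ relax τ Φ S m x :=
  csInf_le ((hS.image _).insert _).bddBelow (mem_insert _ _)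

theorem relax_succ_le_of_mem (hS : S.Finite) (m : ℕ) (x : E) {y : E} (hy : y ∈ S) :
    relax τ Φ S (m + 1) x ≤ Φ y (relax τ Φ S m y) x :=
  csInf_le ((hS.image _).insert _).bddBelow (mem_insert_of_mem _ ⟨y, hy, rfl⟩)

theorem relax_succ_lt_iff (hS : S.Finite) (m : ℕ) (x : E) (q : α) :
    relax τ Φ S (m + 1) x < q ↔
      relax τ Φ S m x < q ∨ ∃ y ∈ S, Φ y (relax τ Φ S m y) x < q := by
  constructor
  · intro hlt
    rcases relax_succ_eq_or τ Φ hS m x with hstay | ⟨y, hy, hdrop⟩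
    · exact Or.inl (hstay ▸ hlt)
    · exact Or.inr ⟨y, hy, hdrop ▸ hlt⟩
  · rintro (hlt | ⟨y, hy, hlt⟩)
    · exact (relax_succ_le hS m x).trans_lt hlt
    · exact (relax_succ_le_of_mem hS m x hy).trans_lt hlt

theorem antitone_relax (hS : S.Finite) (x : E) : Antitone fun m => relax τ Φ S m x :=
  antitone_nat_of_succ_le fun m => relax_succ_le hS m x

-- A decrease of `x` in a given step is caused by a point that decreased in the step before.
-- Following the causes back yields points with larger and larger values, hence distinct ones.
theorem exists_finset_of_relax_lt (hS : S.Finite) (hΦ : ∀ y t x, t ≤ Φ y t x) (m : ℕ) (x : E)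
    (hx : relax τ Φ S (m + 1) x < relax τ Φ S m x) :
    ∃ A : Finset E, (A : Set E) ⊆ S ∧ A.card = m + 1 ∧ x ∉ A ∧
      ∀ y ∈ A, relax τ Φ S m y ≤ relax τ Φ S (m + 1) x := by
  classical
  induction m generalizing x with
  | zero =>
    obtain ⟨y, hy, hdrop⟩ := (relax_succ_eq_or τ Φ hS 0 x).resolve_left hx.ne
    have hyx : relax τ Φ S 0 y ≤ relax τ Φ S 1 x := hdrop ▸ hΦ y _ x
    refine ⟨{y}, by simpa using hy, by simp, fun hxy => ?_, by simpa using hyx⟩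
    exact hx.not_ge (Finset.mem_singleton.1 hxy ▸ hyx)
  | succ m ih =>
    obtain ⟨y, hy, hdrop⟩ := (relax_succ_eq_or τ Φ hS (m + 1) x).resolve_left hx.ne
    have hyx : relax τ Φ S (m + 1) y ≤ relax τ Φ S (m + 1 + 1) x := hdrop ▸ hΦ y _ x
    have hy_lt : relax τ Φ S (m + 1) y < relax τ Φ S m y := by
      refine (relax_succ_le hS m y).lt_of_ne fun heq => hx.not_ge ?_
      rw [hdrop, heq]
      exact relax_succ_le_of_mem hS m x hy
    obtain ⟨A, hAS, hcard, hyA, hA⟩ := ih y hy_lt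
    have hle : ∀ v ∈ insert y A, relax τ Φ S (m + 1) v ≤ relax τ Φ S (m + 1 + 1) x := by
      intro v hv
      rcases Finset.mem_insert.1 hv with rfl | hv
      · exact hyx
      · exact ((relax_succ_le hS m v).trans (hA v hv)).trans hyx
    refine ⟨insert y A, ?_, by rw [Finset.card_insert_of_notMem hyA, hcard],
      fun hxA => hx.not_ge (hle x hxA), hle⟩
    rw [Finset.coe_insert]
    exact insert_subset hy hAS

theorem relax_succ_of_ncard_le (hS : S.Finite) (hΦ : ∀ y t x, t ≤ Φ y t x) {m : ℕ}
    (hm : S.ncard ≤ m) (x : E) : relax τ Φ S (m + 1) x = relax τ Φ S m x := by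
  by_contra hne
  obtain ⟨A, hAS, hcard, -⟩ :=
    exists_finset_of_relax_lt hS hΦ m x ((relax_succ_le hS _ x).lt_of_ne hne)
  have hle := ncard_le_ncard hAS hS
  rw [ncard_coe_finset] at hle
  omega

theorem relax_eq_freeze (hS : S.Finite) (hΦ : ∀ y t x, t ≤ Φ y t x) {m : ℕ}
    (hm : S.ncard ≤ m) (x : E) : relax τ Φ S m x = freeze τ Φ S x := by
  induction m, hm using Nat.le_induction with
  | base => rfl
  | succ m hm ih => rw [relax_succ_of_ncard_le hS hΦ hm, ih]

theorem freeze_le (hS : S.Finite) (x : E) : freeze τ Φ S x ≤ τ x :=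
  antitone_relax hS x (Nat.zero_le _)

theorem freeze_le_of_mem (hS : S.Finite) (hΦ : ∀ y t x, t ≤ Φ y t x) (x : E) {y : E}
    (hy : y ∈ S) : freeze τ Φ S x ≤ Φ y (freeze τ Φ S y) x := by
  rw [← relax_eq_freeze hS hΦ (Nat.le_succ _) x]
  exact relax_succ_le_of_mem hS _ x hy

theorem le_freeze_of_forall_le (hS : S.Finite) (hΦ : ∀ y t x, t ≤ Φ y t x) {b : α}
    (hb : ∀ x, b ≤ τ x) (x : E) : b ≤ freeze τ Φ S x := by
  suffices hrelax : ∀ m x, b ≤ relax τ Φ S m x from hrelax _ x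
  intro m
  induction m with
  | zero => exact hb
  | succ m ih =>
    intro x
    rcases relax_succ_eq_or τ Φ hS m x with hstay | ⟨y, -, hdrop⟩
    · exact hstay ▸ ih x
    · exact hdrop ▸ (ih y).trans (hΦ _ _ _)

theorem freeze_induction (hS : S.Finite) (hΦ : ∀ y t x, t ≤ Φ y t x)
    (hmono : ∀ y x, StrictMono fun t => Φ y t x) {P : E → Prop}
    (base : ∀ x, freeze τ Φ S x = τ x → P x)
    (step : ∀ x, ∀ y ∈ S, P y → freeze τ Φ S x = Φ y (freeze τ Φ S y) x → P x) (x : E) :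
    P x := by
  suffices hrelax : ∀ m ≤ S.ncard, ∀ x, relax τ Φ S m x = freeze τ Φ S x → P x from
    hrelax _ le_rfl x rfl
  intro m
  induction m with
  | zero => exact fun _ x hx => base x hx.symm
  | succ m ih =>
    intro hm x hx
    rcases relax_succ_eq_or τ Φ hS m x with hstay | ⟨y, hy, hdrop⟩
    · exact ih (by omega) x (hstay ▸ hx)
    · have hle : freeze τ Φ S y ≤ relax τ Φ S m y := antitone_relax hS y (by omega)
      have heq : Φ y (freeze τ Φ S y) x = Φ y (relax τ Φ S m y) x :=
        le_antisymm ((hmono y x).monotone hle) (hdrop ▸ hx ▸ freeze_le_of_mem hS hΦ x hy)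
      refine step x y hy (ih (by omega) y ((hmono y x).injective heq).symm) ?_
      rw [heq, ← hdrop, hx]

theorem freeze_eq_or (hS : S.Finite) (hΦ : ∀ y t x, t ≤ Φ y t x)
    (hmono : ∀ y x, StrictMono fun t => Φ y t x) (x : E) :
    freeze τ Φ S x = τ x ∨ ∃ y ∈ S, y ≠ x ∧ freeze τ Φ S x = Φ y (freeze τ Φ S y) x := by
  induction x using freeze_induction (τ := τ) hS hΦ hmono with
  | base x hx => exact Or.inl hx
  | step x y hy ih hxy =>
    rcases eq_or_ne y x with rfl | hyx
    · exact ih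
    · exact Or.inr ⟨y, hy, hyx, hxy⟩

end Freeze

section Duality

variable {E : Type*} [AddCommGroup E] [Module ℝ E]

/-- The data `(τ', Φ')` describe the inverse of the shift in direction `e` given by `(τ, Φ)`:
at time `s` the point `x` has moved to `x + s • e`, and comparing `s` with a bound for the one
shift at `x` amounts to comparing it with the bound for the other shift at `x + s • e`. -/
structure IsDualShift (e : E) (τ : E → ℝ) (Φ : E → ℝ → E → ℝ) (τ' : E → ℝ)
    (Φ' : E → ℝ → E → ℝ) : Prop where
  le_base : ∀ s x, s ≤ τ x ↔ s ≤ τ' (x + s • e)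
  base_le : ∀ s x, τ x ≤ s ↔ τ' (x + s • e) ≤ s
  le_step : ∀ y t s x, s ≤ Φ y t x ↔ s ≤ Φ' (y + t • e) t (x + s • e)
  step_le : ∀ y t s x, Φ y t x ≤ s ↔ Φ' (y + t • e) t (x + s • e) ≤ s

namespace IsDualShift

variable {e : E} {τ τ' : E → ℝ} {Φ Φ' : E → ℝ → E → ℝ}

theorem symm (h : IsDualShift e τ Φ τ' Φ') : IsDualShift (-e) τ' Φ' τ Φ where
  le_base s x := by simpa using (h.le_base s (x + s • -e)).symm
  base_le s x := by simpa using (h.base_le s (x + s • -e)).symm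
  le_step y t s x := by simpa using (h.le_step (y + t • -e) t s (x + s • -e)).symm
  step_le y t s x := by simpa using (h.step_le (y + t • -e) t s (x + s • -e)).symm

variable {S : Set E}

theorem freeze_le_freeze_image (h : IsDualShift e τ Φ τ' Φ') (hS : S.Finite)
    (hΦ : ∀ y t x, t ≤ Φ y t x) (hmono' : ∀ y x, StrictMono fun t => Φ' y t x) {x : E}
    (hx : x ∈ S) :
    freeze τ Φ S x ≤
      freeze τ' Φ' ((fun x => x + freeze τ Φ S x • e) '' S) (x + freeze τ Φ S x • e) := by
  set T : E → E := fun x => x + freeze τ Φ S x • e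
  suffices hrelax : ∀ m, ∀ x ∈ S, freeze τ Φ S x ≤ relax τ' Φ' (T '' S) m (T x) from
    hrelax _ x hx
  intro m
  induction m with
  | zero => exact fun x _ => (h.le_base _ x).1 (freeze_le hS x)
  | succ m ih =>
    intro x hx
    rcases relax_succ_eq_or τ' Φ' (hS.image T) m (T x) with
      hstay | ⟨_, ⟨y, hy, rfl⟩, hdrop⟩
    · exact hstay ▸ ih x hx
    · rw [hdrop]
      exact ((h.le_step y _ _ x).1 (freeze_le_of_mem hS hΦ x hy)).trans
        ((hmono' _ _).monotone (ih y hy))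

theorem freeze_image_le_freeze (h : IsDualShift e τ Φ τ' Φ') (hS : S.Finite)
    (hΦ : ∀ y t x, t ≤ Φ y t x) (hmono : ∀ y x, StrictMono fun t => Φ y t x)
    (hΦ' : ∀ y t x, t ≤ Φ' y t x) (hmono' : ∀ y x, StrictMono fun t => Φ' y t x) (x : E) :
    freeze τ' Φ' ((fun x => x + freeze τ Φ S x • e) '' S) (x + freeze τ Φ S x • e) ≤
      freeze τ Φ S x := by
  have hTS : ((fun x => x + freeze τ Φ S x • e) '' S).Finite := hS.image _
  induction x using freeze_induction (τ := τ) hS hΦ hmono with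
  | base x hx => exact (freeze_le hTS _).trans ((h.base_le _ x).1 hx.ge)
  | step x y hy ih hxy =>
    exact ((freeze_le_of_mem hTS hΦ' _ (mem_image_of_mem _ hy)).trans
      ((hmono' _ _).monotone ih)).trans ((h.step_le y _ _ x).1 hxy.ge)

theorem freeze_image (h : IsDualShift e τ Φ τ' Φ') (hS : S.Finite)
    (hΦ : ∀ y t x, t ≤ Φ y t x) (hmono : ∀ y x, StrictMono fun t => Φ y t x)
    (hΦ' : ∀ y t x, t ≤ Φ' y t x) (hmono' : ∀ y x, StrictMono fun t => Φ' y t x) {x : E}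
    (hx : x ∈ S) :
    freeze τ' Φ' ((fun x => x + freeze τ Φ S x • e) '' S) (x + freeze τ Φ S x • e) =
      freeze τ Φ S x :=
  (h.freeze_image_le_freeze hS hΦ hmono hΦ' hmono' x).antisymm
    (h.freeze_le_freeze_image hS hΦ hmono' hx)

end IsDualShift

end Duality

section FixPt

open scoped NNReal

/-- The fixed point of a contraction `f` of the real line. In contrast to
`ContractingWith.fixedPoint` it needs no proof that `f` contracts, so that `f` may depend on
parameters. -/
def fixPt (f : ℝ → ℝ) : ℝ := sSup {s | s ≤ f s}

theorem le_iff_le_map_of_contractingWith {f : ℝ → ℝ} {K : ℝ≥0} (hf : ContractingWith K f) {r : ℝ}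
    (hr : f r = r) (s : ℝ) : s ≤ r ↔ s ≤ f s := by
  have hK : (K : ℝ) < 1 := by exact_mod_cast hf.1
  have hlip : |f s - r| ≤ K * |s - r| := by
    simpa only [Real.dist_eq, hr] using hf.2.dist_le_mul s r
  obtain ⟨hge, hle⟩ := abs_le.1 hlip
  constructor <;> intro h <;> by_contra! hlt
  · rw [abs_of_nonpos (by linarith)] at hge
    nlinarith
  · rw [abs_of_pos (by linarith)] at hle
    nlinarith

theorem map_fixPt {f : ℝ → ℝ} {K : ℝ≥0} (hf : ContractingWith K f) :
    f (fixPt f) = fixPt f := by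
  have hr : f hf.fixedPoint = hf.fixedPoint := hf.fixedPoint_isFixedPt
  have hIic : {s | s ≤ f s} = Iic hf.fixedPoint :=
    ext fun s => (le_iff_le_map_of_contractingWith hf hr s).symm
  rw [fixPt, hIic, csSup_Iic, hr]

theorem le_fixPt_iff {f : ℝ → ℝ} {K : ℝ≥0} (hf : ContractingWith K f) (s : ℝ) :
    s ≤ fixPt f ↔ s ≤ f s :=
  le_iff_le_map_of_contractingWith hf (map_fixPt hf) s

theorem fixPt_le_iff {f : ℝ → ℝ} {K : ℝ≥0} (hf : ContractingWith K f) (s : ℝ) :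
    fixPt f ≤ s ↔ f s ≤ s := by
  refine ⟨fun hs => ?_, fun hs => ?_⟩
  · by_contra! hlt
    exact hlt.ne' ((le_antisymm hs ((le_fixPt_iff hf s).2 hlt.le)) ▸ map_fixPt hf)
  · by_contra! hlt
    have heq := le_antisymm ((le_fixPt_iff hf s).1 hlt.le) hs
    exact hlt.ne (hf.fixedPoint_unique' heq.symm (map_fixPt hf))

theorem measurable_fixPt {α : Type*} [MeasurableSpace α] {f : α → ℝ → ℝ} {K : ℝ≥0}
    (hf : ∀ a, ContractingWith K (f a)) (hm : ∀ s, Measurable fun a => f a s) :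
    Measurable fun a => fixPt (f a) := by
  refine measurable_of_Iic fun s => ?_
  have hpre : (fun a => fixPt (f a)) ⁻¹' Iic s = {a | f a s ≤ s} :=
    ext fun a => fixPt_le_iff (hf a) s
  rw [hpre]
  exact measurableSet_le (hm s) measurable_const

end FixPt

/-! ### Measurability on the space of configurations -/

section Box

theorem norm_le_of_mem_box {r : ℝ} {x : Plane} (hx : x ∈ box r) : ‖x‖ ≤ √2 * r := by
  have hr : 0 ≤ r := (abs_nonneg _).trans (hx 0)
  have hsq : ∀ i, x i ^ 2 ≤ r ^ 2 := fun i => sq_le_sq' (abs_le.1 (hx i)).1 (abs_le.1 (hx i)).2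
  refine le_of_sq_le_sq ?_ (by positivity)
  rw [EuclideanSpace.real_norm_sq_eq, Fin.sum_univ_two, mul_pow, Real.sq_sqrt zero_le_two]
  linarith [hsq 0, hsq 1]

theorem mem_box_of_norm_le {r : ℝ} {x : Plane} (hx : ‖x‖ ≤ r) : x ∈ box r :=
  fun i => (PiLp.norm_apply_le x i).trans hx

theorem measurableSet_box (r : ℝ) : MeasurableSet (box r) := by
  simp only [box, ofPred_forall]
  exact MeasurableSet.iInter fun i => measurableSet_le (by fun_prop) measurable_const

theorem isBounded_box (r : ℝ) : Bornology.IsBounded (box r) :=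
  isBounded_iff_forall_norm_le.2 ⟨_, fun _ hx => norm_le_of_mem_box hx⟩

theorem iUnion_box : ⋃ n : ℕ, box n = univ := by
  refine eq_univ_of_forall fun x => ?_
  obtain ⟨n, hn⟩ := exists_nat_ge ‖x‖
  exact mem_iUnion.2 ⟨n, mem_box_of_norm_le hn⟩

end Box

section Measurability

theorem measurable_count {B : Set Plane} (hB : MeasurableSet B) : Measurable (Config.count B) :=
  (comap_measurable _).mono (le_iSup₂_of_le B hB le_rfl) le_rfl

theorem measurable_ncard_inter {B : Set Plane} (hB : MeasurableSet B) :
    Measurable fun X : Config => (X.carrier ∩ B).ncard :=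
  (measurable_from_top (f := ENat.toNat)).comp (measurable_count hB)

theorem measurable_config_of_count {α : Type*} [MeasurableSpace α] {f : α → Config}
    (h : ∀ B, MeasurableSet B → Measurable fun a => (f a).count B) : Measurable f := by
  rw [measurable_iff_comap_le]
  simp only [instMeasurableSpaceConfig, MeasurableSpace.comap_iSup, MeasurableSpace.comap_comp]
  exact iSup₂_le fun B hB => (h B hB).comap_le

theorem Config.countable (X : Config) : X.carrier.Countable := by
  rw [← inter_univ X.carrier, ← iUnion_box, inter_iUnion]
  exact countable_iUnion fun n => (X.finite_inter _ (isBounded_box n)).countable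

theorem Config.measurableSet (X : Config) : MeasurableSet X.carrier := X.countable.measurableSet

theorem Config.count_restrict_apply (X : Config) {B : Set Plane} (hB : MeasurableSet B) :
    Measure.count.restrict X.carrier B = ((X.count B : ℕ∞) : ℝ≥0∞) := by
  rw [Measure.restrict_apply hB, Measure.count_apply (hB.inter X.measurableSet), inter_comm]
  rfl

/-- The counting measure on the points of a configuration. It is a kernel, which makes sets
defined by quantification over these points measurable. -/
def pts : Kernel Config Plane where
  toFun X := Measure.count.restrict X.carrier
  measurable' := by
    refine Measure.measurable_of_measurable_coe _ fun B hB => ?_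
    simp only [Config.count_restrict_apply _ hB]
    exact measurable_from_top.comp (measurable_count hB)

theorem pts_apply_apply (X : Config) {B : Set Plane} (hB : MeasurableSet B) :
    pts X B = ((X.count B : ℕ∞) : ℝ≥0∞) :=
  X.count_restrict_apply hB

theorem isSFiniteKernel_pts_restrict {B : Set Plane} (hB : MeasurableSet B)
    (hb : Bornology.IsBounded B) : IsSFiniteKernel (pts.restrict hB) := by
  classical
  have hm : ∀ k : ℕ, MeasurableSet {X : Config | X.count B = k} := fun k =>
    measurable_count hB (measurableSet_singleton (k : ℕ∞))
  have hfin : ∀ k : ℕ, IsFiniteKernel (Kernel.piecewise (hm k) (pts.restrict hB) 0) := by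
    refine fun k => ⟨⟨k, ENNReal.natCast_lt_top k, fun X => ?_⟩⟩
    rw [Kernel.piecewise_apply]
    split_ifs with hX
    · rw [Kernel.restrict_apply, Measure.restrict_apply_univ, pts_apply_apply X hB,
        show X.count B = k from hX, ENat.toENNReal_coe]
    · simp
  have hsum : pts.restrict hB =
      Kernel.sum fun k : ℕ => Kernel.piecewise (hm k) (pts.restrict hB) 0 := by
    ext X A hA
    obtain ⟨k, hk⟩ : ∃ k : ℕ, X.count B = k := ⟨_, ((X.finite_inter B hb).cast_ncard_eq).symm⟩
    rw [Kernel.sum_apply' _ _ hA, tsum_eq_single k]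
    · rw [Kernel.piecewise_apply, if_pos (show X ∈ {X : Config | X.count B = k} from hk)]
    · intro j hj
      rw [Kernel.piecewise_apply, if_neg fun hX => hj (by exact_mod_cast hX.symm.trans hk)]
      rfl
  rw [hsum]
  infer_instance

instance : IsSFiniteKernel pts := by
  have hm : ∀ j : ℕ, MeasurableSet (disjointed (fun j : ℕ => box j) j) :=
    fun j => MeasurableSet.disjointed (fun j => measurableSet_box j) j
  have hsum : pts = Kernel.sum fun j : ℕ => pts.restrict (hm j) := by
    ext X A -
    simp only [Kernel.sum_apply, Kernel.restrict_apply]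
    rw [← Measure.restrict_iUnion (disjoint_disjointed _) hm, iUnion_disjointed, iUnion_box,
      Measure.restrict_univ]
  have hs : ∀ j, IsSFiniteKernel (pts.restrict (hm j)) := fun j =>
    isSFiniteKernel_pts_restrict (hm j) ((isBounded_box j).subset (disjointed_subset _ _))
  rw [hsum]
  infer_instance

theorem measurable_count_sections {α : Type*} [MeasurableSpace α] {X : α → Config}
    (hX : Measurable X) {P : α → Plane → Prop} (hP : MeasurableSet {p : α × Plane | P p.1 p.2}) :
    Measurable fun a => (X a).count {y | P a y} := by
  refine ENat.measurable_iff.2 fun n => ?_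
  have hkernel : (fun a => (X a).count {y | P a y}) ⁻¹' {(n : ℕ∞)} =
      (fun a => pts.comap X hX a (Prod.mk a ⁻¹' {p | P p.1 p.2})) ⁻¹' {(n : ℝ≥0∞)} := by
    ext a
    rw [mem_preimage, mem_preimage, mem_singleton_iff, mem_singleton_iff, Kernel.comap_apply,
      pts_apply_apply _ (measurable_prodMk_left hP), ← ENat.toENNReal_coe, ENat.toENNReal_inj]
    rfl
  rw [hkernel]
  exact Kernel.measurable_kernel_prodMk_left hP (measurableSet_singleton _)

theorem measurableSet_exists_mem {α : Type*} [MeasurableSpace α] {X : α → Config}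
    (hX : Measurable X) {P : α → Plane → Prop} (hP : MeasurableSet {p : α × Plane | P p.1 p.2}) :
    MeasurableSet {a | ∃ y ∈ (X a).carrier, P a y} := by
  convert measurable_count_sections hX hP (measurableSet_singleton 0).compl using 1
  ext a
  rw [mem_preimage, mem_compl_singleton_iff, Config.count, encard_ne_zero]
  rfl

theorem measurableSet_forall_mem {α : Type*} [MeasurableSpace α] {X : α → Config}
    (hX : Measurable X) {P : α → Plane → Prop} (hP : MeasurableSet {p : α × Plane | P p.1 p.2}) :
    MeasurableSet {a | ∀ y ∈ (X a).carrier, P a y} := by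
  convert (measurableSet_exists_mem hX (P := fun a y => ¬P a y) hP.compl).compl using 1
  ext a
  simp

theorem measurableSet_mem : MeasurableSet {p : Config × Plane | p.2 ∈ p.1.carrier} := by
  convert measurableSet_exists_mem measurable_fst (P := fun (p : Config × Plane) y => y = p.2)
    (measurableSet_eq_fun measurable_snd measurable_fst.snd) using 1
  ext p
  simp

theorem measurableSet_hardCore : MeasurableSet hardCore := by
  refine measurableSet_forall_mem measurable_id
    (P := fun X x => ∀ y ∈ X.carrier, x ≠ y → 1 < dist x y) ?_
  refine measurableSet_forall_mem (X := fun p : Config × Plane => p.1) measurable_fst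
    (P := fun p y => p.2 ≠ y → 1 < dist p.2 y) ?_
  have hx : Measurable fun p : (Config × Plane) × Plane => p.1.2 := measurable_fst.snd
  simp only [ne_eq, imp_iff_not_or, not_not]
  exact (measurableSet_eq_fun hx measurable_snd).union
    (measurableSet_lt measurable_const (hx.dist measurable_snd))

/-- The configuration `X` with the point `p` added, used to build up `Config.glue` one point at
a time. -/
def Config.cons (X : Config) (p : Plane) : Config where
  carrier := insert p X.carrier
  finite_inter Λ hΛ := by
    rw [insert_eq, union_inter_distrib_right]
    exact ((finite_singleton p).inter_of_left Λ).union (X.finite_inter Λ hΛ)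

open scoped Classical in
theorem Config.count_cons (X : Config) (p : Plane) (B : Set Plane) :
    (X.cons p).count B = X.count B + if p ∈ B ∧ p ∉ X.carrier then 1 else 0 := by
  simp only [Config.count, Config.cons]
  split_ifs with hp
  · rw [insert_inter_of_mem hp.1, encard_insert_of_notMem fun h => hp.2 h.1]
  · by_cases hpB : p ∈ B
    · rw [insert_eq_of_mem (by_contra fun hpX => hp ⟨hpB, hpX⟩), add_zero]
    · rw [insert_inter_of_notMem hpB, add_zero]

theorem measurable_cons : Measurable fun p : Config × Plane => p.1.cons p.2 := by
  classical
  refine measurable_config_of_count fun B hB => ?_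
  simp only [Config.count_cons]
  exact ((measurable_count hB).comp measurable_fst).add
    (Measurable.ite ((measurable_snd hB).inter measurableSet_mem.compl)
      measurable_const measurable_const)

theorem glue_succ (Λ : Set Plane) (Y : Config) {k : ℕ} (x : Fin (k + 1) → Plane) :
    Config.glue Λ Y x = (Config.glue Λ Y (Fin.tail x)).cons (x 0) := by
  ext p
  simp only [Config.glue, Config.cons, mem_union, mem_insert_iff, mem_range, Fin.exists_fin_succ,
    Fin.tail, eq_comm (a := p), or_assoc]

theorem measurable_glue (Λ : Set Plane) (Y : Config) (k : ℕ) :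
    Measurable (Config.glue Λ Y (k := k)) := by
  induction k with
  | zero => exact Subsingleton.measurable
  | succ k ih =>
    have htail : Measurable fun x : Fin (k + 1) → Plane => Fin.tail x :=
      measurable_pi_lambda _ fun i => measurable_pi_apply _
    rw [funext (glue_succ Λ Y)]
    exact measurable_cons.comp ((ih.comp htail).prodMk (measurable_pi_apply 0))

section Freeze

variable {Λ : Set Plane} {τ : Plane → ℝ} {Φ : Plane → ℝ → Plane → ℝ}

theorem measurable_relax (hΛ : MeasurableSet Λ) (hb : Bornology.IsBounded Λ) (hτ : Measurable τ)
    (hΦ : Measurable fun p : Plane × ℝ × Plane => Φ p.1 p.2.1 p.2.2) (m : ℕ) :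
    Measurable fun p : Config × Plane => relax τ Φ (p.1.carrier ∩ Λ) m p.2 := by
  induction m with
  | zero => exact hτ.comp measurable_snd
  | succ m ih =>
    refine measurable_of_Iio fun q => ?_
    have hpre : (fun p : Config × Plane => relax τ Φ (p.1.carrier ∩ Λ) (m + 1) p.2) ⁻¹' Iio q =
        {p | relax τ Φ (p.1.carrier ∩ Λ) m p.2 < q} ∪
          {p | ∃ y ∈ p.1.carrier, y ∈ Λ ∧ Φ y (relax τ Φ (p.1.carrier ∩ Λ) m y) p.2 < q} := by
      ext p
      simp only [mem_preimage, mem_Iio, relax_succ_lt_iff (p.1.finite_inter Λ hb), mem_union,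
        mem_ofPred_eq, mem_inter_iff, and_assoc]
    rw [hpre]
    have hstep : Measurable fun p : (Config × Plane) × Plane =>
        Φ p.2 (relax τ Φ (p.1.1.carrier ∩ Λ) m p.2) p.1.2 :=
      hΦ.comp (measurable_snd.prodMk
        ((ih.comp (measurable_fst.fst.prodMk measurable_snd)).prodMk measurable_fst.snd))
    exact (measurableSet_lt ih measurable_const).union (measurableSet_exists_mem measurable_fst
      (P := fun p y => y ∈ Λ ∧ Φ y (relax τ Φ (p.1.carrier ∩ Λ) m y) p.2 < q)
      ((measurable_snd hΛ).inter (measurableSet_lt hstep measurable_const)))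

theorem measurable_freeze (hΛ : MeasurableSet Λ) (hb : Bornology.IsBounded Λ) (hτ : Measurable τ)
    (hΦ : Measurable fun p : Plane × ℝ × Plane => Φ p.1 p.2.1 p.2.2) :
    Measurable fun p : Config × Plane => freeze τ Φ (p.1.carrier ∩ Λ) p.2 := by
  have hrelax : Measurable fun q : ℕ × (Config × Plane) =>
      relax τ Φ (q.2.1.carrier ∩ Λ) q.1 q.2.2 :=
    measurable_from_prod_countable_right fun m => measurable_relax hΛ hb hτ hΦ m
  exact hrelax.comp (((measurable_ncard_inter hΛ).comp measurable_fst).prodMk measurable_id)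

end Freeze

end Measurability

/-! ### Shifts of configurations and profiles -/

section Shift

section Defs

variable (Λ : Set Plane) (τ : Plane → ℝ) (Φ : Plane → ℝ → Plane → ℝ) (e : Plane)

/-- The amount by which the point `x` of the configuration `X` is shifted. -/
def shiftTime (X : Config) (x : Plane) : ℝ := Λ.indicator (freeze τ Φ (X.carrier ∩ Λ)) x

/-- The position of the point `x` of the configuration `X` after the shift in direction `e`. -/
def shiftPoint (X : Config) (x : Plane) : Plane := x + shiftTime Λ τ Φ X x • e

end Defs

variable {Λ : Set Plane} {τ τ' : Plane → ℝ} {Φ Φ' : Plane → ℝ → Plane → ℝ} {e e' : Plane}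

theorem shiftTime_of_notMem (X : Config) {x : Plane} (hx : x ∉ Λ) : shiftTime Λ τ Φ X x = 0 :=
  indicator_of_notMem hx _

theorem shiftTime_of_mem (X : Config) {x : Plane} (hx : x ∈ Λ) :
    shiftTime Λ τ Φ X x = freeze τ Φ (X.carrier ∩ Λ) x :=
  indicator_of_mem hx _

theorem shiftPoint_of_notMem (X : Config) {x : Plane} (hx : x ∉ Λ) :
    shiftPoint Λ τ Φ e X x = x := by
  rw [shiftPoint, shiftTime_of_notMem X hx, zero_smul, add_zero]

theorem shiftTime_nonneg (hb : Bornology.IsBounded Λ) (hτ : ∀ x, 0 ≤ τ x)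
    (hΦ : ∀ y t x, t ≤ Φ y t x) (X : Config) (x : Plane) : 0 ≤ shiftTime Λ τ Φ X x :=
  indicator_nonneg (fun x _ => le_freeze_of_forall_le (X.finite_inter Λ hb) hΦ hτ x) x

theorem shiftTime_le (hb : Bornology.IsBounded Λ) (hτ : ∀ x, 0 ≤ τ x) (X : Config) (x : Plane) :
    shiftTime Λ τ Φ X x ≤ τ x :=
  indicator_apply_le' (fun _ => freeze_le (X.finite_inter Λ hb) x) fun _ => hτ x

theorem measurable_shiftTime (hΛ : MeasurableSet Λ) (hb : Bornology.IsBounded Λ)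
    (hτ : Measurable τ) (hΦ : Measurable fun p : Plane × ℝ × Plane => Φ p.1 p.2.1 p.2.2) :
    Measurable fun p : Config × Plane => shiftTime Λ τ Φ p.1 p.2 :=
  (measurable_freeze hΛ hb hτ hΦ).indicator (measurable_snd hΛ)

variable (Λ τ Φ e) in
/-- The configuration `X` with the particles in the bounded set `Λ` shifted in direction `e`. -/
def shift (hb : Bornology.IsBounded Λ) (X : Config) : Config where
  carrier := shiftPoint Λ τ Φ e X '' X.carrier
  finite_inter Λ' hb' := by
    refine (((X.finite_inter Λ hb).image (shiftPoint Λ τ Φ e X)).union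
      (X.finite_inter Λ' hb')).subset ?_
    rintro _ ⟨⟨x, hx, rfl⟩, hx'⟩
    by_cases hxΛ : x ∈ Λ
    · exact Or.inl ⟨x, ⟨hx, hxΛ⟩, rfl⟩
    · rw [shiftPoint_of_notMem X hxΛ] at hx' ⊢
      exact Or.inr ⟨hx, hx'⟩

variable (Λ τ Φ e) in
/-- Conditions on the data `(τ, Φ)` under which they define a shift of the particles in `Λ` in
direction `e` that does not move particles out of `Λ`. -/
structure IsShift : Prop where
  le_step : ∀ y t x, t ≤ Φ y t x
  strictMono : ∀ y x, StrictMono fun t => Φ y t x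
  nonneg : ∀ x, 0 ≤ τ x
  stay : ∀ x ∈ Λ, ∀ s, 0 ≤ s → s ≤ τ x → x + s • e ∈ Λ
  measurable_base : Measurable τ
  measurable_step : Measurable fun p : Plane × ℝ × Plane => Φ p.1 p.2.1 p.2.2

namespace IsShift

theorem shiftPoint_mem_iff (h : IsShift Λ τ Φ e) (hb : Bornology.IsBounded Λ) (X : Config)
    {x : Plane} : shiftPoint Λ τ Φ e X x ∈ Λ ↔ x ∈ Λ := by
  constructor
  · contrapose
    intro hx
    rwa [shiftPoint_of_notMem X hx]
  · exact fun hx => h.stay x hx _ (shiftTime_nonneg hb h.nonneg h.le_step X x)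
      (shiftTime_le hb h.nonneg X x)

theorem shift_inter (h : IsShift Λ τ Φ e) (hb : Bornology.IsBounded Λ) (X : Config) :
    (shift Λ τ Φ e hb X).carrier ∩ Λ = shiftPoint Λ τ Φ e X '' (X.carrier ∩ Λ) := by
  have hpre : shiftPoint Λ τ Φ e X ⁻¹' Λ = Λ := ext fun x => h.shiftPoint_mem_iff hb X
  exact (image_inter_preimage _ _ _).symm.trans (by rw [hpre])

theorem shift_inter_eq_image_freeze (h : IsShift Λ τ Φ e) (hb : Bornology.IsBounded Λ)
    (X : Config) : (shift Λ τ Φ e hb X).carrier ∩ Λ =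
      (fun x => x + freeze τ Φ (X.carrier ∩ Λ) x • e) '' (X.carrier ∩ Λ) :=
  (h.shift_inter hb X).trans <| EqOn.image_eq fun x hx => by
    simp only [shiftPoint, shiftTime_of_mem X hx.2]

end IsShift

namespace IsDualShift

theorem shiftTime_shift (hd : IsDualShift e τ Φ τ' Φ') (h : IsShift Λ τ Φ e)
    (h' : IsShift Λ τ' Φ' e') (hb : Bornology.IsBounded Λ) {X : Config} {x : Plane}
    (hx : x ∈ X.carrier) :
    shiftTime Λ τ' Φ' (shift Λ τ Φ e hb X) (shiftPoint Λ τ Φ e X x) = shiftTime Λ τ Φ X x := by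
  by_cases hxΛ : x ∈ Λ
  · rw [shiftTime_of_mem _ ((h.shiftPoint_mem_iff hb X).2 hxΛ),
      h.shift_inter_eq_image_freeze hb, shiftPoint, shiftTime_of_mem _ hxΛ]
    exact hd.freeze_image (X.finite_inter Λ hb) h.le_step h.strictMono h'.le_step h'.strictMono
      ⟨hx, hxΛ⟩
  · rw [shiftPoint_of_notMem _ hxΛ, shiftTime_of_notMem _ hxΛ, shiftTime_of_notMem _ hxΛ]

theorem leftInvOn_shiftPoint (hd : IsDualShift e τ Φ τ' Φ') (h : IsShift Λ τ Φ e)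
    (h' : IsShift Λ τ' Φ' (-e)) (hb : Bornology.IsBounded Λ) (X : Config) :
    LeftInvOn (shiftPoint Λ τ' Φ' (-e) (shift Λ τ Φ e hb X)) (shiftPoint Λ τ Φ e X)
      X.carrier := fun x hx => by
  rw [shiftPoint, hd.shiftTime_shift h h' hb hx, shiftPoint, smul_neg, add_neg_cancel_right]

theorem shift_shift (hd : IsDualShift e τ Φ τ' Φ') (h : IsShift Λ τ Φ e)
    (h' : IsShift Λ τ' Φ' (-e)) (hb : Bornology.IsBounded Λ) (X : Config) :
    shift Λ τ' Φ' (-e) hb (shift Λ τ Φ e hb X) = X :=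
  Config.ext (hd.leftInvOn_shiftPoint h h' hb X).image_image

theorem bijective_shift (hd : IsDualShift e τ Φ τ' Φ') (h : IsShift Λ τ Φ e)
    (h' : IsShift Λ τ' Φ' (-e)) (hb : Bornology.IsBounded Λ) :
    Function.Bijective (shift Λ τ Φ e hb) := by
  refine Function.bijective_iff_has_inverse.2
    ⟨shift Λ τ' Φ' (-e) hb, hd.shift_shift h h' hb, fun X => ?_⟩
  simpa only [neg_neg] using hd.symm.shift_shift h' (by rwa [neg_neg]) hb X

theorem measurable_shift (hd : IsDualShift e τ Φ τ' Φ') (h : IsShift Λ τ Φ e)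
    (h' : IsShift Λ τ' Φ' (-e)) (hΛ : MeasurableSet Λ) (hb : Bornology.IsBounded Λ) :
    Measurable (shift Λ τ Φ e hb) := by
  refine measurable_config_of_count fun B hB => ?_
  have hpoint : Measurable fun p : Config × Plane => shiftPoint Λ τ Φ e p.1 p.2 :=
    measurable_snd.add
      ((measurable_shiftTime hΛ hb h.measurable_base h.measurable_step).smul_const e)
  convert measurable_count_sections measurable_id
    (P := fun X x => shiftPoint Λ τ Φ e X x ∈ B) (hpoint hB) using 1
  ext1 X
  have hinj := (hd.leftInvOn_shiftPoint h h' hb X).injOn.mono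
    (inter_subset_left (t := shiftPoint Λ τ Φ e X ⁻¹' B))
  exact (congrArg encard (image_inter_preimage _ _ _).symm).trans hinj.encard_image

end IsDualShift

end Shift

section Profile

open scoped NNReal

/-- A base profile `τ` for the shift of particles in `Λ` together with the slack `F y x` that a
particle at `x` gains over a particle at `y`. -/
structure Profile (Λ : Set Plane) where
  τ : Plane → ℝ
  F : Plane → Plane → ℝ
  ρ : ℝ≥0
  ρ_lt_one : ρ < 1
  τ_nonneg : ∀ x, 0 ≤ τ x
  τ_lip : LipschitzWith ρ τ
  τ_off : ∀ x ∉ Λ, τ x = 0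
  τ_le_F : ∀ y ∉ Λ, ∀ x, τ x ≤ F y x
  F_nonneg : ∀ y x, 0 ≤ F y x
  F_pos : ∀ y x, 1 < dist y x → 0 < F y x
  F_eq_zero : ∀ y x, dist y x ≤ 1 → F y x = 0
  F_le : ∀ y x, 1 ≤ dist y x → F y x ≤ ρ * (dist y x - 1)
  F_lip_left : ∀ x, LipschitzWith ρ fun y => F y x
  F_lip_right : ∀ y, LipschitzWith ρ (F y)
  stay : ∀ e : Plane, ‖e‖ = 1 → ∀ x ∈ Λ, ∀ s, 0 ≤ s → s ≤ τ x → x + s • e ∈ Λ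
  bounded : Bornology.IsBounded Λ
  measurableSet : MeasurableSet Λ

namespace Profile

variable {Λ : Set Plane} (P : Profile Λ) {e : Plane}

/-- The relaxation step of a profile. -/
def step (y : Plane) (t : ℝ) (x : Plane) : ℝ := t + P.F y x

/-- The base profile of the inverse shift. -/
def dualBase (e x : Plane) : ℝ := fixPt fun s => P.τ (x - s • e)

/-- The relaxation step of the inverse shift. -/
def dualStep (e y : Plane) (t : ℝ) (x : Plane) : ℝ :=
  fixPt fun s => t + P.F (y - t • e) (x - s • e)

theorem continuous_F : Continuous fun p : Plane × Plane => P.F p.1 p.2 :=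
  (LipschitzWith.uncurry P.F_lip_left P.F_lip_right).continuous

theorem le_step (y : Plane) (t : ℝ) (x : Plane) : t ≤ P.step y t x :=
  le_add_of_nonneg_right (P.F_nonneg y x)

theorem strictMono_step (y x : Plane) : StrictMono fun t => P.step y t x :=
  strictMono_id.add_const _

theorem measurable_step : Measurable fun p : Plane × ℝ × Plane => P.step p.1 p.2.1 p.2.2 :=
  measurable_snd.fst.add (P.continuous_F.measurable.comp (measurable_fst.prodMk measurable_snd.snd))

theorem isShift (he : ‖e‖ = 1) : IsShift Λ P.τ P.step e where
  le_step := P.le_step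
  strictMono := P.strictMono_step
  nonneg := P.τ_nonneg
  stay := P.stay e he
  measurable_base := P.τ_lip.continuous.measurable
  measurable_step := P.measurable_step

theorem lipschitzWith_sub_smul (he : ‖e‖ = 1) (x : Plane) :
    LipschitzWith 1 fun s : ℝ => x - s • e :=
  LipschitzWith.of_dist_le_mul fun s s' => by
    rw [dist_sub_left, dist_eq_norm, ← sub_smul, norm_smul, he, mul_one, NNReal.coe_one, one_mul,
      dist_eq_norm]

theorem contractingWith_τ (he : ‖e‖ = 1) (x : Plane) :
    ContractingWith P.ρ fun s : ℝ => P.τ (x - s • e) :=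
  ⟨P.ρ_lt_one, by
    simpa only [mul_one, Function.comp_def] using P.τ_lip.comp (lipschitzWith_sub_smul he x)⟩

theorem contractingWith_F (he : ‖e‖ = 1) (y : Plane) (t : ℝ) (x : Plane) :
    ContractingWith P.ρ fun s : ℝ => t + P.F (y - t • e) (x - s • e) :=
  ⟨P.ρ_lt_one, by
    simpa only [zero_add, mul_one, Function.comp_def] using (LipschitzWith.const t).add
      ((P.F_lip_right (y - t • e)).comp (lipschitzWith_sub_smul he x))⟩

theorem isDualShift (he : ‖e‖ = 1) :
    IsDualShift e P.τ P.step (P.dualBase e) (P.dualStep e) where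
  le_base s x := by rw [dualBase, le_fixPt_iff (P.contractingWith_τ he _), add_sub_cancel_right]
  base_le s x := by rw [dualBase, fixPt_le_iff (P.contractingWith_τ he _), add_sub_cancel_right]
  le_step y t s x := by
    rw [dualStep, le_fixPt_iff (P.contractingWith_F he _ t _), add_sub_cancel_right,
      add_sub_cancel_right, step]
  step_le y t s x := by
    rw [dualStep, fixPt_le_iff (P.contractingWith_F he _ t _), add_sub_cancel_right,
      add_sub_cancel_right, step]

theorem strictMono_dualStep (he : ‖e‖ = 1) (y x : Plane) :
    StrictMono fun t => P.dualStep e y t x := by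
  intro t t' htt'
  have hfix := map_fixPt (P.contractingWith_F he y t x)
  simp only [dualStep]
  rw [← not_le, fixPt_le_iff (P.contractingWith_F he _ t' _), not_le]
  set r := fixPt fun s => t + P.F (y - t • e) (x - s • e)
  have hlip := ((P.F_lip_left (x - r • e)).comp (lipschitzWith_sub_smul he y)).dist_le_mul t t'
  simp only [Function.comp_apply, Real.dist_eq, mul_one] at hlip
  rw [abs_of_neg (sub_neg.2 htt')] at hlip
  have hρ : (P.ρ : ℝ) < 1 := P.ρ_lt_one
  nlinarith [(abs_le.1 hlip).2]

theorem isShift_dual (he : ‖e‖ = 1) : IsShift Λ (P.dualBase e) (P.dualStep e) (-e) where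
  le_step y t x := by
    rw [dualStep, le_fixPt_iff (P.contractingWith_F he _ t _)]
    exact le_add_of_nonneg_right (P.F_nonneg _ _)
  strictMono := P.strictMono_dualStep he
  nonneg x := by
    rw [dualBase, le_fixPt_iff (P.contractingWith_τ he _)]
    exact P.τ_nonneg _
  stay x hx s hs hs' := by
    rw [dualBase, le_fixPt_iff (P.contractingWith_τ he _)] at hs'
    rw [smul_neg, ← sub_eq_add_neg]
    by_contra hout
    rw [P.τ_off _ hout] at hs'
    rw [le_antisymm hs' hs, zero_smul, sub_zero] at hout
    exact hout hx
  measurable_base := measurable_fixPt (P.contractingWith_τ he) fun s =>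
    P.τ_lip.continuous.measurable.comp (measurable_id.sub_const _)
  measurable_step := measurable_fixPt (f := fun (p : Plane × ℝ × Plane) s =>
    p.2.1 + P.F (p.1 - p.2.1 • e) (p.2.2 - s • e)) (fun p => P.contractingWith_F he p.1 p.2.1 p.2.2)
    fun s => measurable_snd.fst.add (P.continuous_F.measurable.comp
      (f := fun p : Plane × ℝ × Plane => (p.1 - p.2.1 • e, p.2.2 - s • e)) (by fun_prop))

/-- The shift time of the particle `x` of `X`. -/
abbrev time (X : Config) (x : Plane) : ℝ := shiftTime Λ P.τ P.step X x

/-- The shift of the particles in `Λ` in direction `e`. -/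
abbrev move (e : Plane) : Config → Config := shift Λ P.τ P.step e P.bounded

theorem carrier_move_neg (e : Plane) (X : Config) :
    (P.move (-e) X).carrier = (fun x => x - P.time X x • e) '' X.carrier :=
  image_congr fun x _ => by rw [shiftPoint, smul_neg, sub_eq_add_neg]

/-- The inverse of `Profile.move`. -/
abbrev unmove (e : Plane) : Config → Config :=
  shift Λ (P.dualBase e) (P.dualStep e) (-e) P.bounded

theorem unmove_move (he : ‖e‖ = 1) (X : Config) : P.unmove e (P.move e X) = X :=
  (P.isDualShift he).shift_shift (P.isShift he) (P.isShift_dual he) P.bounded X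

theorem bijective_move (he : ‖e‖ = 1) : Function.Bijective (P.move e) :=
  (P.isDualShift he).bijective_shift (P.isShift he) (P.isShift_dual he) P.bounded

theorem measurable_move (he : ‖e‖ = 1) : Measurable (P.move e) :=
  (P.isDualShift he).measurable_shift (P.isShift he) (P.isShift_dual he) P.measurableSet P.bounded

theorem measurable_unmove (he : ‖e‖ = 1) : Measurable (P.unmove e) :=
  (P.isDualShift he).symm.measurable_shift (P.isShift_dual he) (by simpa using P.isShift he)
    P.measurableSet P.bounded

theorem time_nonneg (X : Config) (x : Plane) : 0 ≤ P.time X x :=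
  shiftTime_nonneg P.bounded P.τ_nonneg P.le_step X x

theorem time_le (X : Config) (x : Plane) : P.time X x ≤ P.τ x :=
  shiftTime_le P.bounded P.τ_nonneg X x

theorem time_le_add (X : Config) (x : Plane) {y : Plane} (hy : y ∈ X.carrier) :
    P.time X x ≤ P.time X y + P.F y x := by
  by_cases hyΛ : y ∈ Λ
  · by_cases hxΛ : x ∈ Λ
    · rw [time, time, shiftTime_of_mem _ hxΛ, shiftTime_of_mem _ hyΛ]
      exact freeze_le_of_mem (X.finite_inter Λ P.bounded) P.le_step x ⟨hy, hyΛ⟩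
    · rw [time, shiftTime_of_notMem _ hxΛ]
      exact add_nonneg (P.time_nonneg X y) (P.F_nonneg y x)
  · rw [time, time, shiftTime_of_notMem _ hyΛ, zero_add]
    exact (P.time_le X x).trans (P.τ_le_F y hyΛ x)

theorem F_le_dist (y x : Plane) : P.F y x ≤ P.ρ * dist y x := by
  rcases le_total (dist y x) 1 with h | h
  · rw [P.F_eq_zero y x h]
    positivity
  · exact (P.F_le y x h).trans (mul_le_mul_of_nonneg_left (by linarith) P.ρ.coe_nonneg)

theorem abs_time_sub_le (X : Config) {x y : Plane} (hx : x ∈ X.carrier) (hy : y ∈ X.carrier) :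
    |P.time X x - P.time X y| ≤ P.ρ * dist x y := by
  have hFyx := P.F_le_dist y x
  rw [dist_comm] at hFyx
  exact abs_sub_le_iff.2 ⟨by linarith [P.time_le_add X x hy],
    by linarith [P.time_le_add X y hx, P.F_le_dist x y]⟩

-- Only the later of the two particles can come closer, and the time it gains over the earlier one
-- is less than the distance in excess of `1`.
theorem one_lt_dist_shiftPoint_of_le (he : ‖e‖ = 1) {X : Config} {x y : Plane}
    (hy : y ∈ X.carrier) (hle : P.time X y ≤ P.time X x) (h : 1 < dist y x) :
    1 < dist (shiftPoint Λ P.τ P.step e X y) (shiftPoint Λ P.τ P.step e X x) := by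
  set y' := shiftPoint Λ P.τ P.step e X y with hy'
  set x' := shiftPoint Λ P.τ P.step e X x with hx'
  have htri : dist y x ≤ dist y' x' + (P.time X x - P.time X y) := by
    have hsub : y - x = (y' - x') + (P.time X x - P.time X y) • e := by
      simp only [hy', hx', shiftPoint, sub_smul]
      abel
    rw [dist_eq_norm, dist_eq_norm, hsub]
    refine (norm_add_le _ _).trans_eq ?_
    rw [norm_smul, he, mul_one, Real.norm_of_nonneg (sub_nonneg.2 hle)]
  have hρ : (P.ρ : ℝ) < 1 := P.ρ_lt_one
  nlinarith [P.time_le_add X x hy, P.F_le y x h.le]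

theorem one_lt_dist_shiftPoint (he : ‖e‖ = 1) {X : Config} {x y : Plane}
    (hx : x ∈ X.carrier) (hy : y ∈ X.carrier) (h : 1 < dist x y) :
    1 < dist (shiftPoint Λ P.τ P.step e X x) (shiftPoint Λ P.τ P.step e X y) := by
  rcases le_total (P.time X y) (P.time X x) with hle | hle
  · rw [dist_comm] at h ⊢
    exact P.one_lt_dist_shiftPoint_of_le he hy hle h
  · exact P.one_lt_dist_shiftPoint_of_le he hx hle h

theorem dist_shiftPoint_of_dist_le_one {X : Config} {x y : Plane} (hx : x ∈ X.carrier)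
    (hy : y ∈ X.carrier) (h : dist x y ≤ 1) :
    dist (shiftPoint Λ P.τ P.step e X x) (shiftPoint Λ P.τ P.step e X y) = dist x y := by
  have hxy := P.time_le_add X x hy
  have hyx := P.time_le_add X y hx
  rw [P.F_eq_zero _ _ (by rwa [dist_comm]), add_zero] at hxy
  rw [P.F_eq_zero _ _ h, add_zero] at hyx
  have heq : P.time X x = P.time X y := hxy.antisymm hyx
  simp only [shiftPoint, heq, dist_add_right]

theorem move_mem_hardCore_iff (he : ‖e‖ = 1) (X : Config) :
    P.move e X ∈ hardCore ↔ X ∈ hardCore := by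
  constructor
  · intro h x hx y hy hxy
    have hinj := ((P.isDualShift he).leftInvOn_shiftPoint (P.isShift he) (P.isShift_dual he)
      P.bounded X).injOn
    by_contra! hle
    have hlt := h _ (mem_image_of_mem _ hx) _ (mem_image_of_mem _ hy) (hinj.ne hx hy hxy)
    rw [P.dist_shiftPoint_of_dist_le_one hx hy hle] at hlt
    exact hlt.not_ge hle
  · rintro h _ ⟨x, hx, rfl⟩ _ ⟨y, hy, rfl⟩ hxy
    exact P.one_lt_dist_shiftPoint he hx hy (h x hx y hy fun hxy' => hxy (hxy' ▸ rfl))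

theorem image_hardCore (he : ‖e‖ = 1) : P.move e '' hardCore = hardCore := by
  have hpre : P.move e ⁻¹' hardCore = hardCore := ext (P.move_mem_hardCore_iff he)
  conv_lhs => rw [← hpre, image_preimage_eq _ (P.bijective_move he).2]

end Profile

end Profile

/-! ### Triangular determinants and derivatives -/

section Det

theorem det_eq_prod_diag_of_forall_le {ι α R : Type*} [Fintype ι] [DecidableEq ι] [LinearOrder α]
    [CommRing R] (M : Matrix ι ι R) (t : ι → α) (h : ∀ i j, j ≠ i → t i ≤ t j → M i j = 0) :
    M.det = ∏ i, M i i := by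
  have htri : M.transpose.BlockTriangular t := fun i j hij =>
    h j i (fun heq => hij.ne (congrArg t heq.symm)) hij.le
  have hblock : ∀ a, (M.transpose.toSquareBlock t a).det = ∏ i : {i // t i = a}, M i i := by
    intro a
    rw [← Matrix.det_diagonal]
    congr 1
    ext i j
    rcases eq_or_ne i j with rfl | hij
    · simp [Matrix.toSquareBlock_def]
    · rw [Matrix.diagonal_apply_ne _ hij]
      exact h j i (fun heq => hij (Subtype.ext heq)) (j.2.trans i.2.symm).le
  rw [← Matrix.det_transpose, htri.det]
  simp only [hblock]
  rw [← Finset.prod_fiberwise_of_maps_to (t := Finset.univ.image t) (g := t)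
    fun i _ => Finset.mem_image_of_mem t (Finset.mem_univ i)]
  exact Finset.prod_congr rfl fun a _ =>
    (Finset.prod_subtype _ (fun i => by simp) fun i => M i i).symm

theorem det_one_add_comp_comm {K V W : Type*} [Field K] [AddCommGroup V] [Module K V]
    [AddCommGroup W] [Module K W] [FiniteDimensional K V] [FiniteDimensional K W]
    (A : W →ₗ[K] V) (B : V →ₗ[K] W) :
    LinearMap.det (1 + A ∘ₗ B) = LinearMap.det (1 + B ∘ₗ A) := by
  let b := Module.finBasis K V
  let c := Module.finBasis K W
  rw [← LinearMap.det_toMatrix b, ← LinearMap.det_toMatrix c, map_add, map_add,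
    LinearMap.toMatrix_comp b c b, LinearMap.toMatrix_comp c b c, LinearMap.toMatrix_one,
    LinearMap.toMatrix_one, Matrix.det_one_add_mul_comm]

theorem det_eq_prod_of_apply_eq_add_smul {ι α K V : Type*} [Fintype ι] [DecidableEq ι]
    [LinearOrder α] [Field K] [AddCommGroup V] [Module K V] [FiniteDimensional K V] (e : V)
    (ℓ : ι → (ι → V) →ₗ[K] K) (A : (ι → V) →ₗ[K] (ι → V))
    (hA : ∀ v i, A v i = v i + ℓ i v • e) (t : ι → α)
    (hℓ : ∀ i j, j ≠ i → t i ≤ t j → ℓ i (Pi.single j e) = 0) :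
    LinearMap.det A = ∏ i, (1 + ℓ i (Pi.single i e)) := by
  let B : (ι → V) →ₗ[K] (ι → K) := LinearMap.pi ℓ
  let U : (ι → K) →ₗ[K] (ι → V) := LinearMap.pi fun i => (LinearMap.proj i).smulRight e
  have hAUB : A = 1 + U ∘ₗ B := LinearMap.ext fun v => funext fun i => hA v i
  have hU : ∀ j, U (Pi.single j 1) = Pi.single j e := fun j => by
    ext i
    change (Pi.single j (1 : K) : ι → K) i • e = _
    rcases eq_or_ne i j with rfl | hij
    · simp
    · simp [hij]
  have hM : ∀ i j, LinearMap.toMatrix' (1 + B ∘ₗ U) i j =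
      (1 : Matrix ι ι K) i j + ℓ i (Pi.single j e) := fun i j => by
    rw [map_add, LinearMap.toMatrix'_one, Matrix.add_apply, LinearMap.toMatrix'_apply,
      LinearMap.comp_apply, hU]
    rfl
  rw [hAUB, det_one_add_comp_comm, ← LinearMap.det_toMatrix', det_eq_prod_diag_of_forall_le _ t]
  · simp only [hM, Matrix.one_apply_eq]
  · intro i j hji hij
    rw [hM, hℓ i j hji hij, Matrix.one_apply_ne hji.symm, add_zero]

end Det

section Calculus

open Filter Topology

theorem abs_deriv_le_of_forall_sub_le {f : ℝ → ℝ} {a b : ℝ} (hb : 0 ≤ b)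
    (h : ∀ s, f a - f s ≤ b * |s - a|) : |deriv f a| ≤ b := by
  by_cases hf : DifferentiableAt ℝ f a
  · obtain ⟨hleft, hright⟩ := hasDerivAt_iff_tendsto_slope_left_right.1 hf.hasDerivAt
    refine abs_le.2 ⟨?_, ?_⟩
    · refine ge_of_tendsto hright (eventually_of_mem self_mem_nhdsWithin fun s (hs : a < s) => ?_)
      have hlip := h s
      rw [abs_of_pos (sub_pos.2 hs)] at hlip
      rw [slope_def_field, le_div_iff₀ (sub_pos.2 hs)]
      linarith
    · refine le_of_tendsto hleft (eventually_of_mem self_mem_nhdsWithin fun s (hs : s < a) => ?_)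
      have hlip := h s
      rw [abs_of_neg (sub_neg.2 hs)] at hlip
      rw [slope_def_field, div_le_iff_of_neg (sub_neg.2 hs)]
      linarith
  · rwa [deriv_zero_of_not_differentiableAt hf, abs_zero]

theorem fderiv_apply_eq_of_touch {V : Type*} [NormedAddCommGroup V] [NormedSpace ℝ V] {f : V → ℝ}
    {f' : V →L[ℝ] ℝ} {x v : V} (hf : HasFDerivAt f f' x) {g : ℝ → ℝ} {g' : ℝ}
    (hg : HasDerivAt g g' 0) (hle : ∀ s, f (x + s • v) ≤ g s) (heq : f x = g 0) : f' v = g' := by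
  have hline : HasDerivAt (fun s : ℝ => f (x + s • v)) (f' v) 0 := hf.hasLineDerivAt v
  have hmax : IsLocalMax ((fun s : ℝ => f (x + s • v)) - g) 0 := by
    refine Eventually.of_forall fun s => ?_
    simp only [Pi.sub_apply, zero_smul, add_zero, heq, sub_self]
    exact sub_nonpos.2 (hle s)
  exact sub_eq_zero.1 (hmax.hasDerivAt_eq_zero (hline.sub hg))

theorem addHaar_image_eq_zero_of_lipschitzWith {V : Type*} [NormedAddCommGroup V]
    [NormedSpace ℝ V] [FiniteDimensional ℝ V] [MeasurableSpace V] [BorelSpace V] (μ : Measure V)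
    [μ.IsAddHaarMeasure] {K : NNReal} {f : V → V} (hf : LipschitzWith K f) {s : Set V}
    (hs : μ s = 0) : μ (f '' s) = 0 := by
  have himage := hf.hausdorffMeasure_image_le (Module.finrank ℝ V).cast_nonneg s
  rw [Measure.absolutelyContinuous_isAddHaarMeasure (Measure.hausdorffMeasure _) μ hs, mul_zero]
    at himage
  exact Measure.absolutelyContinuous_isAddHaarMeasure μ (Measure.hausdorffMeasure _)
    (le_antisymm himage bot_le)

end Calculus

/-! ### Tuples of particles and the Jacobian -/

section Tuple

namespace Profile

open scoped NNReal

variable {Λ : Set Plane} (P : Profile Λ) {e : Plane}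

/-- The shift times of the particles of a tuple. -/
def tupleTime {ι : Type*} (x : ι → Plane) (i : ι) : ℝ := freeze P.τ P.step (range x) (x i)

/-- The shift of a tuple of particles. -/
def moveTuple {ι : Type*} (e : Plane) (x : ι → Plane) (i : ι) : Plane :=
  x i + P.tupleTime x i • e

variable {ι : Type*}

theorem tupleTime_le [Finite ι] (x : ι → Plane) (i : ι) : P.tupleTime x i ≤ P.τ (x i) :=
  freeze_le (finite_range x) _

theorem tupleTime_le_add [Finite ι] (x : ι → Plane) (i j : ι) :
    P.tupleTime x i ≤ P.tupleTime x j + P.F (x j) (x i) :=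
  freeze_le_of_mem (finite_range x) P.le_step _ (mem_range_self j)

theorem tupleTime_eq_or [Finite ι] (x : ι → Plane) (i : ι) :
    P.tupleTime x i = P.τ (x i) ∨
      ∃ j, x j ≠ x i ∧ P.tupleTime x i = P.tupleTime x j + P.F (x j) (x i) :=
  (freeze_eq_or (τ := P.τ) (finite_range x) P.le_step P.strictMono_step (x i)).imp_right
    exists_range_iff.1

/-- The displacement of a tuple whose `i`-th particle moves by `t i` in direction `e`. -/
def displacement (ι : Type*) (e : Plane) : (ι → ℝ) →L[ℝ] ι → Plane :=
  ContinuousLinearMap.pi fun i => (ContinuousLinearMap.proj i).smulRight e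

theorem hasFDerivAt_moveTuple [Finite ι] (e : Plane) {x : ι → Plane}
    {L : (ι → Plane) →L[ℝ] ι → ℝ} (hL : HasFDerivAt P.tupleTime L x) :
    HasFDerivAt (P.moveTuple e)
      (ContinuousLinearMap.id ℝ (ι → Plane) + (displacement ι e).comp L) x :=
  have := Fintype.ofFinite ι
  (hasFDerivAt_id x).add ((displacement ι e).hasFDerivAt.comp x hL)

theorem fderiv_tupleTime_eq_zero [Finite ι] {x : ι → Plane}
    (hx : Pairwise fun i j => 1 < dist (x i) (x j)) {L : (ι → Plane) →L[ℝ] ι → ℝ}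
    (hL : HasFDerivAt P.tupleTime L x) (i : ι) (v : ι → Plane) (hvi : v i = 0)
    (hv : ∀ j, P.tupleTime x j < P.tupleTime x i → v j = 0) : L v i = 0 := by
  have := Fintype.ofFinite ι
  have hcoord := hasFDerivAt_pi'.1 hL
  suffices hfreeze : ∀ a, ∀ i, x i = a → ∀ v : ι → Plane, v i = 0 →
      (∀ j, P.tupleTime x j < P.tupleTime x i → v j = 0) → L v i = 0 from
    hfreeze _ i rfl v hvi hv
  refine freeze_induction (τ := P.τ) (finite_range x) P.le_step P.strictMono_step ?_ ?_
  · rintro _ hbase i rfl v hvi -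
    refine fderiv_apply_eq_of_touch (hcoord i) (hasDerivAt_const 0 (P.τ (x i)))
      (fun s => ?_) hbase
    simpa [hvi] using P.tupleTime_le (x + s • v) i
  · rintro _ _ ⟨j, rfl⟩ ih hstep i rfl v hvi hv
    rcases eq_or_ne j i with rfl | hji
    · exact ih j rfl v hvi hv
    have htime : P.tupleTime x i = P.tupleTime x j + P.F (x j) (x i) := hstep
    have hlt : P.tupleTime x j < P.tupleTime x i := by linarith [P.F_pos _ _ (hx hji)]
    have hdiff : L v i - L v j = 0 := by
      refine fderiv_apply_eq_of_touch ((hcoord i).sub (hcoord j))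
        (hasDerivAt_const 0 (P.F (x j) (x i))) (fun s => ?_) ?_
      · have hle := P.tupleTime_le_add (x + s • v) i j
        simp only [Pi.add_apply, Pi.smul_apply, hvi, hv j hlt, smul_zero, add_zero] at hle
        simp only [Pi.sub_apply]
        linarith
      · simp only [Pi.sub_apply]
        linarith
    rwa [ih j rfl v (hv j hlt) fun l hl => hv l (hl.trans hlt), sub_zero] at hdiff

variable [Fintype ι]

theorem τ_le_add (x x' : ι → Plane) (i : ι) : P.τ (x i) ≤ P.τ (x' i) + P.ρ * dist x x' := by
  have hτ := (le_abs_self _).trans (P.τ_lip.dist_le_mul (x i) (x' i))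
  have hdist := mul_le_mul_of_nonneg_left (dist_le_pi_dist x x' i) P.ρ.coe_nonneg
  linarith

theorem F_le_add (x x' : ι → Plane) (i j : ι) :
    P.F (x j) (x i) ≤ P.F (x' j) (x' i) + (P.ρ + P.ρ : ℝ≥0) * dist x x' := by
  have hF := (le_abs_self _).trans ((LipschitzWith.uncurry P.F_lip_left P.F_lip_right).dist_le_mul
    (x j, x i) (x' j, x' i))
  have hdist : dist (x j, x i) (x' j, x' i) ≤ dist x x' :=
    max_le (dist_le_pi_dist x x' j) (dist_le_pi_dist x x' i)
  have hmul := mul_le_mul_of_nonneg_left hdist (P.ρ + P.ρ).coe_nonneg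
  simp only [Function.uncurry_apply_pair] at hF
  linarith

theorem exists_relax_le (m : ℕ) : ∃ C : ℝ≥0, ∀ (x x' : ι → Plane) (i : ι),
    relax P.τ P.step (range x) m (x i) ≤
      relax P.τ P.step (range x') m (x' i) + C * dist x x' := by
  induction m with
  | zero => exact ⟨P.ρ, P.τ_le_add⟩
  | succ m ih =>
    obtain ⟨C, hC⟩ := ih
    refine ⟨C + (P.ρ + P.ρ), fun x x' i => ?_⟩
    rw [NNReal.coe_add, add_mul]
    rcases relax_succ_eq_or P.τ P.step (finite_range x') m (x' i) with
      hstay | ⟨_, ⟨j, rfl⟩, hdrop⟩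
    · have hx := relax_succ_le (τ := P.τ) (Φ := P.step) (finite_range x) m (x i)
      have hnonneg : 0 ≤ ((P.ρ + P.ρ : ℝ≥0) : ℝ) * dist x x' := by positivity
      linarith [hC x x' i]
    · have hx := relax_succ_le_of_mem (τ := P.τ) (Φ := P.step) (finite_range x) m (x i)
        (mem_range_self j)
      simp only [step] at hx hdrop
      linarith [hC x x' j, P.F_le_add x x' i j]

theorem tupleTime_eq_relax (x : ι → Plane) (i : ι) :
    P.tupleTime x i = relax P.τ P.step (range x) (Fintype.card ι) (x i) := by
  refine (relax_eq_freeze (finite_range x) P.le_step ?_ _).symm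
  rw [← image_univ, ← Nat.card_eq_fintype_card, ← ncard_univ]
  exact ncard_image_le finite_univ

variable (ι) in
theorem exists_lipschitzWith_tupleTime :
    ∃ C, LipschitzWith C (P.tupleTime : (ι → Plane) → ι → ℝ) := by
  obtain ⟨C, hC⟩ := P.exists_relax_le (ι := ι) (Fintype.card ι)
  refine ⟨C, LipschitzWith.of_dist_le_mul fun x x' =>
    (dist_pi_le_iff (by positivity)).2 fun i => ?_⟩
  have hx := hC x x' i
  have hx' := hC x' x i
  rw [dist_comm] at hx'
  rw [tupleTime_eq_relax, tupleTime_eq_relax, Real.dist_eq, abs_sub_le_iff]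
  constructor <;> linarith

variable (ι) in
theorem exists_lipschitzWith_moveTuple (e : Plane) :
    ∃ C, LipschitzWith C (P.moveTuple e : (ι → Plane) → ι → Plane) := by
  obtain ⟨C, hC⟩ := P.exists_lipschitzWith_tupleTime ι
  exact ⟨_, LipschitzWith.id.add ((displacement ι e).lipschitz.comp hC)⟩

end Profile

end Tuple

section Slope

namespace Profile

variable {Λ : Set Plane} (P : Profile Λ)

/-- The set of particles of `X` that determine the shift time at `x`. -/
def active (X : Config) (x : Plane) : Set Plane :=
  {y | y ∈ Λ ∧ P.time X y < P.time X x ∧ P.time X x = P.time X y + P.F y x}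

open scoped Classical in
/-- The derivative in direction `e` of the shift time of the particle `x` of `X`. Where several
particles determine the shift time their contributions are averaged, which keeps the slope
measurable; they all agree wherever the shift time is differentiable. -/
def slope (e : Plane) (X : Config) (x : Plane) : ℝ :=
  if P.time X x = P.τ x then deriv (fun s : ℝ => P.τ (x + s • e)) 0
  else ⨍ y in P.active X x, deriv (fun s : ℝ => P.F y (x + s • e)) 0 ∂(pts X)

/-- The Jacobian of the shift in direction `e`. -/
def jacobian (e : Plane) (X : Config) : ℝ :=
  Real.exp (∫ x in Λ, Real.log (1 + P.slope e X x) ∂(pts X))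

theorem measurable_time : Measurable fun p : Config × Plane => P.time p.1 p.2 :=
  measurable_shiftTime P.measurableSet P.bounded P.τ_lip.continuous.measurable
    P.measurable_step

theorem measurableSet_active :
    MeasurableSet {p : (Config × Plane) × Plane | p.2 ∈ P.active p.1.1 p.1.2} := by
  have hx : Measurable fun p : (Config × Plane) × Plane => P.time p.1.1 p.1.2 :=
    P.measurable_time.comp measurable_fst
  have hy : Measurable fun p : (Config × Plane) × Plane => P.time p.1.1 p.2 :=
    P.measurable_time.comp (measurable_fst.fst.prodMk measurable_snd)
  have hF : Measurable fun p : (Config × Plane) × Plane => P.F p.2 p.1.2 :=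
    P.continuous_F.measurable.comp (measurable_snd.prodMk measurable_fst.snd)
  exact (measurable_snd P.measurableSet).inter
    ((measurableSet_lt hy hx).inter (measurableSet_eq_fun hx (hy.add hF)))

theorem measurable_deriv_τ (e : Plane) :
    Measurable fun x => deriv (fun s : ℝ => P.τ (x + s • e)) 0 :=
  (measurable_deriv_with_param (f := fun (x : Plane) (s : ℝ) => P.τ (x + s • e))
    (P.τ_lip.continuous.comp (by fun_prop))).comp (measurable_id.prodMk measurable_const)

theorem measurable_deriv_F (e : Plane) :
    Measurable fun p : Plane × Plane => deriv (fun s : ℝ => P.F p.1 (p.2 + s • e)) 0 :=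
  (measurable_deriv_with_param (f := fun (p : Plane × Plane) (s : ℝ) => P.F p.1 (p.2 + s • e))
    (P.continuous_F.comp (f := fun q : (Plane × Plane) × ℝ => (q.1.1, q.1.2 + q.2 • e))
      (by fun_prop))).comp (measurable_id.prodMk measurable_const)

theorem measurable_slope (e : Plane) :
    Measurable fun p : Config × Plane => P.slope e p.1 p.2 := by
  classical
  have hact := P.measurableSet_active
  refine Measurable.ite (measurableSet_eq_fun P.measurable_time
    (P.τ_lip.continuous.measurable.comp measurable_snd))
    ((P.measurable_deriv_τ e).comp measurable_snd) ?_
  simp only [setAverage_eq, measureReal_def, smul_eq_mul]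
  refine Measurable.mul ?_ ?_
  · exact (Kernel.measurable_kernel_prodMk_left
      (κ := pts.comap (Prod.fst : Config × Plane → Config) measurable_fst) hact).ennreal_toReal.inv
  · have hF : Measurable fun q : (Config × Plane) × Plane =>
        deriv (fun s : ℝ => P.F q.2 (q.1.2 + s • e)) 0 :=
      (P.measurable_deriv_F e).comp (measurable_snd.prodMk measurable_fst.snd)
    have hmeas := ((hF.indicator hact).stronglyMeasurable).integral_kernel_prod_right'
      (κ := pts.comap (Prod.fst : Config × Plane → Config) measurable_fst)
    convert hmeas.measurable using 1
    ext p
    rw [← integral_indicator (show MeasurableSet (P.active p.1 p.2) from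
      measurable_prodMk_left (x := p) hact)]
    rfl

theorem measurable_jacobian (e : Plane) : Measurable (P.jacobian e) := by
  have hlog : Measurable fun p : Config × Plane => Real.log (1 + P.slope e p.1 p.2) :=
    Real.measurable_log.comp ((P.measurable_slope e).const_add 1)
  exact Real.measurable_exp.comp
    (hlog.stronglyMeasurable.integral_kernel_prod_right'
      (κ := pts.restrict P.measurableSet)).measurable

theorem jacobian_pos (e : Plane) (X : Config) : 0 < P.jacobian e X := Real.exp_pos _

theorem pts_active_lt_top (X : Config) (x : Plane) : pts X (P.active X x) < ∞ := by
  have hm : MeasurableSet (P.active X x) :=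
    measurable_prodMk_left (x := (X, x)) P.measurableSet_active
  rw [pts_apply_apply _ hm, ENat.toENNReal_lt_top]
  exact ((X.finite_inter Λ P.bounded).subset
    (inter_subset_inter_right _ fun y hy => hy.1)).encard_lt_top

theorem abs_slope_le {e x : Plane} {b : ℝ} (hb : 0 ≤ b)
    (hτ : ∀ s : ℝ, P.τ x - P.τ (x + s • e) ≤ b * |s|)
    (hF : ∀ y, ∀ s : ℝ, P.F y x - P.F y (x + s • e) ≤ b * |s|) (X : Config) :
    |P.slope e X x| ≤ b := by
  rw [slope]
  split_ifs
  · exact abs_deriv_le_of_forall_sub_le hb (by simpa using hτ)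
  · have hderiv : ∀ y ∈ P.active X x, ‖deriv (fun s : ℝ => P.F y (x + s • e)) 0‖ ≤ b :=
      fun y _ => abs_deriv_le_of_forall_sub_le hb (by simpa using hF y)
    have hbound := norm_setIntegral_le_of_norm_le_const (P.pts_active_lt_top X x) hderiv
    rw [setAverage_eq, smul_eq_mul, abs_mul, abs_of_nonneg (by positivity), ← Real.norm_eq_abs]
    exact inv_mul_le_of_le_mul₀ measureReal_nonneg hb (by rwa [mul_comm])

theorem abs_slope_le_ρ {e : Plane} (he : ‖e‖ = 1) (X : Config) (x : Plane) :
    |P.slope e X x| ≤ P.ρ := by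
  have hlip : ∀ {f : Plane → ℝ}, LipschitzWith P.ρ f → ∀ s : ℝ,
      f x - f (x + s • e) ≤ P.ρ * |s| := fun hf s => by
    simpa [norm_smul, he] using (le_abs_self _).trans (hf.dist_le_mul x (x + s • e))
  exact P.abs_slope_le P.ρ.coe_nonneg (hlip P.τ_lip) (fun y => hlip (P.F_lip_right y)) X

theorem slope_neg (e : Plane) (X : Config) (x : Plane) : P.slope (-e) X x = -P.slope e X x := by
  have hderiv : ∀ f : Plane → ℝ, deriv (fun s : ℝ => f (x + s • -e)) 0 =
      -deriv (fun s : ℝ => f (x + s • e)) 0 := fun f => by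
    simpa using deriv_comp_neg (fun s : ℝ => f (x + s • e)) 0
  simp only [slope, hderiv]
  split_ifs
  · rfl
  · rw [setAverage_eq, setAverage_eq, integral_neg, smul_neg]

end Profile

end Slope

/-! ### The derivative of the shift of a tuple -/

section Tuples

theorem glue_inter {Λ : Set Plane} (Y : Config) {k : ℕ} {x : Fin k → Plane} (hx : ∀ i, x i ∈ Λ) :
    (Config.glue Λ Y x).carrier ∩ Λ = range x := by
  rw [Config.glue, union_inter_distrib_right, sdiff_inter_self, union_empty,
    inter_eq_left.2 (range_subset_iff.2 hx)]

theorem setIntegral_pts {Λ : Set Plane} (hΛ : MeasurableSet Λ) (hb : Bornology.IsBounded Λ)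
    (X : Config) (f : Plane → ℝ) :
    ∫ x in Λ, f x ∂(pts X) = ∑ x ∈ (X.finite_inter Λ hb).toFinset, f x := by
  have hrestrict : (pts X).restrict Λ =
      Measure.count.restrict (X.finite_inter Λ hb).toFinset := by
    rw [Finite.coe_toFinset, inter_comm]
    exact Measure.restrict_restrict hΛ
  rw [hrestrict, setIntegral_finset]
  · simp [Measure.real]
  · rw [← biUnion_of_singleton ((X.finite_inter Λ hb).toFinset : Set Plane),
      integrableOn_finite_biUnion (Finset.finite_toSet _)]
    exact fun x _ => integrableOn_singleton (hx := by simp)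

theorem ae_injective {ι V : Type*} [Finite ι] [NormedAddCommGroup V] [NormedSpace ℝ V]
    [FiniteDimensional ℝ V] [Nontrivial V] [MeasurableSpace V] [BorelSpace V]
    (μ : Measure (ι → V)) [μ.IsAddHaarMeasure] : ∀ᵐ x ∂μ, Function.Injective x := by
  classical
  have := Fintype.ofFinite ι
  have := FiniteDimensional.proper ℝ V
  have hpair : ∀ i j, i ≠ j → ∀ᵐ x ∂μ, x i ≠ x j := by
    intro i j hij
    let L : (ι → V) →ₗ[ℝ] V :=
      (LinearMap.proj i : (ι → V) →ₗ[ℝ] V) - LinearMap.proj j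
    obtain ⟨v, hv⟩ := exists_ne (0 : V)
    have hL : LinearMap.ker L ≠ ⊤ := fun htop => hv <| by
      have hmem : Pi.single i v ∈ LinearMap.ker L := htop ▸ Submodule.mem_top
      simpa [L, hij.symm] using hmem
    filter_upwards [measure_eq_zero_iff_ae_notMem.1 (μ.addHaar_submodule _ hL)] with x hx hxij
    exact hx (by simp [L, hxij])
  have hall : ∀ᵐ x ∂μ, ∀ i j, i ≠ j → x i ≠ x j :=
    ae_all_iff.2 fun i => ae_all_iff.2 fun j => Filter.eventually_imp_distrib_left.2 (hpair i j)
  filter_upwards [hall] with x hx i j hij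
  exact not_imp_not.1 (hx i j) hij

/-- Tuples in `Λ` which together with the particles of `Y` outside `Λ` are hard-core. -/
def hardTuples (Λ : Set Plane) (Y : Config) (k : ℕ) : Set (Fin k → Plane) :=
  univ.pi (fun _ => Λ) ∩ Config.glue Λ Y ⁻¹' hardCore

variable {Λ : Set Plane} {Y : Config} {k : ℕ} {x : Fin k → Plane}

theorem mem_of_mem_hardTuples (hx : x ∈ hardTuples Λ Y k) (i : Fin k) : x i ∈ Λ :=
  hx.1 i (mem_univ i)

theorem measurableSet_hardTuples (hΛ : MeasurableSet Λ) (Y : Config) (k : ℕ) :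
    MeasurableSet (hardTuples Λ Y k) :=
  (MeasurableSet.univ_pi fun _ => hΛ).inter (measurable_glue Λ Y k measurableSet_hardCore)

/-- The injective hard-core tuples; they are almost all of `hardTuples`, and their entries are at
mutual distance larger than one. -/
def properTuples (Λ : Set Plane) (Y : Config) (k : ℕ) : Set (Fin k → Plane) :=
  hardTuples Λ Y k ∩ {x | Function.Injective x}

theorem one_lt_dist_of_mem_properTuples (hx : x ∈ properTuples Λ Y k) :
    Pairwise fun i j => 1 < dist (x i) (x j) :=
  fun i j hij => hx.1.2 _ (Or.inl ⟨i, rfl⟩) _ (Or.inl ⟨j, rfl⟩) (hx.2.ne hij)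

theorem measurableSet_properTuples (hΛ : MeasurableSet Λ) (Y : Config) (k : ℕ) :
    MeasurableSet (properTuples Λ Y k) := by
  have hinj : {x : Fin k → Plane | Function.Injective x} =
      ⋂ i, ⋂ j, ⋂ _ : i ≠ j, {x | x i = x j}ᶜ := by
    ext x
    simp only [mem_iInter, mem_compl_iff, mem_ofPred_eq, Function.Injective]
    exact ⟨fun h i j hij hx => hij (h hx), fun h i j hx => by_contra fun hij => h i j hij hx⟩
  rw [properTuples, hinj]
  exact (measurableSet_hardTuples hΛ Y k).inter <|
    .iInter fun i => .iInter fun j => .iInter fun _ => (measurableSet_eq_fun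
      (measurable_pi_apply i) (measurable_pi_apply j)).compl

theorem properTuples_ae_eq (Λ : Set Plane) (Y : Config) (k : ℕ) :
    properTuples Λ Y k =ᵐ[volume] hardTuples Λ Y k := by
  refine Filter.EventuallyLE.antisymm (Filter.Eventually.of_forall inter_subset_left) ?_
  filter_upwards [ae_injective (volume : Measure (Fin k → Plane))] with x hx hmem
  exact ⟨hmem, hx⟩

end Tuples

section MoveTuple

namespace Profile

variable {Λ : Set Plane} (P : Profile Λ) {e : Plane} {k : ℕ} {x : Fin k → Plane}

theorem time_glue (Y : Config) (hx : ∀ i, x i ∈ Λ) (i : Fin k) :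
    P.time (Config.glue Λ Y x) (x i) = P.tupleTime x i := by
  rw [time, shiftTime_of_mem _ (hx i), glue_inter Y hx, tupleTime]

theorem glue_moveTuple (Y : Config) (e : Plane) (hx : ∀ i, x i ∈ Λ) :
    Config.glue Λ Y (P.moveTuple e x) = P.move e (Config.glue Λ Y x) := by
  have hin : shiftPoint Λ P.τ P.step e (Config.glue Λ Y x) '' range x =
      range (P.moveTuple e x) := by
    rw [← range_comp]
    exact congrArg range (funext fun i => congrArg (x i + · • e) (P.time_glue Y hx i))
  have hout : shiftPoint Λ P.τ P.step e (Config.glue Λ Y x) '' (Y.carrier \ Λ) =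
      Y.carrier \ Λ :=
    EqOn.image_eq_self fun _ hy => shiftPoint_of_notMem _ hy.2
  exact Config.ext ((image_union _ _ _).trans (congrArg₂ _ hin hout)).symm

theorem dualTime_moveTuple {ι : Type*} [Finite ι] (he : ‖e‖ = 1) (x : ι → Plane) (i : ι) :
    freeze (P.dualBase e) (P.dualStep e) (range (P.moveTuple e x)) (P.moveTuple e x i) =
      P.tupleTime x i := by
  have himage := (P.isDualShift he).freeze_image (finite_range x) P.le_step P.strictMono_step
    (P.isShift_dual he).le_step (P.isShift_dual he).strictMono (mem_range_self i)
  rwa [← range_comp] at himage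

theorem injective_moveTuple {ι : Type*} [Finite ι] (he : ‖e‖ = 1) :
    Function.Injective (P.moveTuple e : (ι → Plane) → ι → Plane) := by
  refine fun x x' hxx' => funext fun i => ?_
  have htime : P.tupleTime x i = P.tupleTime x' i := by
    rw [← P.dualTime_moveTuple he, hxx', P.dualTime_moveTuple he]
  have hi := congrFun hxx' i
  simp only [moveTuple, htime] at hi
  exact add_right_cancel hi

theorem moveTuple_mem {ι : Type*} [Finite ι] (he : ‖e‖ = 1) {x : ι → Plane} (hx : ∀ i, x i ∈ Λ)
    (i : ι) : P.moveTuple e x i ∈ Λ :=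
  P.stay e he _ (hx i) _
    (le_freeze_of_forall_le (finite_range x) P.le_step P.τ_nonneg _) (P.tupleTime_le x i)

theorem exists_moveTuple_eq {ι : Type*} [Finite ι] (he : ‖e‖ = 1) {y : ι → Plane}
    (hy : ∀ i, y i ∈ Λ) : ∃ x : ι → Plane, (∀ i, x i ∈ Λ) ∧ P.moveTuple e x = y := by
  set t' := freeze (P.dualBase e) (P.dualStep e) (range y)
  have hdual := P.isShift_dual he
  refine ⟨fun i => y i + t' (y i) • -e, fun i => ?_, funext fun i => ?_⟩
  · exact hdual.stay _ (hy i) _ (le_freeze_of_forall_le (finite_range y) hdual.le_step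
      hdual.nonneg _) (freeze_le (finite_range y) _)
  · have himage := (P.isDualShift he).symm.freeze_image (finite_range y) hdual.le_step
      hdual.strictMono P.le_step P.strictMono_step (mem_range_self i)
    rw [← range_comp] at himage
    have htime : P.tupleTime (fun i => y i + t' (y i) • -e) i = t' (y i) := himage
    rw [moveTuple, htime, smul_neg, neg_add_cancel_right]

theorem moveTuple_mem_hardTuples_iff (he : ‖e‖ = 1) (Y : Config) (hx : ∀ i, x i ∈ Λ) :
    P.moveTuple e x ∈ hardTuples Λ Y k ↔ x ∈ hardTuples Λ Y k := by
  rw [hardTuples, mem_inter_iff, mem_inter_iff, mem_univ_pi, mem_univ_pi, mem_preimage,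
    mem_preimage, P.glue_moveTuple Y e hx, P.move_mem_hardCore_iff he]
  exact and_congr_left' (iff_of_true (P.moveTuple_mem he hx) hx)

theorem image_hardTuples (he : ‖e‖ = 1) (Y : Config) (k : ℕ) :
    P.moveTuple e '' hardTuples Λ Y k = hardTuples Λ Y k := by
  refine Subset.antisymm ?_ fun y hy => ?_
  · rintro _ ⟨x, hx, rfl⟩
    exact (P.moveTuple_mem_hardTuples_iff he Y (mem_of_mem_hardTuples hx)).2 hx
  · obtain ⟨x, hx, rfl⟩ := P.exists_moveTuple_eq he (mem_of_mem_hardTuples hy)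
    exact ⟨x, (P.moveTuple_mem_hardTuples_iff he Y hx).1 hy, rfl⟩

end Profile

end MoveTuple

section Jacobian

theorem hasDerivAt_deriv_line {f : Plane → ℝ} {x : Plane}
    (hf : DifferentiableAt ℝ f x) (e : Plane) :
    HasDerivAt (fun s : ℝ => f (x + s • e)) (deriv (fun s : ℝ => f (x + s • e)) 0) 0 :=
  (hf.hasFDerivAt.hasLineDerivAt e).differentiableAt.hasDerivAt

namespace Profile

variable {Λ : Set Plane} {P : Profile Λ} {e : Plane}

variable (P) in
/-- The profile is differentiable off the null set `N`. -/
structure SmoothOff (N : Set Plane) : Prop where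
  measurableSet : MeasurableSet N
  null : volume N = 0
  τ_diff : ∀ x ∉ N, DifferentiableAt ℝ P.τ x
  F_diff : ∀ x ∉ N, ∀ y, 1 < dist y x → DifferentiableAt ℝ (P.F y) x

theorem slope_eq_of_active {X : Config} {x : Plane} {c : ℝ} (hx : P.time X x ≠ P.τ x)
    (hne : (X.carrier ∩ P.active X x).Nonempty)
    (hc : ∀ y ∈ X.carrier ∩ P.active X x, deriv (fun s : ℝ => P.F y (x + s • e)) 0 = c) :
    P.slope e X x = c := by
  have hactive : MeasurableSet (P.active X x) :=
    measurable_prodMk_left (x := (X, x)) P.measurableSet_active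
  have hpos : pts X (P.active X x) ≠ 0 := by
    rw [pts_apply_apply _ hactive, Ne, ENat.toENNReal_eq_zero, Config.count, encard_eq_zero]
    exact hne.ne_empty
  have hae : ∀ᵐ y ∂(pts X), y ∈ P.active X x → deriv (fun s : ℝ => P.F y (x + s • e)) 0 = c :=
    (ae_restrict_iff' X.measurableSet).2 (ae_of_all _ fun y hyX hy => hc y ⟨hyX, hy⟩)
  rw [slope, if_neg hx, setAverage_congr_fun hactive hae,
    setAverage_const hpos (P.pts_active_lt_top X x).ne]

section Tuple

variable {N : Set Plane} {k : ℕ} {x : Fin k → Plane} {L : (Fin k → Plane) →L[ℝ] Fin k → ℝ}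

theorem deriv_F_eq_fderiv_tupleTime (hN : P.SmoothOff N)
    (hx : Pairwise fun i j => 1 < dist (x i) (x j)) (hL : HasFDerivAt P.tupleTime L x)
    {i j : Fin k} (hi : x i ∉ N) (hlt : P.tupleTime x j < P.tupleTime x i)
    (heq : P.tupleTime x i = P.tupleTime x j + P.F (x j) (x i)) :
    deriv (fun s : ℝ => P.F (x j) (x i + s • e)) 0 = L (Pi.single i e) i := by
  have hji : j ≠ i := fun hji => hlt.ne (congrArg _ hji)
  have hcoord := hasFDerivAt_pi'.1 hL
  have hdiff : L (Pi.single i e) i - L (Pi.single i e) j =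
      deriv (fun s : ℝ => P.F (x j) (x i + s • e)) 0 := by
    refine fderiv_apply_eq_of_touch ((hcoord i).sub (hcoord j))
      (hasDerivAt_deriv_line (hN.F_diff _ hi _ (hx hji)) e) (fun s => ?_) ?_
    · have hle := P.tupleTime_le_add (x + s • (Pi.single i e : Fin k → Plane)) i j
      simp only [Pi.add_apply, Pi.smul_apply, Pi.single_eq_same, Pi.single_eq_of_ne hji,
        smul_zero, add_zero] at hle
      simp only [Pi.sub_apply]
      linarith
    · simp only [Pi.sub_apply, zero_smul, add_zero]
      linarith
  have hj : L (Pi.single i e) j = 0 :=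
    P.fderiv_tupleTime_eq_zero hx hL j _ (Pi.single_eq_of_ne hji _) fun l hl =>
      Pi.single_eq_of_ne (fun hli => by subst hli; exact lt_asymm hl hlt) _
  rw [← hdiff, hj, sub_zero]

theorem fderiv_tupleTime_single (hN : P.SmoothOff N) (Y : Config) (e : Plane)
    (hxΛ : ∀ i, x i ∈ Λ) (hx : Pairwise fun i j => 1 < dist (x i) (x j))
    (hL : HasFDerivAt P.tupleTime L x) {i : Fin k} (hi : x i ∉ N) :
    L (Pi.single i e) i = P.slope e (Config.glue Λ Y x) (x i) := by
  have htime := P.time_glue Y hxΛ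
  by_cases hbase : P.tupleTime x i = P.τ (x i)
  · rw [slope, htime, if_pos hbase]
    refine fderiv_apply_eq_of_touch (hasFDerivAt_pi'.1 hL i)
      (hasDerivAt_deriv_line (hN.τ_diff _ hi) e) (fun s => ?_) (by simpa using hbase)
    simpa using P.tupleTime_le (x + s • (Pi.single i e : Fin k → Plane)) i
  · refine (slope_eq_of_active (by rwa [htime]) ?_ ?_).symm
    · obtain ⟨j, hne, hj⟩ := (P.tupleTime_eq_or x i).resolve_left hbase
      have hF := P.F_pos _ _ (hx fun hji => hne (congrArg x hji))
      exact ⟨x j, Or.inl ⟨j, rfl⟩, hxΛ j, by rw [htime, htime]; linarith,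
        by rw [htime, htime, hj]⟩
    · rintro y ⟨hyX, hyΛ, hlt, heq⟩
      obtain ⟨j, rfl⟩ : y ∈ range x := glue_inter Y hxΛ ▸ ⟨hyX, hyΛ⟩
      rw [htime, htime] at hlt heq
      exact deriv_F_eq_fderiv_tupleTime hN hx hL hi hlt heq

theorem jacobian_glue (he : ‖e‖ = 1) (Y : Config) (hxΛ : ∀ i, x i ∈ Λ)
    (hx : Function.Injective x) :
    P.jacobian e (Config.glue Λ Y x) = ∏ i, (1 + P.slope e (Config.glue Λ Y x) (x i)) := by
  classical
  have hpos : ∀ y, 0 < 1 + P.slope e (Config.glue Λ Y x) y := fun y => by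
    have hρ : (P.ρ : ℝ) < 1 := P.ρ_lt_one
    linarith [(abs_le.1 (P.abs_slope_le_ρ he (Config.glue Λ Y x) y)).1]
  have hparticles : ((Config.glue Λ Y x).finite_inter Λ P.bounded).toFinset =
      Finset.univ.image x := by
    ext p
    simp [glue_inter Y hxΛ]
  rw [jacobian, setIntegral_pts P.measurableSet P.bounded, hparticles, Finset.sum_image hx.injOn,
    Real.exp_sum]
  exact Finset.prod_congr rfl fun i _ => Real.exp_log (hpos _)

theorem det_fderiv_moveTuple (hN : P.SmoothOff N) (he : ‖e‖ = 1) (Y : Config)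
    (hx : x ∈ properTuples Λ Y k) (hxN : ∀ i, x i ∉ N) (hL : HasFDerivAt P.tupleTime L x) :
    (ContinuousLinearMap.id ℝ (Fin k → Plane) + (displacement (Fin k) e).comp L).det =
      P.jacobian e (Config.glue Λ Y x) := by
  have hdist := one_lt_dist_of_mem_properTuples hx
  have hxΛ := mem_of_mem_hardTuples hx.1
  rw [P.jacobian_glue he Y hxΛ hx.2]
  refine (det_eq_prod_of_apply_eq_add_smul e
    (fun i => LinearMap.proj i ∘ₗ (L : (Fin k → Plane) →ₗ[ℝ] Fin k → ℝ)) _ (fun v i => rfl)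
    (P.tupleTime x) fun i j hji hle => ?_).trans (Finset.prod_congr rfl fun i _ => ?_)
  · exact P.fderiv_tupleTime_eq_zero hdist hL i _ (Pi.single_eq_of_ne hji.symm _)
      fun l hl => Pi.single_eq_of_ne (fun hlj => by subst hlj; exact hle.not_gt hl) _
  · rw [← fderiv_tupleTime_single hN Y e hxΛ hdist hL (hxN i)]
    rfl

end Tuple

end Profile

end Jacobian

/-! ### Change of variables for the Gibbs distribution -/

section ChangeOfVariables

namespace Profile

variable {Λ : Set Plane} (P : Profile Λ) {N : Set Plane} {e : Plane} {k : ℕ}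

/-- The proper tuples at which the change of variables `P.moveTuple e` is differentiable with the
determinant of `det_fderiv_moveTuple`; almost all of `hardTuples`. -/
def regularTuples (N : Set Plane) (Y : Config) (k : ℕ) : Set (Fin k → Plane) :=
  properTuples Λ Y k ∩ ((⋂ i, {x | x i ∉ N}) ∩ {x | DifferentiableAt ℝ P.tupleTime x})

theorem regularTuples_subset (N : Set Plane) (Y : Config) (k : ℕ) :
    P.regularTuples N Y k ⊆ hardTuples Λ Y k :=
  inter_subset_left.trans inter_subset_left

theorem measurableSet_regularTuples (hN : MeasurableSet N) (Y : Config) (k : ℕ) :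
    MeasurableSet (P.regularTuples N Y k) :=
  (measurableSet_properTuples P.measurableSet Y k).inter <|
    (MeasurableSet.iInter fun i => (measurable_pi_apply i hN).compl).inter
      (measurableSet_of_differentiableAt ℝ _)

theorem volume_hardTuples_diff_regularTuples (hN : volume N = 0) (Y : Config) (k : ℕ) :
    volume (hardTuples Λ Y k \ P.regularTuples N Y k) = 0 := by
  have hdiff : ∀ᵐ x : Fin k → Plane, DifferentiableAt ℝ P.tupleTime x :=
    (P.exists_lipschitzWith_tupleTime (Fin k)).choose_spec.ae_differentiableAt
  have hnotMem : ∀ᵐ x : Fin k → Plane, ∀ i, x i ∉ N := ae_all_iff.2 fun i =>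
    (Measure.quasiMeasurePreserving_eval (fun _ : Fin k => (volume : Measure Plane)) i).ae
      (measure_eq_zero_iff_ae_notMem.1 hN)
  rw [measure_eq_zero_iff_ae_notMem]
  filter_upwards [hdiff, hnotMem, (properTuples_ae_eq Λ Y k).mem_iff] with x hx hxN hproper hmem
  exact hmem.2 ⟨hproper.2 hmem.1, mem_iInter.2 hxN, hx⟩

theorem regularTuples_ae_eq (hN : volume N = 0) (Y : Config) (k : ℕ) :
    P.regularTuples N Y k =ᵐ[volume] hardTuples Λ Y k :=
  (LE.le.eventuallyLE (P.regularTuples_subset N Y k)).antisymm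
    (ae_le_set.2 (P.volume_hardTuples_diff_regularTuples hN Y k))

theorem image_regularTuples_ae_eq (hN : volume N = 0) (he : ‖e‖ = 1) (Y : Config) (k : ℕ) :
    P.moveTuple e '' P.regularTuples N Y k =ᵐ[volume] hardTuples Λ Y k := by
  obtain ⟨C, hC⟩ := P.exists_lipschitzWith_moveTuple (Fin k) e
  have himage := P.image_hardTuples he Y k
  refine (LE.le.eventuallyLE ((image_mono (P.regularTuples_subset N Y k)).trans
    himage.subset)).antisymm (ae_le_set.2 ?_)
  nth_rewrite 1 [← himage]
  rw [← image_sdiff (P.injective_moveTuple he)]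
  exact addHaar_image_eq_zero_of_lipschitzWith volume hC
    (P.volume_hardTuples_diff_regularTuples hN Y k)

variable {P}

theorem lintegral_hardTuples (hN : P.SmoothOff N) (he : ‖e‖ = 1) (Y : Config) (k : ℕ)
    (f : (Fin k → Plane) → ℝ≥0∞) :
    ∫⁻ x in hardTuples Λ Y k, f x =
      ∫⁻ x in hardTuples Λ Y k,
        ENNReal.ofReal (P.jacobian e (Config.glue Λ Y x)) * f (P.moveTuple e x) := by
  have hregular := P.measurableSet_regularTuples hN.measurableSet Y k
  have hderiv : ∀ x ∈ P.regularTuples N Y k, HasFDerivWithinAt (P.moveTuple e)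
      (ContinuousLinearMap.id ℝ (Fin k → Plane) +
        (displacement (Fin k) e).comp (fderiv ℝ P.tupleTime x)) (P.regularTuples N Y k) x :=
    fun x hx => (P.hasFDerivAt_moveTuple e hx.2.2.hasFDerivAt).hasFDerivWithinAt
  rw [← setLIntegral_congr (P.image_regularTuples_ae_eq hN.null he Y k),
    ← setLIntegral_congr (P.regularTuples_ae_eq hN.null Y k),
    lintegral_image_eq_lintegral_abs_det_fderiv_mul volume hregular hderiv
      (P.injective_moveTuple he).injOn f]
  refine setLIntegral_congr_fun hregular fun x ⟨hx, hxN, hdiff⟩ => ?_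
  rw [det_fderiv_moveTuple hN he Y hx (mem_iInter.1 hxN) hdiff.hasFDerivAt,
    abs_of_pos (P.jacobian_pos e _)]

end Profile

end ChangeOfVariables

section Density

theorem measurable_weight (z : ℝ) {Λ : Set Plane} (hΛ : MeasurableSet Λ) :
    Measurable (weight z Λ) :=
  ((measurable_from_top (f := fun k : ℕ => ENNReal.ofReal z ^ k)).comp
    (measurable_ncard_inter hΛ)).indicator measurableSet_hardCore

theorem lintegral_poisson {Λ : Set Plane} (Y : Config) {f : Config → ℝ≥0∞}
    (hf : Measurable f) :
    ∫⁻ X, f X ∂(poisson Λ Y) = ENNReal.ofReal (Real.exp (-(volume Λ).toReal)) *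
      ∑' k : ℕ, ((k.factorial : ℝ≥0∞)⁻¹) *
        ∫⁻ x in univ.pi fun _ : Fin k => Λ, f (Config.glue Λ Y x) := by
  rw [poisson, lintegral_smul_measure, lintegral_sum_measure, smul_eq_mul]
  refine congrArg _ (tsum_congr fun k => ?_)
  rw [lintegral_smul_measure, smul_eq_mul, lintegral_map hf (measurable_glue Λ Y k),
    ← Measure.restrict_pi_pi, volume_pi]

theorem setLIntegral_weight (Λ : Set Plane) (Y : Config) (z : ℝ) (k : ℕ)
    (f : (Fin k → Plane) → ℝ≥0∞) :
    ∫⁻ x in univ.pi fun _ => Λ, f x * weight z Λ (Config.glue Λ Y x) =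
      ∫⁻ x in hardTuples Λ Y k, f x * weight z Λ (Config.glue Λ Y x) := by
  have hmeas : MeasurableSet (Config.glue Λ Y ⁻¹' hardCore : Set (Fin k → Plane)) :=
    measurable_glue Λ Y k measurableSet_hardCore
  rw [hardTuples, inter_comm, ← setLIntegral_indicator hmeas]
  refine lintegral_congr fun x => ?_
  by_cases hx : Config.glue Λ Y x ∈ hardCore
  · rw [indicator_of_mem (mem_preimage.2 hx)]
  · rw [indicator_of_notMem (s := Config.glue Λ Y ⁻¹' hardCore) hx, weight,
      indicator_of_notMem hx, mul_zero]

namespace Profile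

variable {Λ : Set Plane} {P : Profile Λ} {N : Set Plane} {e : Plane}

theorem weight_move (he : ‖e‖ = 1) (z : ℝ) (X : Config) :
    weight z Λ (P.move e X) = weight z Λ X := by
  classical
  have hcard : ((P.move e X).carrier ∩ Λ).ncard = (X.carrier ∩ Λ).ncard := by
    rw [(P.isShift he).shift_inter P.bounded]
    exact (((P.isDualShift he).leftInvOn_shiftPoint (P.isShift he) (P.isShift_dual he)
      P.bounded X).injOn.mono inter_subset_left).ncard_image
  simp only [weight, indicator, P.move_mem_hardCore_iff he, hcard]

theorem lintegral_move (hN : P.SmoothOff N) (he : ‖e‖ = 1) (Y : Config) (z : ℝ)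
    {f : Config → ℝ≥0∞} (hf : Measurable f) :
    ∫⁻ X, f X * weight z Λ X ∂(poisson Λ Y) =
      ∫⁻ X, ENNReal.ofReal (P.jacobian e X) * f (P.move e X) * weight z Λ X ∂(poisson Λ Y) := by
  have hweight := measurable_weight z P.measurableSet
  have hjacobian := (P.measurable_jacobian e).ennreal_ofReal
  refine (lintegral_poisson Y (hf.mul hweight)).trans (.trans ?_ (lintegral_poisson Y
    ((hjacobian.mul (hf.comp (P.measurable_move he))).mul hweight)).symm)
  refine congrArg _ (tsum_congr fun k => congrArg _ ?_)
  simp only [Pi.mul_apply, Function.comp_apply]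
  rw [setLIntegral_weight Λ Y z k fun x => f (Config.glue Λ Y x),
    setLIntegral_weight Λ Y z k fun x =>
      ENNReal.ofReal (P.jacobian e (Config.glue Λ Y x)) * f (P.move e (Config.glue Λ Y x)),
    lintegral_hardTuples hN he Y k]
  refine setLIntegral_congr_fun (measurableSet_hardTuples P.measurableSet Y k) fun x hx => ?_
  rw [P.glue_moveTuple Y e (mem_of_mem_hardTuples hx), weight_move he, mul_assoc]

theorem lintegral_gibbs_move (hN : P.SmoothOff N) (he : ‖e‖ = 1) (Y : Config) (z : ℝ)
    {f : Config → ℝ≥0∞} (hf : Measurable f) :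
    ∫⁻ X, ENNReal.ofReal (P.jacobian e X) * f (P.move e X) ∂(gibbs z Λ Y) =
      ∫⁻ X, f X ∂(gibbs z Λ Y) := by
  have hweight := measurable_weight z P.measurableSet
  have hjacobian := (P.measurable_jacobian e).ennreal_ofReal
  rw [gibbs, lintegral_smul_measure, lintegral_smul_measure,
    lintegral_withDensity_eq_lintegral_mul _ hweight hf,
    lintegral_withDensity_eq_lintegral_mul _ hweight
      (g := fun X => ENNReal.ofReal (P.jacobian e X) * f (P.move e X))
      (hjacobian.mul (hf.comp (P.measurable_move he)))]
  simp only [Pi.mul_apply, mul_comm (weight z Λ _)]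
  rw [lintegral_move hN he Y z hf]

theorem isImageDensity (hN : P.SmoothOff N) (he : ‖e‖ = 1) (Y : Config) (z : ℝ) :
    IsImageDensity (gibbs z Λ Y) (P.move e) (P.jacobian e) := by
  have hdensity : Measurable fun X => P.jacobian e (P.unmove e X) :=
    (P.measurable_jacobian e).comp (P.measurable_unmove he)
  refine ⟨fun X => P.jacobian e (P.unmove e X), hdensity, fun X => (P.jacobian_pos e _).le, ?_,
    fun X => by simp only [P.unmove_move he]⟩
  ext A hA
  rw [withDensity_apply _ hA, ← lintegral_indicator hA,
    lintegral_map (hdensity.ennreal_ofReal.indicator hA) (P.measurable_move he),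
    ← lintegral_indicator_one hA, ← lintegral_gibbs_move hN he Y z (measurable_one.indicator hA)]
  refine lintegral_congr fun X => ?_
  by_cases hX : P.move e X ∈ A <;> simp [hX, P.unmove_move he]

end Profile

end Density

/-! ### Chains of particles under the Gibbs distribution -/

section Gibbs

variable {Λ : Set Plane} {Y : Config} (z : ℝ)

theorem weight_glue {k : ℕ} {x : Fin k → Plane} (hx : x ∈ properTuples Λ Y k) :
    weight z Λ (Config.glue Λ Y x) = ENNReal.ofReal z ^ k := by
  rw [weight, indicator_of_mem (mem_preimage.1 hx.1.2), glue_inter Y (mem_of_mem_hardTuples hx.1),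
    ← image_univ, InjOn.ncard_image hx.2.injOn, ncard_univ, Nat.card_fin]

/-- The unnormalized Gibbs expectation `∑ₖ zᵏ / k! ∫ B k` of a function `B` of the particles in
`Λ`; the factor `exp (-|Λ|)` is left out. -/
def hardSum (z : ℝ) (Λ : Set Plane) (Y : Config) (B : (k : ℕ) → (Fin k → Plane) → ℝ≥0∞) : ℝ≥0∞ :=
  ∑' k : ℕ, (k.factorial : ℝ≥0∞)⁻¹ * (ENNReal.ofReal z ^ k * ∫⁻ x in properTuples Λ Y k, B k x)

theorem hardSum_mono (hΛ : MeasurableSet Λ) {B B' : (k : ℕ) → (Fin k → Plane) → ℝ≥0∞}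
    (h : ∀ k, ∀ x ∈ properTuples Λ Y k, B k x ≤ B' k x) :
    hardSum z Λ Y B ≤ hardSum z Λ Y B' := by
  refine ENNReal.tsum_le_tsum fun k => ?_
  gcongr 2
  exact setLIntegral_mono' (measurableSet_properTuples hΛ Y k) (h k)

theorem hardSum_const (Λ : Set Plane) (Y : Config) (C : ℝ≥0∞) :
    hardSum z Λ Y (fun _ _ => C) = C * hardSum z Λ Y fun _ _ => 1 := by
  simp only [hardSum, ← ENNReal.tsum_mul_left, setLIntegral_const]
  exact tsum_congr fun k => by ring

theorem lintegral_weight_poisson (hΛ : MeasurableSet Λ) (Y : Config) {f : Config → ℝ≥0∞}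
    (hf : Measurable f) :
    ∫⁻ X, f X * weight z Λ X ∂(poisson Λ Y) =
      ENNReal.ofReal (Real.exp (-(volume Λ).toReal)) *
        hardSum z Λ Y fun _ x => f (Config.glue Λ Y x) := by
  refine (lintegral_poisson Y (hf.mul (measurable_weight z hΛ))).trans
    (congrArg _ (tsum_congr fun k => congrArg _ ?_))
  simp only [Pi.mul_apply]
  rw [setLIntegral_weight Λ Y z k fun x => f (Config.glue Λ Y x),
    ← setLIntegral_congr (properTuples_ae_eq Λ Y k),
    ← lintegral_const_mul (f := fun x => f (Config.glue Λ Y x)) _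
      (hf.comp (measurable_glue Λ Y k))]
  refine setLIntegral_congr_fun (measurableSet_properTuples hΛ Y k) fun x hx => ?_
  simp only [weight_glue z hx, mul_comm]

theorem partitionFn_eq (hΛ : MeasurableSet Λ) (Y : Config) :
    partitionFn z Λ Y = ENNReal.ofReal (Real.exp (-(volume Λ).toReal)) *
      hardSum z Λ Y fun _ _ => 1 := by
  rw [partitionFn, ← lintegral_weight_poisson z hΛ Y measurable_const]
  simp only [one_mul]

theorem lintegral_gibbs (hΛ : MeasurableSet Λ) (Y : Config) {f : Config → ℝ≥0∞}
    (hf : Measurable f) :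
    ∫⁻ X, f X ∂(gibbs z Λ Y) = (partitionFn z Λ Y)⁻¹ *
      (ENNReal.ofReal (Real.exp (-(volume Λ).toReal)) *
        hardSum z Λ Y fun _ x => f (Config.glue Λ Y x)) := by
  rw [gibbs, lintegral_smul_measure, lintegral_withDensity_eq_lintegral_mul _
    (measurable_weight z hΛ) hf, smul_eq_mul, ← lintegral_weight_poisson z hΛ Y hf]
  simp only [Pi.mul_apply, mul_comm]

theorem lintegral_gibbs_le (hΛ : MeasurableSet Λ) {f : Config → ℝ≥0∞} (hf : Measurable f)
    {C : ℝ≥0∞}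
    (h : (hardSum z Λ Y fun _ x => f (Config.glue Λ Y x)) ≤ C * hardSum z Λ Y fun _ _ => 1) :
    ∫⁻ X, f X ∂(gibbs z Λ Y) ≤ C := by
  rw [lintegral_gibbs z hΛ Y hf]
  calc _ ≤ (partitionFn z Λ Y)⁻¹ * (ENNReal.ofReal (Real.exp (-(volume Λ).toReal)) *
        (C * hardSum z Λ Y fun _ _ => 1)) := by gcongr
    _ = C * ((partitionFn z Λ Y)⁻¹ * partitionFn z Λ Y) := by
        rw [partitionFn_eq z hΛ Y]; ring
    _ ≤ C := mul_le_of_le_one_right bot_le (ENNReal.inv_mul_le_one _)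

theorem gibbs_univ_le (hΛ : MeasurableSet Λ) (Y : Config) : gibbs z Λ Y univ ≤ 1 := by
  rw [← lintegral_one]
  exact lintegral_gibbs_le z hΛ measurable_const (by rw [one_mul])

theorem isFiniteMeasure_gibbs (hΛ : MeasurableSet Λ) (Y : Config) :
    IsFiniteMeasure (gibbs z Λ Y) :=
  ⟨(gibbs_univ_le z hΛ Y).trans_lt ENNReal.one_lt_top⟩

theorem gibbs_le_of_hardSum_le (hΛ : MeasurableSet Λ) {A : Set Config} (hA : MeasurableSet A)
    {B : (k : ℕ) → (Fin k → Plane) → ℝ≥0∞} {C : ℝ≥0∞}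
    (hAB : ∀ k, ∀ x ∈ properTuples Λ Y k, Config.glue Λ Y x ∈ A → 1 ≤ B k x)
    (hB : hardSum z Λ Y B ≤ C * hardSum z Λ Y fun _ _ => 1) : gibbs z Λ Y A ≤ C := by
  rw [← lintegral_indicator_one hA]
  refine lintegral_gibbs_le z hΛ (measurable_one.indicator hA)
    ((hardSum_mono z hΛ fun k x hx => ?_).trans hB)
  by_cases hmem : Config.glue Λ Y x ∈ A
  · exact (indicator_of_mem hmem _).trans_le (hAB k x hx hmem)
  · exact (indicator_of_notMem hmem _).trans_le bot_le

theorem ae_gibbs_mem_hardCore (hΛ : MeasurableSet Λ) (Y : Config) :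
    ∀ᵐ X ∂(gibbs z Λ Y), X ∈ hardCore :=
  nonpos_iff_eq_zero.1 <| gibbs_le_of_hardSum_le z hΛ (B := fun _ _ => 0)
    measurableSet_hardCore.compl (fun _ _ hx hmem => absurd hx.1.2 hmem) (hardSum_const z Λ Y 0).le

end Gibbs

section Chains

/-- The sum over chains of `j` further entries of the tuple `x`, with distinct indices, starting
from the point `p`; a step from `u` to `v` has the weight `g (u - v)`, and the last point `q` of the
chain the weight `a q`. -/
def chainSum {E : Type*} [Sub E] (g a : E → ℝ≥0∞) : ℕ → (k : ℕ) → E → (Fin k → E) → ℝ≥0∞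
  | 0, _, p, _ => a p
  | _ + 1, 0, _, _ => 0
  | j + 1, k + 1, p, x => ∑ i, g (p - x i) * chainSum g a j k (x i) (i.removeNth x)

/-- The sum of the weights of all chains of `j + 1` entries of the tuple `x`; it bounds the
indicator of the existence of a chain each of whose weights is at least one. -/
def chainTotal {E : Type*} [Sub E] (g a : E → ℝ≥0∞) (j : ℕ) : (k : ℕ) → (Fin k → E) → ℝ≥0∞
  | 0, _ => 0
  | k + 1, x => ∑ i, chainSum g a j k (x i) (i.removeNth x)

section Paths

variable {E : Type*}

theorem mem_range_removeNth {k : ℕ} {x : Fin (k + 1) → E} {l : Fin (k + 1)} {y : E}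
    (hy : y ∈ range x) (hne : y ≠ x l) : y ∈ range (l.removeNth x : Fin k → E) := by
  obtain ⟨i, rfl⟩ := hy
  obtain ⟨i, rfl⟩ := Fin.exists_succAbove_eq fun hil : i = l => hne (congrArg x hil)
  exact ⟨i, rfl⟩

variable [Sub E] {g a : E → ℝ≥0∞}

theorem prod_le_chainSum {j k : ℕ} {x : Fin k → E} {y : ℕ → E} (hy : MapsTo y (Ioc 0 j) (range x))
    (hinj : InjOn y (Ioc 0 j)) :
    (∏ i ∈ Finset.range j, g (y i - y (i + 1))) * a (y j) ≤ chainSum g a j k (y 0) x := by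
  induction j generalizing k y with
  | zero => simp [chainSum]
  | succ j ih =>
    obtain ⟨l, hl⟩ := hy (show 1 ∈ Ioc 0 (j + 1) by simp)
    cases k with
    | zero => exact l.elim0
    | succ k =>
      have hshift : ∀ {i}, i ∈ Ioc 0 j → i + 1 ∈ Ioc 0 (j + 1) := fun hi => by
        simp only [mem_Ioc] at hi ⊢; omega
      have htail := ih (k := k) (x := l.removeNth x) (y := fun i => y (i + 1))
        (fun i hi => mem_range_removeNth (hy (hshift hi)) fun heq => hi.1.ne'
          (Nat.succ_injective (hinj (hshift hi) (show 1 ∈ Ioc 0 (j + 1) by simp) (heq.trans hl))))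
        fun i hi i' hi' heq => Nat.succ_injective (hinj (hshift hi) (hshift hi') heq)
      calc (∏ i ∈ Finset.range (j + 1), g (y i - y (i + 1))) * a (y (j + 1))
          = g (y 0 - x l) *
              ((∏ i ∈ Finset.range j, g (y (i + 1) - y (i + 1 + 1))) * a (y (j + 1))) := by
            rw [Finset.prod_range_succ', hl]; ring
        _ ≤ g (y 0 - x l) * chainSum g a j k (x l) (l.removeNth x) := by
            rw [hl]; gcongr
        _ ≤ chainSum g a (j + 1) (k + 1) (y 0) x :=
            Finset.single_le_sum (f := fun i => g (y 0 - x i) *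
              chainSum g a j k (x i) (i.removeNth x)) (fun _ _ => bot_le) (Finset.mem_univ l)

theorem prod_le_chainTotal {j k : ℕ} {x : Fin k → E} {y : ℕ → E}
    (hy : MapsTo y (Iic j) (range x)) (hinj : InjOn y (Iic j)) :
    (∏ i ∈ Finset.range j, g (y i - y (i + 1))) * a (y j) ≤ chainTotal g a j k x := by
  obtain ⟨l, hl⟩ := hy (mem_Iic.2 j.zero_le)
  cases k with
  | zero => exact l.elim0
  | succ k =>
    have htail := prod_le_chainSum (g := g) (a := a) (j := j) (x := l.removeNth x) (y := y)
      (fun i hi => mem_range_removeNth (hy hi.2) fun heq =>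
        hi.1.ne' (hinj hi.2 (mem_Iic.2 j.zero_le) (heq.trans hl)))
      (hinj.mono Ioc_subset_Iic_self)
    rw [← hl] at htail
    exact htail.trans (Finset.single_le_sum (f := fun i => chainSum g a j k (x i) (i.removeNth x))
      (fun _ _ => bot_le) (Finset.mem_univ l))

end Paths

variable {g a : Plane → ℝ≥0∞}

theorem measurable_removeNth {E : Type*} [MeasurableSpace E] {k : ℕ} (i : Fin (k + 1)) :
    Measurable fun x : Fin (k + 1) → E => (i.removeNth x : Fin k → E) :=
  measurable_pi_lambda _ fun _ => measurable_pi_apply _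

theorem measurable_chainSum (hg : Measurable g) (ha : Measurable a) (j k : ℕ) :
    Measurable fun q : Plane × (Fin k → Plane) => chainSum g a j k q.1 q.2 := by
  induction j generalizing k with
  | zero => exact ha.comp measurable_fst
  | succ j ih =>
    cases k with
    | zero => exact measurable_const
    | succ k =>
      refine Finset.measurable_sum _ fun i _ => ?_
      have hi : Measurable fun q : Plane × (Fin (k + 1) → Plane) => q.2 i :=
        (measurable_pi_apply i).comp measurable_snd
      exact (hg.comp (measurable_fst.sub hi)).mul
        ((ih k).comp (hi.prodMk ((measurable_removeNth i).comp measurable_snd)))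

theorem measurable_chainSum_removeNth (hg : Measurable g) (ha : Measurable a) (j k : ℕ)
    (i : Fin (k + 1)) : Measurable fun x : Fin (k + 1) → Plane =>
      chainSum g a j k (x i) (i.removeNth x) :=
  (measurable_chainSum hg ha j k).comp ((measurable_pi_apply i).prodMk (measurable_removeNth i))

theorem measurable_chainTotal (hg : Measurable g) (ha : Measurable a) (j k : ℕ) :
    Measurable (chainTotal g a j k) := by
  cases k with
  | zero => exact measurable_const
  | succ k => exact Finset.measurable_sum _ fun i _ => measurable_chainSum_removeNth hg ha j k i

theorem lintegral_chainSum_succ (hg : Measurable g) (a : Plane → ℝ≥0∞) (j k : ℕ)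
    (x : Fin k → Plane) :
    ∫⁻ p, chainSum g a (j + 1) k p x = (∫⁻ v, g v) * chainTotal g a j k x := by
  cases k with
  | zero => simp [chainSum, chainTotal]
  | succ k =>
    simp only [chainSum, chainTotal]
    have hgi : ∀ i, Measurable fun p => g (p - x i) := fun i =>
      hg.comp (measurable_id.sub_const (x i))
    rw [lintegral_finsetSum _ fun i _ => (hgi i).mul_const _, Finset.mul_sum]
    refine Finset.sum_congr rfl fun i _ => ?_
    rw [lintegral_mul_const _ (hgi i), lintegral_sub_right_eq_self g (x i)]

variable {Λ : Set Plane}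

theorem removeNth_mem_properTuples {Y : Config} {k : ℕ} {x : Fin (k + 1) → Plane}
    (hx : x ∈ properTuples Λ Y (k + 1)) (i : Fin (k + 1)) :
    (i.removeNth x : Fin k → Plane) ∈ properTuples Λ Y k := by
  have hsub : (Config.glue Λ Y (i.removeNth x : Fin k → Plane)).carrier ⊆
      (Config.glue Λ Y x).carrier :=
    union_subset_union_left _ (range_comp_subset_range i.succAbove x)
  exact ⟨⟨fun l _ => mem_of_mem_hardTuples hx.1 _,
    fun p hp q hq hpq => hx.1.2 p (hsub hp) q (hsub hq) hpq⟩,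
    hx.2.comp Fin.succAbove_right_injective⟩

theorem lintegral_properTuples_succ_le (hΛ : MeasurableSet Λ) (Y : Config) {k : ℕ}
    (i : Fin (k + 1)) {f : Plane × (Fin k → Plane) → ℝ≥0∞} (hf : Measurable f) :
    ∫⁻ x in properTuples Λ Y (k + 1), f (x i, i.removeNth x) ≤
      ∫⁻ x in properTuples Λ Y k, ∫⁻ p, f (p, x) := by
  have hproper : MeasurableSet (univ ×ˢ properTuples Λ Y k : Set (Plane × (Fin k → Plane))) :=
    .prod .univ (measurableSet_properTuples hΛ Y k)
  have hsplit := volume_preserving_piFinSuccAbove (fun _ : Fin (k + 1) => Plane) i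
  calc ∫⁻ x in properTuples Λ Y (k + 1), f (x i, i.removeNth x)
      ≤ ∫⁻ x in MeasurableEquiv.piFinSuccAbove (fun _ => Plane) i ⁻¹' univ ×ˢ properTuples Λ Y k,
          f (x i, i.removeNth x) :=
        lintegral_mono_set fun x hx => ⟨mem_univ _, removeNth_mem_properTuples hx i⟩
    _ = ∫⁻ q in univ ×ˢ properTuples Λ Y k, f q := hsplit.setLIntegral_comp_preimage hproper hf
    _ = ∫⁻ x in properTuples Λ Y k, ∫⁻ p, f (p, x) := by
        rw [Measure.volume_eq_prod, ← Measure.prod_restrict, Measure.restrict_univ,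
          lintegral_prod_symm' _ hf]

theorem lintegral_chainTotal_succ_le (hg : Measurable g) (ha : Measurable a)
    (hΛ : MeasurableSet Λ) (Y : Config) (j k : ℕ) :
    ∫⁻ x in properTuples Λ Y (k + 1), chainTotal g a (j + 1) (k + 1) x ≤
      (k + 1) * ((∫⁻ v, g v) * ∫⁻ x in properTuples Λ Y k, chainTotal g a j k x) := by
  have hsum : ∀ x : Fin (k + 1) → Plane, chainTotal g a (j + 1) (k + 1) x =
      ∑ i, chainSum g a (j + 1) k (x i) (i.removeNth x) := fun _ => rfl
  simp only [hsum]
  rw [lintegral_finsetSum _ fun i _ => measurable_chainSum_removeNth hg ha (j + 1) k i]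
  calc _ ≤ ∑ _i : Fin (k + 1), ∫⁻ x in properTuples Λ Y k,
        ∫⁻ p, chainSum g a (j + 1) k p x :=
        Finset.sum_le_sum fun i _ =>
          lintegral_properTuples_succ_le hΛ Y i (measurable_chainSum hg ha (j + 1) k)
    _ = _ := by
        simp only [lintegral_chainSum_succ hg, Finset.sum_const, Finset.card_univ, Fintype.card_fin,
          nsmul_eq_mul, lintegral_const_mul _ (measurable_chainTotal hg ha j k), Nat.cast_add,
          Nat.cast_one]

theorem inv_factorial_succ_mul (k : ℕ) :
    ((k + 1).factorial : ℝ≥0∞)⁻¹ * (k + 1) = (k.factorial : ℝ≥0∞)⁻¹ := by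
  rw [Nat.factorial_succ, Nat.cast_mul, ENNReal.mul_inv (Or.inr (by finiteness))
    (Or.inr (Nat.cast_ne_zero.2 k.factorial_ne_zero)), mul_right_comm, Nat.cast_add, Nat.cast_one,
    ENNReal.inv_mul_cancel (by positivity) (by finiteness), one_mul]

theorem hardSum_chainTotal_succ_le (hg : Measurable g) (ha : Measurable a) (z : ℝ)
    (hΛ : MeasurableSet Λ) (Y : Config) (j : ℕ) :
    hardSum z Λ Y (chainTotal g a (j + 1)) ≤
      (ENNReal.ofReal z * ∫⁻ v, g v) * hardSum z Λ Y (chainTotal g a j) := by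
  have hzero : ∫⁻ x in properTuples Λ Y 0, chainTotal g a (j + 1) 0 x = 0 := lintegral_zero
  rw [hardSum, tsum_eq_zero_add' ENNReal.summable, hzero, mul_zero, mul_zero, zero_add, hardSum,
    ← ENNReal.tsum_mul_left]
  refine ENNReal.tsum_le_tsum fun k => ?_
  calc _ ≤ ((k + 1).factorial : ℝ≥0∞)⁻¹ * (ENNReal.ofReal z ^ (k + 1) *
        ((k + 1) * ((∫⁻ v, g v) * ∫⁻ x in properTuples Λ Y k, chainTotal g a j k x))) := by
        gcongr
        exact lintegral_chainTotal_succ_le hg ha hΛ Y j k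
    _ = (((k + 1).factorial : ℝ≥0∞)⁻¹ * (k + 1)) * (ENNReal.ofReal z * ∫⁻ v, g v) *
        (ENNReal.ofReal z ^ k * ∫⁻ x in properTuples Λ Y k, chainTotal g a j k x) := by ring
    _ = _ := by rw [inv_factorial_succ_mul]; ring

theorem hardSum_chainTotal_le (hg : Measurable g) (ha : Measurable a) (z : ℝ)
    (hΛ : MeasurableSet Λ) (Y : Config) (j : ℕ) :
    hardSum z Λ Y (chainTotal g a j) ≤
      (ENNReal.ofReal z * ∫⁻ v, g v) ^ j * hardSum z Λ Y (chainTotal g a 0) := by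
  induction j with
  | zero => rw [pow_zero, one_mul]
  | succ j ih =>
    refine (hardSum_chainTotal_succ_le hg ha z hΛ Y j).trans ?_
    rw [pow_succ', mul_assoc (ENNReal.ofReal z * ∫⁻ v, g v)]
    gcongr

end Chains

section Packing

theorem sum_mul_measure_ball_le_lintegral {E : Type*} [PseudoMetricSpace E] [MeasurableSpace E]
    [OpensMeasurableSpace E] (μ : Measure E) {r : ℝ} {A : Finset E}
    (hA : (A : Set E).Pairwise fun x y => 2 * r ≤ dist x y) {f h : E → ℝ≥0∞}
    (hfh : ∀ x ∈ A, ∀ p ∈ Metric.ball x r, f x ≤ h p) :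
    ∑ x ∈ A, f x * μ (Metric.ball x r) ≤ ∫⁻ p, h p ∂μ := by
  have hdisjoint : (A : Set E).PairwiseDisjoint fun x => Metric.ball x r :=
    hA.imp fun x y hxy => Metric.ball_disjoint_ball (by linarith)
  calc ∑ x ∈ A, f x * μ (Metric.ball x r)
      = ∑ x ∈ A, ∫⁻ _ in Metric.ball x r, f x ∂μ :=
        Finset.sum_congr rfl fun x _ => (setLIntegral_const _ _).symm
    _ ≤ ∑ x ∈ A, ∫⁻ p in Metric.ball x r, h p ∂μ :=
        Finset.sum_le_sum fun x hx => setLIntegral_mono' measurableSet_ball (hfh x hx)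
    _ = ∫⁻ p in ⋃ x ∈ A, Metric.ball x r, h p ∂μ :=
        (lintegral_biUnion_finset hdisjoint (fun _ _ => measurableSet_ball) h).symm
    _ ≤ ∫⁻ p, h p ∂μ := setLIntegral_le_lintegral _ _

theorem volume_ball_half (x : Plane) :
    volume (Metric.ball x (1 / 2)) = ENNReal.ofReal (Real.pi / 4) := by
  rw [EuclideanSpace.volume_ball_fin_two, ← ENNReal.ofReal_pow (by norm_num),
    ← NNReal.coe_real_pi, ← ENNReal.ofReal_mul (by norm_num)]
  congr 1
  ring

end Packing

/-! ### The logarithmic profile -/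

/-- The parameters of the logarithmic profile: the base shift decreases like `c log (R / ‖x‖)` from
the radius `r` to the radius `R`, and `σ` is the strength of the slack. -/
structure LogParams where
  r : ℝ
  R : ℝ
  c : ℝ
  σ : ℝ
  one_le_r : 1 ≤ r
  r_lt_R : r < R
  c_pos : 0 < c
  c_le : c ≤ σ
  σ_le : σ ≤ r / 2

namespace LogParams

variable (p : LogParams)

theorem r_pos : 0 < p.r := one_pos.trans_le p.one_le_r

theorem R_pos : 0 < p.R := p.r_pos.trans p.r_lt_R

theorem σ_pos : 0 < p.σ := p.c_pos.trans_le p.c_le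

/-- The Lipschitz constant of the logarithmic profile. -/
def ρ : NNReal := ⟨p.σ / p.r, div_nonneg p.σ_pos.le p.r_pos.le⟩

theorem coe_ρ : (p.ρ : ℝ) = p.σ / p.r := rfl

theorem ρ_le_half : (p.ρ : ℝ) ≤ 1 / 2 := by
  rw [coe_ρ, div_le_iff₀ p.r_pos]
  linarith [p.σ_le]

section Normed

variable {E : Type*} [SeminormedAddCommGroup E]

/-- The distance to the origin truncated below at `r`, on which scale the profile varies. -/
def w (x : E) : ℝ := max ‖x‖ p.r

/-- The base shift, a logarithmic cone cut off at the radius `R`. -/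
def base (x : E) : ℝ := max 0 (p.c * Real.log (p.R / p.w x))

/-- The slack of a particle at `x` over a particle at `y`; it vanishes when the two disks touch. -/
def slack (y x : E) : ℝ := p.σ * Real.log (1 + max 0 (dist y x - 1) / p.w x)

theorem r_le_w (x : E) : p.r ≤ p.w x := le_max_right _ _

theorem norm_le_w (x : E) : ‖x‖ ≤ p.w x := le_max_left _ _

theorem w_pos (x : E) : 0 < p.w x := p.r_pos.trans_le (p.r_le_w x)

theorem w_le_add (x y : E) : p.w y ≤ p.w x + dist x y := by
  have hnorm : ‖y‖ ≤ ‖x‖ + dist x y := dist_eq_norm x y ▸ norm_le_norm_add_norm_sub x y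
  exact max_le (hnorm.trans (add_le_add_left (p.norm_le_w x) _))
    (le_add_of_le_of_nonneg (p.r_le_w x) dist_nonneg)

theorem σ_div_w_le (x : E) : p.σ / p.w x ≤ p.ρ :=
  div_le_div_of_nonneg_left p.σ_pos.le p.r_pos (p.r_le_w x)

theorem base_nonneg (x : E) : 0 ≤ p.base x := le_max_left _ _

theorem base_eq_log {x : E} (hx : ‖x‖ ≤ p.R) : p.base x = p.c * Real.log (p.R / p.w x) :=
  max_eq_right (mul_nonneg p.c_pos.le
    (Real.log_nonneg ((one_le_div (p.w_pos x)).2 (max_le hx p.r_lt_R.le))))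

theorem base_eq_zero {x : E} (hx : p.R ≤ ‖x‖) : p.base x = 0 :=
  max_eq_left (mul_nonpos_of_nonneg_of_nonpos p.c_pos.le
    (Real.log_nonpos (div_pos p.R_pos (p.w_pos x)).le
      ((div_le_one (p.w_pos x)).2 (hx.trans (p.norm_le_w x)))))

theorem base_eventuallyEq_zero {x : E} (hx : p.R < ‖x‖) : p.base =ᶠ[nhds x] 0 := by
  filter_upwards [continuousAt_const.eventually_lt continuous_norm.continuousAt hx] with y hy
  exact p.base_eq_zero hy.le

theorem base_sub_le (x y : E) : p.base x - p.base y ≤ p.σ / p.w x * dist x y := by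
  rcases le_total p.R ‖x‖ with hx | hx
  · rw [p.base_eq_zero hx, zero_sub]
    exact (neg_nonpos.2 (p.base_nonneg y)).trans
      (mul_nonneg (div_pos p.σ_pos (p.w_pos x)).le dist_nonneg)
  · have hlog : Real.log (p.R / p.w x) - Real.log (p.R / p.w y) ≤ dist x y / p.w x :=
      calc Real.log (p.R / p.w x) - Real.log (p.R / p.w y)
          = Real.log (p.w y / p.w x) := by
            rw [Real.log_div p.R_pos.ne' (p.w_pos x).ne', Real.log_div p.R_pos.ne' (p.w_pos y).ne',
              Real.log_div (p.w_pos y).ne' (p.w_pos x).ne']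
            ring
        _ ≤ p.w y / p.w x - 1 := Real.log_le_sub_one_of_pos (div_pos (p.w_pos y) (p.w_pos x))
        _ ≤ dist x y / p.w x := by
            rw [div_sub_one (p.w_pos x).ne', div_le_div_iff_of_pos_right (p.w_pos x)]
            linarith [p.w_le_add x y]
    calc p.base x - p.base y
        ≤ p.c * Real.log (p.R / p.w x) - p.c * Real.log (p.R / p.w y) :=
          sub_le_sub (p.base_eq_log hx).le (le_max_right _ _)
      _ = p.c * (Real.log (p.R / p.w x) - Real.log (p.R / p.w y)) := (mul_sub _ _ _).symm
      _ ≤ p.c * (dist x y / p.w x) := mul_le_mul_of_nonneg_left hlog p.c_pos.le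
      _ ≤ p.σ * (dist x y / p.w x) :=
          mul_le_mul_of_nonneg_right p.c_le (div_nonneg dist_nonneg (p.w_pos x).le)
      _ = p.σ / p.w x * dist x y := by ring

theorem lipschitzWith_base : LipschitzWith p.ρ (p.base : E → ℝ) :=
  LipschitzWith.of_le_add_mul _ fun x y => by
    linarith [p.base_sub_le x y,
      mul_le_mul_of_nonneg_right (p.σ_div_w_le x) (dist_nonneg (x := x) (y := y))]

theorem slack_nonneg (y x : E) : 0 ≤ p.slack y x :=
  mul_nonneg p.σ_pos.le (Real.log_nonneg
    (le_add_of_nonneg_right (div_nonneg (le_max_left _ _) (p.w_pos x).le)))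

theorem slack_pos {y x : E} (h : 1 < dist y x) : 0 < p.slack y x :=
  mul_pos p.σ_pos (Real.log_pos
    (lt_add_of_pos_right 1 (div_pos (lt_max_of_lt_right (sub_pos.2 h)) (p.w_pos x))))

theorem slack_eq_zero {y x : E} (h : dist y x ≤ 1) : p.slack y x = 0 := by
  rw [slack, max_eq_left (sub_nonpos.2 h), zero_div, add_zero, Real.log_one, mul_zero]

theorem slack_le {y x : E} (h : 1 ≤ dist y x) : p.slack y x ≤ p.ρ * (dist y x - 1) := by
  have hgap : 0 ≤ dist y x - 1 := sub_nonneg.2 h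
  have hlog : Real.log (1 + (dist y x - 1) / p.w x) ≤ (dist y x - 1) / p.w x := by
    linarith [Real.log_le_sub_one_of_pos
      (add_pos_of_pos_of_nonneg one_pos (div_nonneg hgap (p.w_pos x).le))]
  calc p.slack y x = p.σ * Real.log (1 + (dist y x - 1) / p.w x) := by
        rw [slack, max_eq_right hgap]
    _ ≤ p.σ * ((dist y x - 1) / p.w x) := mul_le_mul_of_nonneg_left hlog p.σ_pos.le
    _ = p.σ / p.w x * (dist y x - 1) := by ring
    _ ≤ p.ρ * (dist y x - 1) := mul_le_mul_of_nonneg_right (p.σ_div_w_le x) hgap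

theorem base_le_slack {y : E} (hy : p.R + 1 ≤ ‖y‖) (x : E) : p.base x ≤ p.slack y x := by
  refine max_le (p.slack_nonneg y x) ?_
  have hw := p.w_pos x
  have hratio : p.R / p.w x ≤ 1 + max 0 (dist y x - 1) / p.w x := by
    rw [one_add_div hw.ne', div_le_div_iff_of_pos_right hw]
    have hnorm : ‖y‖ ≤ ‖x‖ + dist y x := by
      rw [dist_comm, dist_eq_norm]
      exact norm_le_norm_add_norm_sub x y
    linarith [le_max_right 0 (dist y x - 1), p.norm_le_w x]
  calc p.c * Real.log (p.R / p.w x)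
      ≤ p.c * Real.log (1 + max 0 (dist y x - 1) / p.w x) :=
        mul_le_mul_of_nonneg_left (Real.log_le_log (div_pos p.R_pos hw) hratio) p.c_pos.le
    _ ≤ p.slack y x := mul_le_mul_of_nonneg_right p.c_le
        (Real.log_nonneg (le_add_of_nonneg_right (div_nonneg (le_max_left _ _) hw.le)))

theorem log_one_add_div_sub_le {d d' w w' h : ℝ} (hd' : 0 ≤ d') (hw : 0 < w) (hw' : 0 < w')
    (hd : 0 ≤ d) (hdd' : d ≤ d' + h) (hww' : w' ≤ w + h) (hh : 0 ≤ h) :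
    Real.log (1 + d / w) - Real.log (1 + d' / w') ≤ h / w := by
  have hprod : 1 + d / w ≤ (1 + d' / w') * (1 + h / w) :=
    calc 1 + d / w ≤ 1 + (d' + h) / w := by gcongr
      _ = (1 + d' / (w + h)) * (1 + h / w) := by
          field_simp
          ring
      _ ≤ (1 + d' / w') * (1 + h / w) := by gcongr
  have hlog := Real.log_le_log (by positivity) hprod
  rw [Real.log_mul (by positivity) (by positivity)] at hlog
  linarith [Real.log_le_sub_one_of_pos (show 0 < 1 + h / w by positivity)]

theorem slack_sub_le (y x y' x' : E) :
    p.slack y x - p.slack y' x' ≤ p.σ / p.w x * (dist y y' + dist x x') := by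
  have hgap : max 0 (dist y x - 1) ≤ max 0 (dist y' x' - 1) + (dist y y' + dist x x') := by
    have htri : dist y x ≤ dist y y' + dist y' x' + dist x x' :=
      dist_comm x' x ▸ dist_triangle4 y y' x' x
    exact max_le (by positivity) (by linarith [le_max_right 0 (dist y' x' - 1)])
  have hlog := log_one_add_div_sub_le (le_max_left 0 (dist y' x' - 1)) (p.w_pos x) (p.w_pos x')
    (le_max_left 0 (dist y x - 1)) hgap
    ((p.w_le_add x x').trans (add_le_add_right (le_add_of_nonneg_left dist_nonneg) _))
    (by positivity)
  calc p.slack y x - p.slack y' x'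
      = p.σ * (Real.log (1 + max 0 (dist y x - 1) / p.w x) -
          Real.log (1 + max 0 (dist y' x' - 1) / p.w x')) := (mul_sub _ _ _).symm
    _ ≤ p.σ * ((dist y y' + dist x x') / p.w x) := mul_le_mul_of_nonneg_left hlog p.σ_pos.le
    _ = p.σ / p.w x * (dist y y' + dist x x') := by ring

theorem slack_le_add (y x y' x' : E) :
    p.slack y x ≤ p.slack y' x' + p.ρ * (dist y y' + dist x x') := by
  linarith [p.slack_sub_le y x y' x', mul_le_mul_of_nonneg_right (p.σ_div_w_le x)
    (add_nonneg (dist_nonneg (x := y) (y := y')) (dist_nonneg (x := x) (y := x')))]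

theorem lipschitzWith_slack_left (x : E) : LipschitzWith p.ρ fun y => p.slack y x :=
  LipschitzWith.of_le_add_mul _ fun y y' => by
    simpa only [dist_self, add_zero] using p.slack_le_add y x y' x

theorem lipschitzWith_slack_right (y : E) : LipschitzWith p.ρ (p.slack y) :=
  LipschitzWith.of_le_add_mul _ fun x x' => by
    simpa only [dist_self, zero_add] using p.slack_le_add y x y x'

theorem norm_add_smul_le_R [NormedSpace ℝ E] {e x : E} {s : ℝ} (he : ‖e‖ = 1) (hx : ‖x‖ ≤ p.R)
    (hs : 0 ≤ s) (hsb : s ≤ p.base x) : ‖x + s • e‖ ≤ p.R := by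
  have hw := p.w_pos x
  have hratio : 0 ≤ p.R / p.w x - 1 :=
    sub_nonneg.2 ((one_le_div hw).2 (max_le hx p.r_lt_R.le))
  have hcw : p.c ≤ p.w x := by linarith [p.c_le, p.σ_le, p.r_le_w x, p.r_pos]
  have hsw : s ≤ p.R - p.w x :=
    calc s ≤ p.c * Real.log (p.R / p.w x) := p.base_eq_log hx ▸ hsb
      _ ≤ p.c * (p.R / p.w x - 1) := mul_le_mul_of_nonneg_left
          (Real.log_le_sub_one_of_pos (div_pos p.R_pos hw)) p.c_pos.le
      _ ≤ p.w x * (p.R / p.w x - 1) := mul_le_mul_of_nonneg_right hcw hratio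
      _ = p.R - p.w x := by rw [mul_sub, mul_div_cancel₀ _ hw.ne', mul_one]
  calc ‖x + s • e‖ ≤ ‖x‖ + s := by
        simpa only [norm_smul, he, mul_one, Real.norm_of_nonneg hs] using norm_add_le x (s • e)
    _ ≤ p.R := by linarith [p.norm_le_w x]

end Normed

section Differentiability

variable {E : Type*} [NormedAddCommGroup E] [InnerProductSpace ℝ E]

theorem differentiableAt_w {x : E} (hx : ‖x‖ ≠ p.r) : DifferentiableAt ℝ p.w x := by
  rcases lt_or_gt_of_ne hx with hlt | hgt
  · have hconst : p.w =ᶠ[nhds x] fun _ => p.r := by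
      filter_upwards [continuous_norm.continuousAt.eventually_lt continuousAt_const hlt] with y hy
      exact max_eq_right hy.le
    exact (differentiableAt_const _).congr_of_eventuallyEq hconst
  · have hnorm : p.w =ᶠ[nhds x] fun y => ‖y‖ := by
      filter_upwards [continuousAt_const.eventually_lt continuous_norm.continuousAt hgt] with y hy
      exact max_eq_left hy.le
    exact (differentiableAt_id.norm ℝ
      (norm_pos_iff.1 (p.r_pos.trans hgt))).congr_of_eventuallyEq hnorm

theorem differentiableAt_base {x : E} (hr : ‖x‖ ≠ p.r) (hR : ‖x‖ ≠ p.R) :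
    DifferentiableAt ℝ p.base x := by
  rcases lt_or_gt_of_ne hR with hlt | hgt
  · have hlog : p.base =ᶠ[nhds x] fun y => p.c * (Real.log p.R - Real.log (p.w y)) := by
      filter_upwards [continuous_norm.continuousAt.eventually_lt continuousAt_const hlt] with y hy
      rw [p.base_eq_log hy.le, Real.log_div p.R_pos.ne' (p.w_pos y).ne']
    exact ((((p.differentiableAt_w hr).log (p.w_pos x).ne').const_sub _).const_mul
      _).congr_of_eventuallyEq hlog
  · exact (differentiableAt_const 0).congr_of_eventuallyEq (p.base_eventuallyEq_zero hgt)

theorem differentiableAt_slack {y x : E} (hr : ‖x‖ ≠ p.r) (hyx : 1 < dist y x) :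
    DifferentiableAt ℝ (p.slack y) x := by
  have hlog : p.slack y =ᶠ[nhds x]
      fun x => p.σ * (Real.log (p.w x + (dist y x - 1)) - Real.log (p.w x)) := by
    have hcont : Continuous fun x => dist y x := by fun_prop
    filter_upwards [continuousAt_const.eventually_lt hcont.continuousAt hyx] with x' hx'
    have hw := p.w_pos x'
    rw [slack, max_eq_right (by linarith), ← Real.log_div (by linarith) hw.ne', add_div,
      div_self hw.ne']
  have hdist : DifferentiableAt ℝ (fun x => dist y x) x :=
    (differentiableAt_const y).dist ℝ differentiableAt_id (dist_pos.1 (one_pos.trans hyx))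
  have hw := p.differentiableAt_w hr
  have hne : p.w x + (dist y x - 1) ≠ 0 := by linarith [p.w_pos x]
  exact (((hw.add (hdist.sub_const 1)).log hne).sub
    (hw.log (p.w_pos x).ne')).const_mul p.σ |>.congr_of_eventuallyEq hlog

end Differentiability

section Profile

theorem lt_norm_of_notMem_box {x : Plane} {n : ℝ} (hx : x ∉ box n) : n < ‖x‖ :=
  not_le.1 fun h => hx (mem_box_of_norm_le h)

theorem add_smul_mem_box {n : ℝ} (hn : p.R ≤ n) {e x : Plane} {s : ℝ} (he : ‖e‖ = 1)
    (hx : x ∈ box n) (hs : 0 ≤ s) (hsb : s ≤ p.base x) : x + s • e ∈ box n := by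
  rcases le_total p.R ‖x‖ with hR | hR
  · rw [p.base_eq_zero hR] at hsb
    rwa [le_antisymm hsb hs, zero_smul, add_zero]
  · exact mem_box_of_norm_le ((p.norm_add_smul_le_R he hR hs hsb).trans hn)

theorem R_le {n : ℝ} (hn : p.R + 1 ≤ n) : p.R ≤ n :=
  (le_add_of_nonneg_right zero_le_one).trans hn

variable {n : ℝ} (hn : p.R + 1 ≤ n) {e : Plane}

/-- The logarithmic profile in the square `[-n, n]²`. -/
def profile (n : ℝ) (hn : p.R + 1 ≤ n) : Profile (box n) where
  τ := p.base
  F := p.slack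
  ρ := p.ρ
  ρ_lt_one := NNReal.coe_lt_coe.1 (p.ρ_le_half.trans_lt one_half_lt_one)
  τ_nonneg := p.base_nonneg
  τ_lip := p.lipschitzWith_base
  τ_off _ hx := p.base_eq_zero ((p.R_le hn).trans (lt_norm_of_notMem_box hx).le)
  τ_le_F _ hy := p.base_le_slack (hn.trans (lt_norm_of_notMem_box hy).le)
  F_nonneg := p.slack_nonneg
  F_pos _ _ := p.slack_pos
  F_eq_zero _ _ := p.slack_eq_zero
  F_le _ _ := p.slack_le
  F_lip_left := p.lipschitzWith_slack_left
  F_lip_right := p.lipschitzWith_slack_right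
  stay _ he _ hx _ := p.add_smul_mem_box (p.R_le hn) he hx
  bounded := isBounded_box n
  measurableSet := measurableSet_box n

theorem smoothOff : (p.profile n hn).SmoothOff (Metric.sphere 0 p.r ∪ Metric.sphere 0 p.R) where
  measurableSet := Metric.isClosed_sphere.measurableSet.union Metric.isClosed_sphere.measurableSet
  null := measure_union_null (Measure.addHaar_sphere _ _ _) (Measure.addHaar_sphere _ _ _)
  τ_diff x hx := by
    simp only [mem_union, mem_sphere_iff_norm, sub_zero, not_or] at hx
    exact p.differentiableAt_base hx.1 hx.2
  F_diff x hx y := by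
    simp only [mem_union, mem_sphere_iff_norm, sub_zero, not_or] at hx
    exact p.differentiableAt_slack hx.1

theorem abs_slope_le (he : ‖e‖ = 1) (X : Config) (x : Plane) :
    |(p.profile n hn).slope e X x| ≤ p.σ / p.w x := by
  have hdist : ∀ s : ℝ, dist x (x + s • e) = |s| := fun s => by
    rw [dist_self_add_right, norm_smul, he, mul_one, Real.norm_eq_abs]
  refine (p.profile n hn).abs_slope_le (div_pos p.σ_pos (p.w_pos x)).le (fun s => ?_)
    (fun y s => ?_) X
  · exact hdist s ▸ p.base_sub_le x (x + s • e)
  · have hslack := p.slack_sub_le y x y (x + s • e)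
    rwa [dist_self, zero_add, hdist] at hslack

theorem slope_eq_zero (e : Plane) (X : Config) {x : Plane} (hx : p.R < ‖x‖) :
    (p.profile n hn).slope e X x = 0 := by
  have htime : (p.profile n hn).time X x = (p.profile n hn).τ x := by
    have hτ : (p.profile n hn).τ x = 0 := p.base_eq_zero hx.le
    exact ((p.profile n hn).time_le X x).antisymm (hτ ▸ (p.profile n hn).time_nonneg X x)
  have hline : Filter.Tendsto (fun s : ℝ => x + s • e) (nhds 0) (nhds x) := by
    have hcont : Continuous fun s : ℝ => x + s • e := by fun_prop
    simpa only [zero_smul, add_zero] using hcont.tendsto 0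
  have hzero : (fun s : ℝ => p.base (x + s • e)) =ᶠ[nhds 0] fun _ => 0 :=
    hline.eventually (p.base_eventuallyEq_zero hx)
  rw [Profile.slope, if_pos htime]
  exact hzero.deriv_eq.trans (deriv_const _ _)

end Profile

end LogParams

/-! ### Slow particles and chains with small gaps -/

section FreezeChain

variable {E α : Type*} [ConditionallyCompleteLinearOrder α] {τ : E → α} {Φ : E → α → E → α}
  {S : Set E} {m : ℕ} {y : ℕ → E}

/-- The points `y 0, …, y m` of `S` form a chain along which the value of `freeze` at `y 0` is
determined: each point is frozen by the next one, and the last one takes its base value. -/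
structure IsFreezeChain (τ : E → α) (Φ : E → α → E → α) (S : Set E) (m : ℕ) (y : ℕ → E) :
    Prop where
  mem : ∀ l ≤ m, y l ∈ S
  ne : ∀ l < m, y (l + 1) ≠ y l
  freeze_eq : ∀ l < m, freeze τ Φ S (y l) = Φ (y (l + 1)) (freeze τ Φ S (y (l + 1))) (y l)
  last : freeze τ Φ S (y m) = τ (y m)

theorem IsFreezeChain.cons {x : E} (h : IsFreezeChain τ Φ S m y) (hx : x ∈ S) (hne : y 0 ≠ x)
    (heq : freeze τ Φ S x = Φ (y 0) (freeze τ Φ S (y 0)) x) :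
    IsFreezeChain τ Φ S (m + 1) fun l => Nat.casesOn l x y where
  mem
    | 0, _ => hx
    | l + 1, hl => h.mem l (Nat.succ_le_succ_iff.1 hl)
  ne
    | 0, _ => hne
    | l + 1, hl => h.ne l (Nat.succ_lt_succ_iff.1 hl)
  freeze_eq
    | 0, _ => heq
    | l + 1, hl => h.freeze_eq l (Nat.succ_lt_succ_iff.1 hl)
  last := h.last

theorem exists_isFreezeChain (hS : S.Finite) (hΦ : ∀ y t x, t ≤ Φ y t x)
    (hmono : ∀ y x, StrictMono fun t => Φ y t x) {x : E} (hx : x ∈ S) :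
    ∃ (m : ℕ) (y : ℕ → E), IsFreezeChain τ Φ S m y ∧ y 0 = x := by
  induction x using freeze_induction (τ := τ) hS hΦ hmono with
  | base x hbase =>
    exact ⟨0, fun _ => x, ⟨fun _ _ => hx, fun _ hl => absurd hl (Nat.not_lt_zero _),
      fun _ hl => absurd hl (Nat.not_lt_zero _), hbase⟩, rfl⟩
  | step x v hv ih heq =>
    rcases eq_or_ne v x with rfl | hvx
    · exact ih hv
    · obtain ⟨m, y, hy, rfl⟩ := ih hv
      exact ⟨m + 1, _, hy.cons hx hvx heq, rfl⟩

end FreezeChain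

theorem add_sum_range_le_mul_prod {A : ℝ} {d w : ℕ → ℝ} (hd : ∀ l, 0 ≤ d l) (hw : ∀ l, 0 < w l)
    {q : ℕ} (h : ∀ l < q, w l ≤ A + ∑ i ∈ Finset.range l, d i) :
    A + ∑ i ∈ Finset.range q, d i ≤ A * ∏ i ∈ Finset.range q, (1 + d i / w i) := by
  induction q with
  | zero => simp
  | succ q ih =>
    have hstep : d q ≤ (A + ∑ i ∈ Finset.range q, d i) * (d q / w q) := by
      rw [mul_div_left_comm]
      exact le_mul_of_one_le_right (hd q) ((one_le_div (hw q)).2 (h q q.lt_succ_self))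
    rw [Finset.sum_range_succ, Finset.prod_range_succ, ← mul_assoc]
    calc A + (∑ i ∈ Finset.range q, d i + d q)
        ≤ (A + ∑ i ∈ Finset.range q, d i) * (1 + d q / w q) := by linarith
      _ ≤ (A * ∏ i ∈ Finset.range q, (1 + d i / w i)) * (1 + d q / w q) :=
          mul_le_mul_of_nonneg_right (ih fun l hl => h l (hl.trans q.lt_succ_self))
            (add_nonneg zero_le_one (div_nonneg (hd q) (hw q).le))

theorem le_of_forall_le_add {α : Type*} [Preorder α] {ℓ m : ℕ} (hℓ : 0 < ℓ) {f : ℕ → α} {a : α}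
    (hstart : ∀ q < ℓ, a ≤ f q) (hstep : ∀ j, j + ℓ ≤ m → f j ≤ f (j + ℓ)) : a ≤ f m := by
  induction m using Nat.strong_induction_on with
  | _ m ih =>
    rcases lt_or_ge m ℓ with hm | hm
    · exact hstart m hm
    · have hlast := hstep (m - ℓ) (Nat.sub_add_cancel hm).le
      rw [Nat.sub_add_cancel hm] at hlast
      exact (ih (m - ℓ) (Nat.sub_lt (hℓ.trans_le hm) hℓ)
        fun j hj => hstep j (hj.trans (Nat.sub_le m ℓ))).trans hlast

section Gap

/-- The distance between the unit disks at `y i` and `y (i + 1)`. -/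
def gap {E : Type*} [Dist E] (y : ℕ → E) (i : ℕ) : ℝ := max 0 (dist (y (i + 1)) (y i) - 1)

theorem gap_nonneg {E : Type*} [Dist E] (y : ℕ → E) (i : ℕ) : 0 ≤ gap y i := le_max_left _ _

theorem norm_le_add_sum_gap {E : Type*} [SeminormedAddCommGroup E] (y : ℕ → E) (i : ℕ) :
    ‖y i‖ ≤ ‖y 0‖ + i + ∑ l ∈ Finset.range i, gap y l := by
  induction i with
  | zero => simp
  | succ i ih =>
    have hgap : dist (y (i + 1)) (y i) - 1 ≤ gap y i := le_max_right _ _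
    have hnorm := norm_sub_norm_le (y (i + 1)) (y i)
    rw [← dist_eq_norm] at hnorm
    rw [Finset.sum_range_succ]
    push_cast
    linarith

end Gap

namespace LogParams

variable (p : LogParams) {E : Type*} [SeminormedAddCommGroup E]

theorem w_le_add_sum_gap (y : ℕ → E) (i : ℕ) :
    p.w (y i) ≤ p.w (y 0) + i + ∑ l ∈ Finset.range i, gap y l := by
  have hsum : 0 ≤ ∑ l ∈ Finset.range i, gap y l := Finset.sum_nonneg fun l _ => gap_nonneg y l
  refine max_le ((norm_le_add_sum_gap y i).trans ?_) ?_
  · gcongr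
    exact p.norm_le_w _
  · linarith [p.r_le_w (y 0), i.cast_nonneg (α := ℝ)]

theorem sum_slack (y : ℕ → E) (q : ℕ) :
    ∑ i ∈ Finset.range q, p.slack (y (i + 1)) (y i) =
      p.σ * Real.log (∏ i ∈ Finset.range q, (1 + gap y i / p.w (y i))) := by
  have hpos : ∀ i, 0 < 1 + gap y i / p.w (y i) := fun i =>
    add_pos_of_pos_of_nonneg one_pos (div_nonneg (gap_nonneg y i) (p.w_pos _).le)
  rw [Real.log_prod fun i _ => (hpos i).ne', Finset.mul_sum]
  rfl

/-- The base shift of `y m` plus the slack collected on the way back to `y 0`. -/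
def delay (y : ℕ → E) (m : ℕ) : ℝ :=
  p.base (y m) + ∑ i ∈ Finset.range m, p.slack (y (i + 1)) (y i)

theorem delay_add (y : ℕ → E) (j ℓ : ℕ) :
    p.delay y (j + ℓ) = p.delay y j + (p.delay (fun i => y (j + i)) ℓ - p.base (y j)) := by
  simp only [delay, Finset.sum_range_add, add_assoc]
  ring

theorem le_delay {A : ℝ} (hA : 0 < A) {y : ℕ → E} {q : ℕ}
    (h : ∀ l ≤ q, p.w (y l) ≤ A + ∑ i ∈ Finset.range l, gap y i) :
    p.c * Real.log (p.R / A) +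
      (p.σ - p.c) * Real.log (1 + (∑ i ∈ Finset.range q, gap y i) / A) ≤ p.delay y q := by
  set D := ∑ i ∈ Finset.range q, gap y i
  have hratio : 0 < 1 + D / A := add_pos_of_pos_of_nonneg one_pos
    (div_nonneg (Finset.sum_nonneg fun i _ => gap_nonneg y i) hA.le)
  have hbase : p.c * (Real.log (p.R / A) - Real.log (1 + D / A)) ≤ p.base (y q) := by
    have hAD : A * (1 + D / A) = A + D := by rw [mul_add, mul_one, mul_div_cancel₀ _ hA.ne']
    rw [← Real.log_div (div_pos p.R_pos hA).ne' hratio.ne', div_div, hAD]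
    refine (mul_le_mul_of_nonneg_left (Real.log_le_log ?_ ?_) p.c_pos.le).trans (le_max_right _ _)
    · exact div_pos p.R_pos (hAD ▸ mul_pos hA hratio)
    · exact div_le_div_of_nonneg_left p.R_pos.le (p.w_pos _) (h q le_rfl)
  have hslack : p.σ * Real.log (1 + D / A) ≤
      ∑ i ∈ Finset.range q, p.slack (y (i + 1)) (y i) := by
    rw [p.sum_slack]
    refine mul_le_mul_of_nonneg_left (Real.log_le_log hratio ?_) p.σ_pos.le
    rw [one_add_div hA.ne', div_le_iff₀' hA]
    exact add_sum_range_le_mul_prod (gap_nonneg y) (fun l => p.w_pos (y l)) fun l hl => h l hl.le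
  rw [delay]
  linarith

theorem sum_gap_le_of_delay_lt {ε : ℝ} (hε : 0 ≤ ε) {ℓ : ℕ}
    (hgrow : ∀ w, p.r ≤ w →
      p.c * Real.log (1 + ℓ / w) ≤ (p.σ - p.c) * Real.log (1 + ε * ℓ / (w + ℓ)))
    {y : ℕ → E} (h : p.delay y ℓ < p.base (y 0)) (hR : ‖y 0‖ ≤ p.R) :
    ∑ i ∈ Finset.range ℓ, gap y i ≤ ε * ℓ := by
  set w := p.w (y 0)
  set D := ∑ i ∈ Finset.range ℓ, gap y i
  have hw : 0 < w := p.w_pos _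
  have hA : 0 < w + ℓ := add_pos_of_pos_of_nonneg hw ℓ.cast_nonneg
  have hD : 0 ≤ D := Finset.sum_nonneg fun i _ => gap_nonneg y i
  have hdelay := p.le_delay hA (q := ℓ) fun l hl =>
    (p.w_le_add_sum_gap y l).trans (by gcongr)
  have hlog : Real.log (p.R / w) = Real.log (p.R / (w + ℓ)) + Real.log (1 + ℓ / w) := by
    rw [one_add_div hw.ne', ← Real.log_mul (div_pos p.R_pos hA).ne' (div_pos hA hw).ne',
      div_mul_div_cancel₀ hA.ne']
  rw [p.base_eq_log hR, hlog] at h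
  have hlt : (p.σ - p.c) * Real.log (1 + D / (w + ℓ)) <
      (p.σ - p.c) * Real.log (1 + ε * ℓ / (w + ℓ)) := by
    linarith [hgrow w (p.r_le_w _)]
  have hratio := (Real.log_lt_log_iff (by positivity) (by positivity)).1
    (lt_of_mul_lt_mul_left hlt (sub_nonneg.2 p.c_le))
  exact ((div_lt_div_iff_of_pos_right hA).1 (lt_of_add_lt_add_left hratio)).le

theorem le_delay_of_norm_le {ℓ q : ℕ} (hq : q < ℓ) {y : ℕ → E} (hy : ‖y 0‖ + ℓ ≤ p.r + 1) :
    p.c * Real.log (p.R / p.r) ≤ p.delay y q := by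
  have hsum : ∀ l, 0 ≤ ∑ i ∈ Finset.range l, gap y i := fun l =>
    Finset.sum_nonneg fun i _ => gap_nonneg y i
  refine le_trans (le_add_of_nonneg_right ?_) (p.le_delay p.r_pos (q := q) fun l hl => ?_)
  · exact mul_nonneg (sub_nonneg.2 p.c_le)
      (Real.log_nonneg (le_add_of_nonneg_right (div_nonneg (hsum q) p.r_pos.le)))
  · have hlℓ : (l : ℝ) + 1 ≤ ℓ := by exact_mod_cast hl.trans_lt hq
    exact max_le ((norm_le_add_sum_gap y l).trans (by linarith))
      (le_add_of_nonneg_right (hsum l))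

end LogParams

section Percolation

namespace LogParams

variable (p : LogParams) {n : ℝ} {hn : p.R + 1 ≤ n} {S : Set Plane} {m : ℕ} {y : ℕ → Plane}

theorem freeze_eq_delay
    (hy : IsFreezeChain (p.profile n hn).τ (p.profile n hn).step S m y) :
    freeze (p.profile n hn).τ (p.profile n hn).step S (y 0) = p.delay y m := by
  set t := freeze (p.profile n hn).τ (p.profile n hn).step S
  have hsum : ∀ q ≤ m, t (y 0) = t (y q) + ∑ i ∈ Finset.range q, p.slack (y (i + 1)) (y i) := by
    intro q hq
    induction q with
    | zero => simp
    | succ q ih =>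
      have hstep : t (y q) = t (y (q + 1)) + p.slack (y (q + 1)) (y q) := hy.freeze_eq q hq
      rw [ih (Nat.le_of_succ_le hq), hstep, Finset.sum_range_succ]
      ring
  exact (hsum m le_rfl).trans (congrArg (· + _) hy.last)

theorem strictAntiOn_freeze_chain (hS : S.Pairwise fun x y => 1 < dist x y)
    (hy : IsFreezeChain (p.profile n hn).τ (p.profile n hn).step S m y) :
    StrictAntiOn (fun i => freeze (p.profile n hn).τ (p.profile n hn).step S (y i)) (Iic m) :=
  strictAntiOn_of_succ_lt ordConnected_Iic fun i _ _ hi' => by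
    rw [Order.succ_eq_add_one, mem_Iic, Nat.add_one_le_iff] at hi'
    have hstep := hy.freeze_eq i hi'
    have hpos : 0 < p.slack (y (i + 1)) (y i) :=
      p.slack_pos (hS (hy.mem _ hi') (hy.mem _ hi'.le) (hy.ne i hi'))
    exact (lt_add_of_pos_right _ hpos).trans_eq hstep.symm

/-- If the delay dropped over no window of `ℓ` steps of the chain that determines the shift of `x`,
then at its end it would be at least the full shift `p.c * Real.log (p.R / p.r)`. -/
theorem exists_short_chain {ε : ℝ} (hε : 0 ≤ ε) {ℓ : ℕ} (hℓ : 0 < ℓ)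
    (hgrow : ∀ w, p.r ≤ w →
      p.c * Real.log (1 + ℓ / w) ≤ (p.σ - p.c) * Real.log (1 + ε * ℓ / (w + ℓ)))
    (hfin : S.Finite) (hS : S.Pairwise fun x y => 1 < dist x y) {x : Plane} (hx : x ∈ S)
    (hxr : ‖x‖ + ℓ ≤ p.r + 1)
    (hslow : freeze (p.profile n hn).τ (p.profile n hn).step S x < p.c * Real.log (p.R / p.r)) :
    ∃ y : ℕ → Plane, MapsTo y (Iic ℓ) S ∧ InjOn y (Iic ℓ) ∧ ‖y 0‖ < p.R ∧
      ∑ i ∈ Finset.range ℓ, gap y i ≤ ε * ℓ := by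
  obtain ⟨m, y, hy, rfl⟩ := exists_isFreezeChain hfin (p.profile n hn).le_step
    (p.profile n hn).strictMono_step hx
  have hdrop : ∃ j, j + ℓ ≤ m ∧ p.delay y (j + ℓ) < p.delay y j := by
    by_contra! hmono
    exact hslow.not_ge (p.freeze_eq_delay hy ▸
      le_of_forall_le_add hℓ (fun q hq => p.le_delay_of_norm_le hq hxr) hmono)
  obtain ⟨j, hj, hlt⟩ := hdrop
  rw [p.delay_add, add_lt_iff_neg_left, sub_neg] at hlt
  have hwin : ∀ i ∈ Iic ℓ, j + i ∈ Iic m := fun i hi => (Nat.add_le_add_left hi j).trans hj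
  have hbase : 0 < p.base (y j) := (add_nonneg (p.base_nonneg _)
    (Finset.sum_nonneg fun i _ => p.slack_nonneg _ _)).trans_lt hlt
  have hR : ‖y j‖ < p.R := lt_of_not_ge fun hle => hbase.ne' (p.base_eq_zero hle)
  have hinj : InjOn y (Iic m) := (p.strictAntiOn_freeze_chain hS hy).injOn.of_comp
  exact ⟨fun i => y (j + i), fun i hi => hy.mem _ (hwin i hi),
    hinj.comp (add_right_injective j).injOn hwin, hR,
    p.sum_gap_le_of_delay_lt hε hgrow hlt hR.le⟩

end LogParams

end Percolation

/-! ### The probability of slow particles -/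

theorem lintegral_ofReal_fun_norm {f : ℝ → ℝ} (hf : ∀ r, 0 ≤ f r)
    (hintegrable : IntegrableOn (fun r => r * f r) (Ioi 0)) :
    ∫⁻ p : Plane, ENNReal.ofReal (f ‖p‖) =
      ENNReal.ofReal (2 * Real.pi * ∫ r in Ioi 0, r * f r) := by
  have hdim : Module.finrank ℝ Plane = 2 := finrank_euclideanSpace_fin
  have hball : volume.real (Metric.ball (0 : Plane) 1) = Real.pi := by
    rw [Measure.real, EuclideanSpace.volume_ball_fin_two]
    simp [Real.pi_nonneg]
  have hnorm : Integrable fun p : Plane => f ‖p‖ := by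
    rw [integrable_fun_norm_addHaar volume]
    simpa [hdim] using hintegrable
  rw [← ofReal_integral_eq_lintegral_ofReal hnorm (.of_forall fun p => hf _),
    integral_fun_norm_addHaar volume, hdim, hball]
  simp [mul_assoc]

section Gap

variable {ε : ℝ}

/-- The weight of a step `v` between two particles, decaying exponentially at rate `1 / ε` in the
gap `‖v‖ - 1` between their disks. It is normalised so that a chain of average gap at most `ε` has
weight at least one. -/
def gapWeight {E : Type*} [Norm E] (ε : ℝ) (v : E) : ℝ≥0∞ :=
  ENNReal.ofReal ((Ioi 1).indicator (fun r => Real.exp (1 - (r - 1) / ε)) ‖v‖)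

theorem measurable_gapWeight (ε : ℝ) : Measurable (gapWeight ε : Plane → ℝ≥0∞) := by
  have hprofile : Measurable ((Ioi 1).indicator fun r => Real.exp (1 - (r - 1) / ε)) :=
    .indicator (by fun_prop) measurableSet_Ioi
  exact (hprofile.comp measurable_norm).ennreal_ofReal

theorem hasDerivAt_neg_mul_exp_gap (hε : ε ≠ 0) (r : ℝ) :
    HasDerivAt (fun r => -(ε * r + ε ^ 2) * Real.exp (1 - (r - 1) / ε))
      (r * Real.exp (1 - (r - 1) / ε)) r := by
  have hpoly : HasDerivAt (fun r : ℝ => -(ε * r + ε ^ 2)) (-(ε * 1)) r :=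
    (((hasDerivAt_id r).const_mul ε).add_const _).neg
  have hexp : HasDerivAt (fun r : ℝ => Real.exp (1 - (r - 1) / ε))
      (Real.exp (1 - (r - 1) / ε) * -(1 / ε)) r :=
    ((((hasDerivAt_id r).sub_const 1).div_const ε).const_sub 1).exp
  refine (hpoly.mul hexp).congr_deriv ?_
  field_simp
  ring

theorem tendsto_neg_mul_exp_gap (hε : 0 < ε) :
    Filter.Tendsto (fun r => -(ε * r + ε ^ 2) * Real.exp (1 - (r - 1) / ε)) Filter.atTop
      (nhds 0) := by
  have hlim := (((Real.tendsto_pow_mul_exp_neg_atTop_nhds_zero 1).add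
    (Real.tendsto_pow_mul_exp_neg_atTop_nhds_zero 0)).comp
      (Filter.tendsto_id.atTop_div_const hε)).const_mul (-(ε ^ 2) * Real.exp (1 + 1 / ε))
  rw [add_zero, mul_zero] at hlim
  refine hlim.congr fun r => ?_
  have hsplit : Real.exp (1 - (r - 1) / ε) = Real.exp (1 + 1 / ε) * Real.exp (-(r / ε)) := by
    rw [← Real.exp_add]
    congr 1
    ring
  simp only [Function.comp_apply, id_eq, hsplit]
  field_simp

theorem lintegral_gapWeight (hε : 0 < ε) :
    ∫⁻ v : Plane, gapWeight ε v =
      ENNReal.ofReal (2 * Real.pi * ((ε + ε ^ 2) * Real.exp 1)) := by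
  have hderiv : ∀ r ∈ Ici (1 : ℝ), HasDerivAt _ (r * Real.exp (1 - (r - 1) / ε)) r :=
    fun r _ => hasDerivAt_neg_mul_exp_gap hε.ne' r
  have hpos : ∀ r ∈ Ioi (1 : ℝ), 0 ≤ r * Real.exp (1 - (r - 1) / ε) := fun r hr =>
    mul_nonneg (zero_le_one.trans (mem_Ioi.1 hr).le) (Real.exp_nonneg _)
  have hsub : Ioi (1 : ℝ) ⊆ Ioi 0 := Ioi_subset_Ioi zero_le_one
  have hindicator (r : ℝ) : r * (Ioi 1).indicator (fun r => Real.exp (1 - (r - 1) / ε)) r =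
      (Ioi 1).indicator (fun r => r * Real.exp (1 - (r - 1) / ε)) r :=
    (indicator_mul_right _ (fun r => r) _).symm
  have hintegrable := integrableOn_Ioi_deriv_of_nonneg' hderiv hpos (tendsto_neg_mul_exp_gap hε)
  unfold gapWeight
  rw [lintegral_ofReal_fun_norm (indicator_nonneg fun _ _ => Real.exp_nonneg _)]
  · simp only [hindicator]
    rw [setIntegral_indicator measurableSet_Ioi, inter_eq_self_of_subset_right hsub,
      integral_Ioi_of_hasDerivAt_of_nonneg' hderiv hpos (tendsto_neg_mul_exp_gap hε)]
    congr 2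
    rw [sub_self, zero_div, sub_zero]
    ring
  · simp only [hindicator]
    exact (hintegrable.integrable_indicator measurableSet_Ioi).integrableOn

theorem one_le_prod_gapWeight {E : Type*} [SeminormedAddCommGroup E] (hε : 0 < ε) {ℓ : ℕ}
    {y : ℕ → E} (hy : ∀ i < ℓ, 1 < dist (y i) (y (i + 1)))
    (hsum : ∑ i ∈ Finset.range ℓ, (dist (y i) (y (i + 1)) - 1) ≤ ε * ℓ) :
    1 ≤ ∏ i ∈ Finset.range ℓ, gapWeight ε (y i - y (i + 1)) := by
  have hprod : ∏ i ∈ Finset.range ℓ, gapWeight ε (y i - y (i + 1)) =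
      ∏ i ∈ Finset.range ℓ, ENNReal.ofReal (Real.exp (1 - (dist (y i) (y (i + 1)) - 1) / ε)) :=
    Finset.prod_congr rfl fun i hi => by
      rw [gapWeight, ← dist_eq_norm, indicator_of_mem (mem_Ioi.2 (hy i (Finset.mem_range.1 hi)))]
  rw [hprod, ← ENNReal.ofReal_prod_of_nonneg fun _ _ => Real.exp_nonneg _, ← Real.exp_sum,
    ENNReal.one_le_ofReal, Real.one_le_exp_iff, Finset.sum_sub_distrib, ← Finset.sum_div,
    Finset.sum_const, Finset.card_range, nsmul_one, sub_nonneg, div_le_iff₀ hε]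
  linarith

theorem one_le_chainTotal_gapWeight {E : Type*} [SeminormedAddCommGroup E] (hε : 0 < ε) {R : ℝ}
    {k ℓ : ℕ} {x : Fin k → E} {y : ℕ → E} (hx : (range x).Pairwise fun u v => 1 < dist u v)
    (hyx : MapsTo y (Iic ℓ) (range x)) (hinj : InjOn y (Iic ℓ)) (hyR : ‖y 0‖ < R)
    (hsum : ∑ i ∈ Finset.range ℓ, gap y i ≤ ε * ℓ) :
    1 ≤ chainTotal (gapWeight ε) ((Metric.ball 0 R).indicator fun _ => 1) ℓ k x := by
  have hrange (i : ℕ) : ℓ - i ∈ Iic ℓ := mem_Iic.2 (ℓ.sub_le i)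
  have hprod := prod_le_chainTotal (g := gapWeight ε) (a := (Metric.ball 0 R).indicator fun _ => 1)
    (y := fun i => y (ℓ - i)) (fun i _ => hyx (hrange i)) fun i hi j hj hij =>
      (tsub_right_inj hi hj).1 (hinj (hrange i) (hrange j) hij)
  rw [Nat.sub_self, indicator_of_mem (mem_ball_zero_iff.2 hyR), mul_one] at hprod
  have hstep : ∀ i < ℓ, 1 < dist (y (ℓ - i)) (y (ℓ - (i + 1))) := fun i hi =>
    hx (hyx (hrange i)) (hyx (hrange _)) (hinj.ne (hrange i) (hrange _) (by omega))
  refine (one_le_prod_gapWeight hε hstep ?_).trans hprod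
  refine le_trans ?_ ((Finset.sum_range_reflect (gap y) ℓ).trans_le hsum)
  refine Finset.sum_le_sum fun i hi => ?_
  rw [gap, show ℓ - 1 - i + 1 = ℓ - i by have := Finset.mem_range.1 hi; omega,
    show ℓ - 1 - i = ℓ - (i + 1) by omega]
  exact le_max_right _ _

end Gap

theorem sum_indicator_ball_le {A : Finset Plane}
    (hA : (A : Set Plane).Pairwise fun x y => 1 < dist x y) {R : ℝ} (hR : 0 ≤ R) :
    ∑ x ∈ A, (Metric.ball (0 : Plane) R).indicator (fun _ => (1 : ℝ≥0∞)) x ≤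
      ENNReal.ofReal ((2 * R + 1) ^ 2) := by
  have hpacking := sum_mul_measure_ball_le_lintegral volume (r := 1 / 2)
    (hA.imp fun {x y} h => by linarith) (f := (Metric.ball (0 : Plane) R).indicator fun _ => 1)
    (h := (Metric.ball (0 : Plane) (R + 1 / 2)).indicator fun _ => 1) fun x _ q hq => by
      by_cases hx : x ∈ Metric.ball (0 : Plane) R
      · have hq' : q ∈ Metric.ball (0 : Plane) (R + 1 / 2) :=
          (dist_triangle q x 0).trans_lt (by linarith [Metric.mem_ball.1 hq, Metric.mem_ball.1 hx])
        rw [indicator_of_mem hx, indicator_of_mem hq']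
      · rw [indicator_of_notMem hx]
        exact zero_le
  simp only [volume_ball_half, ← Finset.sum_mul] at hpacking
  have harea : ∫⁻ p : Plane, (Metric.ball 0 (R + 1 / 2)).indicator (fun _ => 1) p =
      ENNReal.ofReal ((2 * R + 1) ^ 2) * ENNReal.ofReal (Real.pi / 4) := by
    rw [lintegral_indicator_const measurableSet_ball, one_mul,
      EuclideanSpace.volume_ball_fin_two, ← NNReal.coe_real_pi, ← ENNReal.ofReal_pow (by linarith),
      ← ENNReal.ofReal_mul (by positivity), ← ENNReal.ofReal_mul (by positivity)]
    congr 1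
    ring
  rw [harea] at hpacking
  exact (ENNReal.mul_le_mul_iff_left (ENNReal.ofReal_pos.2 (by positivity)).ne'
    ENNReal.ofReal_ne_top).1 hpacking

theorem pairwise_range_of_mem_hardTuples {Λ : Set Plane} {Y : Config} {k : ℕ}
    {x : Fin k → Plane} (hx : x ∈ hardTuples Λ Y k) :
    (range x).Pairwise fun u v => 1 < dist u v :=
  fun u hu v hv => hx.2 u (Or.inl hu) v (Or.inl hv)

theorem chainTotal_zero_le {Λ : Set Plane} {Y : Config} (g : Plane → ℝ≥0∞) {R : ℝ} (hR : 0 ≤ R)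
    {k : ℕ} {x : Fin k → Plane} (hx : x ∈ properTuples Λ Y k) :
    chainTotal g ((Metric.ball (0 : Plane) R).indicator fun _ => 1) 0 k x ≤
      ENNReal.ofReal ((2 * R + 1) ^ 2) := by
  classical
  cases k with
  | zero => exact bot_le
  | succ k =>
    simp only [chainTotal, chainSum]
    rw [← Finset.sum_image (f := (Metric.ball (0 : Plane) R).indicator fun _ => (1 : ℝ≥0∞))
      (g := x) (s := Finset.univ) hx.2.injOn]
    refine sum_indicator_ball_le ?_ hR
    rw [Finset.coe_image, Finset.coe_univ, image_univ]
    exact pairwise_range_of_mem_hardTuples hx.1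

namespace LogParams

variable (p : LogParams) {n : ℝ}

/-- Configurations all of whose particles in the box of size `s` move by the full amount. -/
def goodSet (hn : p.R + 1 ≤ n) (s : ℝ) : Set Config :=
  {X | ∀ x ∈ X.carrier, x ∈ box s → (p.profile n hn).time X x = p.c * Real.log (p.R / p.r)}

theorem measurableSet_goodSet (hn : p.R + 1 ≤ n) (s : ℝ) : MeasurableSet (p.goodSet hn s) :=
  measurableSet_forall_mem measurable_id <|
    .imp (measurable_snd (measurableSet_box s))
      (measurableSet_eq_fun (p.profile n hn).measurable_time measurable_const)

theorem base_le {E : Type*} [SeminormedAddCommGroup E] (x : E) :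
    p.base x ≤ p.c * Real.log (p.R / p.r) :=
  max_le (mul_nonneg p.c_pos.le (Real.log_nonneg ((one_le_div p.r_pos).2 p.r_lt_R.le)))
    (mul_le_mul_of_nonneg_left (Real.log_le_log (div_pos p.R_pos (p.w_pos x))
      (div_le_div_of_nonneg_left p.R_pos.le p.r_pos (p.r_le_w x))) p.c_pos.le)

theorem exists_freeze_lt_of_glue_notMem_goodSet {hn : p.R + 1 ≤ n} {s : ℝ} (hs : s ≤ n)
    {Y : Config} {k : ℕ} {x : Fin k → Plane} (hx : ∀ i, x i ∈ box n)
    (hbad : Config.glue (box n) Y x ∉ p.goodSet hn s) :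
    ∃ v ∈ range x ∩ box s, freeze (p.profile n hn).τ (p.profile n hn).step (range x) v <
      p.c * Real.log (p.R / p.r) := by
  simp only [goodSet, mem_ofPred_eq, not_forall] at hbad
  obtain ⟨v, hv, hvs, hne⟩ := hbad
  have hvn : v ∈ box n := fun i => (hvs i).trans hs
  have hlt := (((p.profile n hn).time_le _ v).trans (p.base_le v)).lt_of_ne hne
  rw [Profile.time, shiftTime_of_mem _ hvn, glue_inter Y hx] at hlt
  exact ⟨v, ⟨glue_inter Y hx ▸ ⟨hv, hvn⟩, hvs⟩, hlt⟩

theorem gibbs_compl_goodSet_le (z : ℝ) (hn : p.R + 1 ≤ n) {ε : ℝ} (hε : 0 < ε) {ℓ : ℕ}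
    (hℓ : 0 < ℓ)
    (hgrow : ∀ w, p.r ≤ w → p.c * Real.log (1 + ℓ / w) ≤
      (p.σ - p.c) * Real.log (1 + ε * ℓ / (w + ℓ)))
    {s : ℝ} (hsn : s ≤ n) (hs : √2 * s + ℓ ≤ p.r + 1) (Y : Config) :
    gibbs z (box n) Y (p.goodSet hn s)ᶜ ≤
      (ENNReal.ofReal z * ENNReal.ofReal (2 * Real.pi * ((ε + ε ^ 2) * Real.exp 1))) ^ ℓ *
        ENNReal.ofReal ((2 * p.R + 1) ^ 2) := by
  refine gibbs_le_of_hardSum_le z (measurableSet_box n) (p.measurableSet_goodSet hn s).compl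
    (B := chainTotal (gapWeight ε) ((Metric.ball 0 p.R).indicator fun _ => 1) ℓ)
    (fun k x hx hbad => ?_) ?_
  · obtain ⟨v, ⟨hv, hvs⟩, hslow⟩ :=
      p.exists_freeze_lt_of_glue_notMem_goodSet hsn (mem_of_mem_hardTuples hx.1) hbad
    have hpair := pairwise_range_of_mem_hardTuples hx.1
    obtain ⟨y, hyx, hinj, hyR, hsum⟩ := p.exists_short_chain hε.le hℓ hgrow (finite_range x)
      hpair hv (by linarith [norm_le_of_mem_box hvs]) hslow
    exact one_le_chainTotal_gapWeight hε hpair hyx hinj hyR hsum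
  · refine (hardSum_chainTotal_le (measurable_gapWeight ε)
      (measurable_const.indicator measurableSet_ball) z (measurableSet_box n) Y ℓ).trans ?_
    rw [lintegral_gapWeight hε, mul_assoc (_ ^ ℓ), ← hardSum_const]
    gcongr
    exact hardSum_mono z (measurableSet_box n) fun k x hx =>
      chainTotal_zero_le _ p.R_pos.le hx

end LogParams

/-! ### The integral of the logarithm of the Jacobians -/

theorem abs_log_add_log_le {a b : ℝ} (hab : |a| ≤ b) (hb : b ≤ 1 / 20) :
    |Real.log (1 + a) + Real.log (1 + -a)| ≤ 101 / 100 * b ^ 2 := by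
  have ha : a ^ 2 ≤ b ^ 2 := sq_le_sq' (abs_le.1 hab).1 (abs_le.1 hab).2
  have hb2 : b ^ 2 ≤ 1 / 400 := by nlinarith [abs_nonneg a]
  have hpos : 0 < 1 - a ^ 2 := by linarith
  have hinv : (1 - a ^ 2)⁻¹ ≤ 1 + 101 / 100 * b ^ 2 := by
    rw [inv_le_comm₀ hpos (by positivity), inv_eq_one_div, div_le_iff₀ (by positivity)]
    nlinarith [sq_nonneg a, sq_nonneg b]
  calc |Real.log (1 + a) + Real.log (1 + -a)|
      = |Real.log (1 - a ^ 2)| := by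
        rw [← Real.log_mul (by linarith [abs_le.1 hab]) (by linarith [abs_le.1 hab])]
        ring_nf
    _ = -Real.log (1 - a ^ 2) :=
        abs_of_nonpos (Real.log_nonpos hpos.le (sub_le_self _ (sq_nonneg a)))
    _ ≤ (1 - a ^ 2)⁻¹ - 1 := by linarith [Real.one_sub_inv_le_log_of_pos hpos]
    _ ≤ 101 / 100 * b ^ 2 := by linarith

theorem continuousOn_mul_inv_sub_half_sq {r b : ℝ} (hr : 1 ≤ r) :
    ContinuousOn (fun s : ℝ => s * (1 / (s - 1 / 2) ^ 2)) (Icc r b) :=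
  continuousOn_id.mul <| continuousOn_const.div (by fun_prop) fun s hs =>
    pow_ne_zero 2 (by linarith [hs.1])

theorem integral_mul_inv_sub_half_sq {r b : ℝ} (hr : 1 ≤ r) (hrb : r ≤ b) :
    ∫ s in r..b, s * (1 / (s - 1 / 2) ^ 2) =
      Real.log ((b - 1 / 2) / (r - 1 / 2)) + 1 / (2 * (r - 1 / 2)) - 1 / (2 * (b - 1 / 2)) := by
  have hne : ∀ s ∈ uIcc r b, s - 1 / 2 ≠ 0 := fun s hs => by
    rw [uIcc_of_le hrb] at hs
    linarith [hs.1]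
  have hderiv : ∀ s ∈ uIcc r b, HasDerivAt
      (fun s : ℝ => Real.log (s - 1 / 2) - 1 / 2 * (s - 1 / 2)⁻¹)
      (s * (1 / (s - 1 / 2) ^ 2)) s := fun s hs => by
    have hsub : HasDerivAt (fun s : ℝ => s - 1 / 2) 1 s := (hasDerivAt_id s).sub_const _
    have hs := hne s hs
    refine ((hsub.log hs).sub ((hsub.inv hs).const_mul _)).congr_deriv ?_
    field_simp
    ring
  have hrne := hne r left_mem_uIcc
  have hbne := hne b right_mem_uIcc
  rw [intervalIntegral.integral_eq_sub_of_hasDerivAt hderiv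
    (uIcc_of_le hrb ▸ continuousOn_mul_inv_sub_half_sq hr).intervalIntegrable,
    Real.log_div hbne hrne]
  field_simp
  ring

namespace LogParams

variable (p : LogParams) {n : ℝ} {e : Plane}

/-- An upper bound for the sum of `1 / w ^ 2` over the particles at distance at most `R` from the
origin in a hard-core configuration; it comes from comparing the sum with an integral. -/
def energy : ℝ :=
  8 * (1 / 2 + (Real.log (p.R / (p.r - 1 / 2)) + 1 / (2 * (p.r - 1 / 2))))

theorem r_sub_half_pos : 0 < p.r - 1 / 2 := by linarith [p.one_le_r]

theorem log_R_div_r_sub_half_nonneg : 0 ≤ Real.log (p.R / (p.r - 1 / 2)) :=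
  Real.log_nonneg ((one_le_div p.r_sub_half_pos).2 (by linarith [p.r_lt_R]))

theorem energy_nonneg : 0 ≤ p.energy := by
  have hr := p.r_sub_half_pos
  have hlog := p.log_R_div_r_sub_half_nonneg
  rw [energy]
  positivity

/-- The radial profile of `invSqMajorant` outside the radius `r`. -/
def tail : ℝ → ℝ := (Ioc p.r (p.R + 1 / 2)).indicator fun s => 1 / (s - 1 / 2) ^ 2

/-- A function whose value at every point of the disk of radius `1 / 2` about a particle `x` with
`‖x‖ ≤ R` is at least `1 / w x ^ 2`. -/
def invSqMajorant (q : Plane) : ℝ≥0∞ :=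
  (Metric.closedBall (0 : Plane) p.r).indicator (fun _ => ENNReal.ofReal (1 / p.r ^ 2)) q +
    ENNReal.ofReal (p.tail ‖q‖)

theorem ofReal_inv_w_sq_le_invSqMajorant {x q : Plane} (hx : ‖x‖ ≤ p.R) (hq : dist q x < 1 / 2) :
    ENNReal.ofReal (1 / p.w x ^ 2) ≤ p.invSqMajorant q := by
  have hqx := norm_sub_norm_le q x
  rw [dist_eq_norm] at hq
  by_cases hqr : ‖q‖ ≤ p.r
  · rw [invSqMajorant, indicator_of_mem (mem_closedBall_zero_iff.2 hqr)]
    exact le_add_of_le_of_nonneg (ENNReal.ofReal_le_ofReal (one_div_le_one_div_of_le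
      (pow_pos p.r_pos 2) (pow_le_pow_left₀ p.r_pos.le (p.r_le_w x) 2))) bot_le
  · have hmem : ‖q‖ ∈ Ioc p.r (p.R + 1 / 2) := ⟨not_le.1 hqr, by linarith⟩
    have hpos : 0 < ‖q‖ - 1 / 2 := by linarith [p.one_le_r, hmem.1]
    have hle : ‖q‖ - 1 / 2 ≤ p.w x := by linarith [p.norm_le_w x]
    rw [invSqMajorant, tail, indicator_of_mem hmem]
    exact le_add_of_nonneg_of_le bot_le (ENNReal.ofReal_le_ofReal (one_div_le_one_div_of_le
      (pow_pos hpos 2) (pow_le_pow_left₀ hpos.le hle 2)))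

theorem lintegral_tail_le :
    ∫⁻ q : Plane, ENNReal.ofReal (p.tail ‖q‖) ≤ ENNReal.ofReal
      (2 * Real.pi * (Real.log (p.R / (p.r - 1 / 2)) + 1 / (2 * (p.r - 1 / 2)))) := by
  have hrR : p.r ≤ p.R + 1 / 2 := by linarith [p.r_lt_R]
  have hindicator (s : ℝ) : s * p.tail s =
      (Ioc p.r (p.R + 1 / 2)).indicator (fun s => s * (1 / (s - 1 / 2) ^ 2)) s :=
    (indicator_mul_right _ (fun s => s) _).symm
  have hsub : Ioc p.r (p.R + 1 / 2) ⊆ Ioi 0 := fun s hs => p.r_pos.trans hs.1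
  have hradial : IntegrableOn (fun s : ℝ => s * (1 / (s - 1 / 2) ^ 2)) (Ioc p.r (p.R + 1 / 2)) :=
    (continuousOn_mul_inv_sub_half_sq p.one_le_r).integrableOn_Icc.mono_set Ioc_subset_Icc_self
  rw [lintegral_ofReal_fun_norm (f := p.tail) (indicator_nonneg fun _ _ => by positivity)]
  · refine ENNReal.ofReal_le_ofReal (mul_le_mul_of_nonneg_left ?_ (by positivity))
    simp only [hindicator]
    rw [setIntegral_indicator measurableSet_Ioc, inter_eq_self_of_subset_right hsub,
      ← intervalIntegral.integral_of_le hrR, integral_mul_inv_sub_half_sq p.one_le_r hrR,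
      add_sub_cancel_right]
    exact sub_le_self _ (one_div_nonneg.2 (by linarith [p.R_pos]))
  · simp only [hindicator]
    exact (hradial.integrable_indicator measurableSet_Ioc).integrableOn

theorem lintegral_invSqMajorant_le :
    ∫⁻ q, p.invSqMajorant q ≤ ENNReal.ofReal (p.energy * (Real.pi / 4)) := by
  have hr := p.r_sub_half_pos
  have hlog := p.log_R_div_r_sub_half_nonneg
  have hinner : ENNReal.ofReal (1 / p.r ^ 2) * volume (Metric.closedBall (0 : Plane) p.r) =
      ENNReal.ofReal Real.pi := by
    rw [EuclideanSpace.volume_closedBall_fin_two, ← NNReal.coe_real_pi,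
      ← ENNReal.ofReal_pow p.r_pos.le, ← ENNReal.ofReal_mul (sq_nonneg _),
      ← ENNReal.ofReal_mul (by positivity), ← mul_assoc,
      one_div_mul_cancel (pow_ne_zero 2 p.r_pos.ne'), one_mul]
  unfold invSqMajorant
  rw [lintegral_add_left (measurable_const.indicator measurableSet_closedBall),
    lintegral_indicator_const measurableSet_closedBall, hinner]
  refine (add_le_add_right p.lintegral_tail_le _).trans_eq ?_
  rw [← ENNReal.ofReal_add Real.pi_nonneg (by positivity), energy]
  congr 1
  ring

theorem sum_inv_w_sq_le {A : Finset Plane} (hA : (A : Set Plane).Pairwise fun x y => 1 < dist x y)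
    (hAR : ∀ x ∈ A, ‖x‖ ≤ p.R) : ∑ x ∈ A, 1 / p.w x ^ 2 ≤ p.energy := by
  have hpos : 0 < Real.pi / 4 := by positivity
  have hpacking := (sum_mul_measure_ball_le_lintegral volume (r := 1 / 2)
    (f := fun x => ENNReal.ofReal (1 / p.w x ^ 2)) (hA.imp fun {x y} h => by linarith)
    fun x hx q hq => p.ofReal_inv_w_sq_le_invSqMajorant (hAR x hx) hq).trans
      p.lintegral_invSqMajorant_le
  simp only [volume_ball_half, ← Finset.sum_mul] at hpacking
  rw [← ENNReal.ofReal_sum_of_nonneg fun _ _ => by positivity,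
    ← ENNReal.ofReal_mul (Finset.sum_nonneg fun _ _ => by positivity),
    ENNReal.ofReal_le_ofReal_iff (mul_nonneg p.energy_nonneg hpos.le)] at hpacking
  exact le_of_mul_le_mul_right hpacking hpos

theorem abs_log_slope_add_le (hn : p.R + 1 ≤ n) (hσ : p.σ ≤ p.r / 20) (he : ‖e‖ = 1)
    (X : Config) (x : Plane) :
    |Real.log (1 + (p.profile n hn).slope e X x) +
      Real.log (1 + (p.profile n hn).slope (-e) X x)| ≤
        if ‖x‖ ≤ p.R then 101 / 100 * p.σ ^ 2 * (1 / p.w x ^ 2) else 0 := by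
  rw [Profile.slope_neg]
  split_ifs with hx
  · have hsmall : p.σ / p.w x ≤ 1 / 20 := by
      rw [div_le_iff₀ (p.w_pos x)]
      linarith [p.r_le_w x]
    refine (abs_log_add_log_le (p.abs_slope_le hn he X x) hsmall).trans_eq ?_
    rw [div_pow, mul_assoc, mul_one_div]
  · simp [p.slope_eq_zero hn e X (not_le.1 hx)]

theorem abs_log_jacobian_le (hn : p.R + 1 ≤ n) (hσ : p.σ ≤ p.r / 20) (he : ‖e‖ = 1) {X : Config}
    (hX : X ∈ hardCore) :
    |Real.log ((p.profile n hn).jacobian e X * (p.profile n hn).jacobian (-e) X)| ≤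
      101 / 100 * p.σ ^ 2 * p.energy := by
  have hfin := X.finite_inter (box n) (isBounded_box n)
  have hsum (e' : Plane) : Real.log ((p.profile n hn).jacobian e' X) =
      ∑ x ∈ hfin.toFinset, Real.log (1 + (p.profile n hn).slope e' X x) := by
    rw [Profile.jacobian, Real.log_exp, setIntegral_pts (measurableSet_box n) (isBounded_box n)]
  rw [Real.log_mul ((p.profile n hn).jacobian_pos _ _).ne' ((p.profile n hn).jacobian_pos _ _).ne',
    hsum, hsum, ← Finset.sum_add_distrib]
  calc _ ≤ ∑ x ∈ hfin.toFinset, |Real.log (1 + (p.profile n hn).slope e X x) +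
        Real.log (1 + (p.profile n hn).slope (-e) X x)| := Finset.abs_sum_le_sum_abs _ _
    _ ≤ ∑ x ∈ hfin.toFinset with ‖x‖ ≤ p.R, 101 / 100 * p.σ ^ 2 * (1 / p.w x ^ 2) := by
        rw [Finset.sum_filter]
        exact Finset.sum_le_sum fun x _ => p.abs_log_slope_add_le hn hσ he X x
    _ = 101 / 100 * p.σ ^ 2 * ∑ x ∈ hfin.toFinset with ‖x‖ ≤ p.R, 1 / p.w x ^ 2 :=
        (Finset.mul_sum _ _ _).symm
    _ ≤ 101 / 100 * p.σ ^ 2 * p.energy := by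
        refine mul_le_mul_of_nonneg_left (p.sum_inv_w_sq_le (fun x hx y hy => ?_) fun x hx =>
          (Finset.mem_filter.1 hx).2) (by positivity)
        simp only [Finset.coe_filter, Finite.mem_toFinset, mem_ofPred_eq] at hx hy
        exact hX x hx.1.1 y hy.1.1

theorem measurable_log_jacobian_mul (hn : p.R + 1 ≤ n) (e : Plane) :
    Measurable fun X =>
      Real.log ((p.profile n hn).jacobian e X * (p.profile n hn).jacobian (-e) X) :=
  Real.measurable_log.comp
    (((p.profile n hn).measurable_jacobian e).mul ((p.profile n hn).measurable_jacobian (-e)))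

theorem ae_abs_log_jacobian_le (hn : p.R + 1 ≤ n) (hσ : p.σ ≤ p.r / 20) (he : ‖e‖ = 1) (z : ℝ)
    (Y : Config) : ∀ᵐ X ∂(gibbs z (box n) Y),
      |Real.log ((p.profile n hn).jacobian e X * (p.profile n hn).jacobian (-e) X)| ≤
        101 / 100 * p.σ ^ 2 * p.energy := by
  filter_upwards [ae_gibbs_mem_hardCore z (measurableSet_box n) Y] with X hX
  exact p.abs_log_jacobian_le hn hσ he hX

theorem integrable_log_jacobian (hn : p.R + 1 ≤ n) (hσ : p.σ ≤ p.r / 20) (he : ‖e‖ = 1) (z : ℝ)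
    (Y : Config) :
    Integrable (fun X => Real.log ((p.profile n hn).jacobian e X *
      (p.profile n hn).jacobian (-e) X)) (gibbs z (box n) Y) :=
  have := isFiniteMeasure_gibbs z (measurableSet_box n) Y
  .of_bound (p.measurable_log_jacobian_mul hn e).aestronglyMeasurable _
    (p.ae_abs_log_jacobian_le hn hσ he z Y)

theorem integral_abs_log_jacobian_le (hn : p.R + 1 ≤ n) (hσ : p.σ ≤ p.r / 20) (he : ‖e‖ = 1)
    (z : ℝ) (Y : Config) :
    ∫ X, |Real.log ((p.profile n hn).jacobian e X * (p.profile n hn).jacobian (-e) X)|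
      ∂(gibbs z (box n) Y) ≤ 101 / 100 * p.σ ^ 2 * p.energy := by
  have huniv := gibbs_univ_le z (measurableSet_box n) Y
  have := isFiniteMeasure_gibbs z (measurableSet_box n) Y
  calc _ ≤ ∫ _, 101 / 100 * p.σ ^ 2 * p.energy ∂(gibbs z (box n) Y) :=
        integral_mono_ae (p.integrable_log_jacobian hn hσ he z Y).abs (integrable_const _)
          (p.ae_abs_log_jacobian_le hn hσ he z Y)
    _ = (gibbs z (box n) Y).real univ * (101 / 100 * p.σ ^ 2 * p.energy) := by
        rw [integral_const, smul_eq_mul]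
    _ ≤ 101 / 100 * p.σ ^ 2 * p.energy :=
        mul_le_of_le_one_left (mul_nonneg (by positivity) p.energy_nonneg)
          (ENNReal.toReal_le_of_le_ofReal zero_le_one (by rwa [ENNReal.ofReal_one]))

end LogParams

/-! ### The choice of parameters -/

section Numerics

variable {n ε : ℝ}

theorem log_le_div_of_pow_le {x : ℝ} (hx : 0 < x) {p q : ℕ} (hq : q ≠ 0)
    (h : x ^ q ≤ 2.7182818283 ^ p) : Real.log x ≤ p / q := by
  have hq' : (0 : ℝ) < q := by positivity
  rw [le_div_iff₀' hq', ← Real.log_pow, Real.log_le_iff_le_exp (by positivity), ← mul_one (p : ℝ),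
    Real.exp_nat_mul]
  exact h.trans (pow_le_pow_left₀ (by norm_num) Real.exp_one_gt_d9.le p)

theorem exp_div_le_of_pow_le {x : ℝ} (hx : 0 ≤ x) {p q : ℕ} (hq : q ≠ 0)
    (h : 2.7182818286 ^ p ≤ x ^ q) : Real.exp (p / q) ≤ x := by
  refine le_of_pow_le_pow_left₀ hq hx (le_trans ?_ h)
  rw [← Real.exp_nat_mul, mul_div_cancel₀ _ (by positivity : (q : ℝ) ≠ 0), ← mul_one (p : ℝ),
    Real.exp_nat_mul]
  exact pow_le_pow_left₀ (Real.exp_nonneg 1) Real.exp_one_lt_d9.le p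

theorem log_two_hundred_le : Real.log 200 ≤ 53 / 10 := by
  exact_mod_cast log_le_div_of_pow_le (x := 200) (p := 53) (q := 10) (by norm_num) (by norm_num)
    (by norm_num)

theorem log_three_le : Real.log 3 ≤ 11 / 10 := by
  exact_mod_cast log_le_div_of_pow_le (x := 3) (p := 11) (q := 10) (by norm_num) (by norm_num)
    (by norm_num)

theorem exp_nine_fifths_le : Real.exp (9 / 5) ≤ 611 / 100 := by
  exact_mod_cast exp_div_le_of_pow_le (x := 611 / 100) (p := 9) (q := 5) (by norm_num)
    (by norm_num) (by norm_num)

theorem five_le_log (hn : 200 ≤ n) : 5 ≤ Real.log n := by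
  have hexp := exp_div_le_of_pow_le (x := 200) (p := 5) (q := 1) (by norm_num) (by norm_num)
    (by norm_num)
  rw [Nat.cast_one, div_one] at hexp
  exact (Real.le_log_iff_exp_le (by linarith)).2 (hexp.trans hn)

theorem le_sqrt_of_two_hundred_le (hn : 200 ≤ n) : 14142 / 1000 ≤ √n :=
  Real.le_sqrt_of_sq_le (by norm_num; linarith)

-- The tangent line of the concave function `log` of `√n` at `n = 200`.
theorem log_le_sqrt (hn : 200 ≤ n) : Real.log n ≤ 33 / 10 + 14143 / 100000 * √n := by
  have hn0 : 0 < n := by linarith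
  have hratio : √(n / 200) ≤ 14143 / 200000 * √n := by
    rw [Real.sqrt_div hn0.le, div_le_iff₀ (by positivity)]
    nlinarith [le_sqrt_of_two_hundred_le hn, le_sqrt_of_two_hundred_le le_rfl]
  have hlog : Real.log n = Real.log 200 + 2 * Real.log √(n / 200) := by
    rw [Real.log_sqrt (by positivity), Real.log_div hn0.ne' (by norm_num)]
    ring
  linarith [log_two_hundred_le, Real.log_le_sub_one_of_pos (Real.sqrt_pos.2 (by positivity :
    0 < n / 200))]

theorem le_sqrt_two : 14142 / 10000 ≤ √2 := Real.le_sqrt_of_sq_le (by norm_num)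

theorem sqrt_two_le : √2 ≤ 14143 / 10000 := (Real.sqrt_le_left (by norm_num)).2 (by norm_num)

theorem log_one_add_le {u : ℝ} (hu : 0 ≤ u) (hu' : u ≤ 55 / 100) :
    Real.log (1 + u) ≤ 145 / 100 * u / (1 + 125 / 100 * u) := by
  rw [le_div_iff₀ (by positivity)]
  rcases le_total u (36 / 100) with hsmall | hlarge
  · nlinarith [Real.log_le_sub_one_of_pos (show 0 < 1 + u by linarith)]
  · have hlog : Real.log (3 / 2) ≤ 42 / 100 := by
      rw [Real.log_le_iff_le_exp (by norm_num)]
      exact le_trans (by norm_num)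
        (Real.quadratic_le_exp_of_nonneg (show (0 : ℝ) ≤ 42 / 100 by norm_num))
    have htangent : Real.log (1 + u) ≤ 42 / 100 + ((1 + u) / (3 / 2) - 1) := by
      have hle := Real.log_le_sub_one_of_pos (show 0 < (1 + u) / (3 / 2) by positivity)
      rw [Real.log_div (by positivity) (by norm_num)] at hle
      linarith
    nlinarith

theorem log_one_add_le_mul_log (hε : 0 < ε) (hε' : ε ≤ 1 / 4) {u : ℝ} (hu : 0 ≤ u)
    (hu' : u ≤ 55 / 100) :
    Real.log (1 + u) ≤ (17 / 10 / ε - 1) * Real.log (1 + ε * u / (1 + u)) := by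
  have hfactor : 0 ≤ 17 / 10 / ε - 1 := by
    rw [sub_nonneg, one_le_div hε]
    linarith
  have hcross : u * (145 / 100 * (1 + u + ε * u)) ≤
      u * ((17 / 10 - ε) * (1 + 125 / 100 * u)) :=
    mul_le_mul_of_nonneg_left (by nlinarith) hu
  calc Real.log (1 + u) ≤ 145 / 100 * u / (1 + 125 / 100 * u) := log_one_add_le hu hu'
    _ ≤ (17 / 10 - ε) * u / (1 + u + ε * u) := by
        rw [div_le_div_iff₀ (by positivity) (by positivity)]
        linarith
    _ = (17 / 10 / ε - 1) * (1 - (1 + ε * u / (1 + u))⁻¹) := by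
        field_simp
        ring
    _ ≤ (17 / 10 / ε - 1) * Real.log (1 + ε * u / (1 + u)) :=
        mul_le_mul_of_nonneg_left (Real.one_sub_inv_le_log_of_pos (by positivity)) hfactor

end Numerics

section Radii

variable {n : ℝ}

/-- The length of the chains that a slow particle in the box of size `√n` would produce. The factor
`41 / 10` makes the probability of such a chain, at most `exp (-4 / 5)` per step, beat the number
of its possible starting points, which is of order `n ^ 2`. -/
def window (n : ℝ) : ℕ := ⌈41 / 10 * Real.log n⌉₊

/-- The radius inside which the base shift is constant. It exceeds the radius `√2 * √n` of the
box of size `√n` by about the length of a chain. -/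
def innerRadius (n : ℝ) : ℝ := √2 * √n + 41 / 10 * Real.log n

/-- The logarithmic range over which the base shift decreases to zero. -/
def logRange (n : ℝ) : ℝ := Real.log ((n - 1) / innerRadius n)

theorem window_pos (hn : 200 ≤ n) : 0 < window n := Nat.ceil_pos.2 (by linarith [five_le_log hn])

theorem window_le (hn : 200 ≤ n) : (window n : ℝ) ≤ 41 / 10 * Real.log n + 1 :=
  (Nat.ceil_lt_add_one (by linarith [five_le_log hn])).le

theorem forty_le_innerRadius (hn : 200 ≤ n) : 40 ≤ innerRadius n := by
  rw [innerRadius]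
  nlinarith [le_sqrt_two, le_sqrt_of_two_hundred_le hn, five_le_log hn]

theorem innerRadius_le (hn : 200 ≤ n) : innerRadius n ≤ 298 / 100 * √n := by
  rw [innerRadius]
  nlinarith [sqrt_two_le, le_sqrt_of_two_hundred_le hn, log_le_sqrt hn]

theorem window_div_le (hn : 200 ≤ n) {w : ℝ} (hw : innerRadius n ≤ w) :
    (window n : ℝ) / w ≤ 55 / 100 := by
  rw [div_le_iff₀ (by linarith [forty_le_innerRadius hn])]
  rw [innerRadius] at hw
  nlinarith [le_sqrt_two, le_sqrt_of_two_hundred_le hn, log_le_sqrt hn, window_le hn]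

theorem sqrt_div_three_le (hn : 200 ≤ n) : √n / 3 ≤ (n - 1) / innerRadius n := by
  have hsq : √n * √n = n := Real.mul_self_sqrt (by linarith)
  rw [div_le_div_iff₀ (by norm_num) (by linarith [forty_le_innerRadius hn])]
  nlinarith [innerRadius_le hn, le_sqrt_of_two_hundred_le hn]

theorem innerRadius_lt (hn : 200 ≤ n) : innerRadius n < n - 1 := by
  have hr := forty_le_innerRadius hn
  have hle := sqrt_div_three_le hn
  rw [le_div_iff₀ (by linarith)] at hle
  nlinarith [le_sqrt_of_two_hundred_le hn]

theorem half_log_sub_le_logRange (hn : 200 ≤ n) : Real.log n / 2 - 11 / 10 ≤ logRange n := by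
  have hn0 : 0 < √n := Real.sqrt_pos.2 (by linarith)
  have hle := Real.log_le_log (div_pos hn0 three_pos) (sqrt_div_three_le hn)
  rw [Real.log_div hn0.ne' three_ne_zero, Real.log_sqrt (by linarith)] at hle
  rw [logRange]
  linarith [log_three_le]

theorem seven_fifths_le_logRange (hn : 200 ≤ n) : 7 / 5 ≤ logRange n := by
  linarith [half_log_sub_le_logRange hn, five_le_log hn]

theorem sqrt_log_div_logRange_le (hn : 200 ≤ n) :
    17 / 10 * √(Real.log n) / logRange n ≤ innerRadius n / 10 := by
  have hlog := five_le_log hn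
  have hrange := seven_fifths_le_logRange hn
  have hsqrt : 2 ≤ √(Real.log n) := Real.le_sqrt_of_sq_le (by linarith)
  have hsq : √(Real.log n) * √(Real.log n) = Real.log n := Real.mul_self_sqrt (by linarith)
  rw [div_le_iff₀ (by linarith)]
  nlinarith [half_log_sub_le_logRange hn, forty_le_innerRadius hn]

theorem log_div_logRange_sq_mul_le (hn : 200 ≤ n) :
    Real.log n / logRange n ^ 2 * (logRange n + 526 / 1000) ≤ 513 / 100 := by
  have hrange := seven_fifths_le_logRange hn
  rw [div_mul_eq_mul_div, div_le_iff₀ (by positivity)]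
  nlinarith [half_log_sub_le_logRange hn]

theorem log_div_innerRadius_sub_half_le (hn : 200 ≤ n) :
    Real.log ((n - 1) / (innerRadius n - 1 / 2)) ≤ logRange n + 13 / 1000 := by
  have hr := forty_le_innerRadius hn
  have hr0 : 0 < innerRadius n - 1 / 2 := by linarith
  have hsplit : (n - 1) / (innerRadius n - 1 / 2) =
      (n - 1) / innerRadius n * (innerRadius n / (innerRadius n - 1 / 2)) :=
    (div_mul_div_cancel₀ (by linarith : innerRadius n ≠ 0)).symm
  have hle : innerRadius n / (innerRadius n - 1 / 2) ≤ 1013 / 1000 := by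
    rw [div_le_iff₀ hr0]
    linarith
  rw [hsplit, Real.log_mul (div_pos (by linarith) (by linarith)).ne'
    (div_pos (by linarith) hr0).ne', logRange]
  linarith [Real.log_le_sub_one_of_pos (div_pos (by linarith : 0 < innerRadius n) hr0)]

theorem mul_lintegral_gapWeight_le {z ε : ℝ} (hε : 0 ≤ ε) (hε' : ε ≤ 1 / 4)
    (hzε : z * ε ≤ 1 / 48) :
    z * (2 * Real.pi * ((ε + ε ^ 2) * Real.exp 1)) ≤ Real.exp (-(4 / 5)) := by
  have hexp : Real.exp 1 = Real.exp (9 / 5) * Real.exp (-(4 / 5)) := by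
    rw [← Real.exp_add]
    norm_num
  have hzε2 : z * (ε + ε ^ 2) ≤ 5 / 192 := by nlinarith
  calc z * (2 * Real.pi * ((ε + ε ^ 2) * Real.exp 1))
      = z * (ε + ε ^ 2) * (2 * Real.pi * Real.exp (9 / 5)) * Real.exp (-(4 / 5)) := by
        rw [hexp]
        ring
    _ ≤ 5 / 192 * (2 * 3.1416 * (611 / 100)) * Real.exp (-(4 / 5)) := by
        gcongr
        · exact Real.pi_lt_d4.le
        · exact exp_nine_fifths_le
    _ ≤ 1 * Real.exp (-(4 / 5)) := by
        gcongr
        norm_num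
    _ = Real.exp (-(4 / 5)) := one_mul _

theorem pow_window_mul_le {q : ℝ} (hn : 200 ≤ n) (hq : 0 ≤ q) (hq' : q ≤ Real.exp (-(4 / 5))) :
    q ^ window n * (2 * (n - 1) + 1) ^ 2 ≤ 1 / n := by
  have hn0 : 0 < n := by linarith
  have hpow : q ^ window n ≤ Real.exp (-(328 / 100 * Real.log n)) := by
    refine (pow_le_pow_left₀ hq hq' _).trans ?_
    rw [← Real.exp_nat_mul]
    refine Real.exp_le_exp.2 ?_
    linarith [show 41 / 10 * Real.log n ≤ window n from Nat.le_ceil _]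
  have harea : (2 * (n - 1) + 1) ^ 2 ≤ 4 * n ^ 2 := by nlinarith
  have hcubic : 4 * n ^ 3 ≤ Real.exp (328 / 100 * Real.log n) := by
    rw [← Real.log_le_iff_le_exp (by positivity), Real.log_mul (by norm_num) (by positivity),
      Real.log_pow, show (4 : ℝ) = 2 ^ 2 by norm_num, Real.log_pow]
    push_cast
    linarith [Real.log_two_lt_d9, five_le_log hn]
  rw [le_div_iff₀ hn0]
  calc q ^ window n * (2 * (n - 1) + 1) ^ 2 * n
      ≤ Real.exp (-(328 / 100 * Real.log n)) * (4 * n ^ 2) * n := by gcongr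
    _ = Real.exp (-(328 / 100 * Real.log n)) * (4 * n ^ 3) := by ring
    _ ≤ Real.exp (-(328 / 100 * Real.log n)) * Real.exp (328 / 100 * Real.log n) := by gcongr
    _ = 1 := by rw [← Real.exp_add, neg_add_cancel, Real.exp_zero]

end Radii

section Parameters

variable {n δ ε : ℝ}

/-- The parameters of the profile in the box of size `n`, with shift height `δ * ε * √(log n)`. -/
def params (hn : 200 ≤ n) (hδ : 0 < δ) (hδ' : δ ≤ 1 / 2) (hε : 0 < ε) (hε' : ε ≤ 1 / 4) :
    LogParams where
  r := innerRadius n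
  R := n - 1
  c := δ * ε * √(Real.log n) / logRange n
  σ := 17 / 10 * δ * √(Real.log n) / logRange n
  one_le_r := by linarith [forty_le_innerRadius hn]
  r_lt_R := innerRadius_lt hn
  c_pos := by
    have hrange := seven_fifths_le_logRange hn
    have hlog := five_le_log hn
    positivity
  c_le := by
    have hrange := seven_fifths_le_logRange hn
    have hmul : δ * ε ≤ 17 / 10 * δ := by nlinarith
    gcongr
  σ_le := by
    rw [mul_right_comm, mul_div_right_comm]
    nlinarith [sqrt_log_div_logRange_le hn, forty_le_innerRadius hn]

variable (hn : 200 ≤ n) (hδ : 0 < δ) (hδ' : δ ≤ 1 / 2) (hε : 0 < ε) (hε' : ε ≤ 1 / 4)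

theorem params_R_add_one_le : (params hn hδ hδ' hε hε').R + 1 ≤ n := (sub_add_cancel n 1).le

theorem params_c_mul_log :
    (params hn hδ hδ' hε hε').c *
      Real.log ((params hn hδ hδ' hε hε').R / (params hn hδ hδ' hε hε').r) =
        δ * ε * √(Real.log n) :=
  div_mul_cancel₀ _ (by linarith [seven_fifths_le_logRange hn] : logRange n ≠ 0)

theorem params_σ_le : (params hn hδ hδ' hε hε').σ ≤ δ * ((params hn hδ hδ' hε hε').r / 10) := by
  refine le_trans (le_of_eq ?_) (mul_le_mul_of_nonneg_left (sqrt_log_div_logRange_le hn) hδ.le)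
  change 17 / 10 * δ * √(Real.log n) / logRange n = _
  ring

theorem params_ρ_le : ((params hn hδ hδ' hε hε').ρ : ℝ) ≤ δ := by
  rw [LogParams.coe_ρ, div_le_iff₀ (LogParams.r_pos _)]
  nlinarith [params_σ_le hn hδ hδ' hε hε', (params hn hδ hδ' hε hε').r_pos]

theorem params_σ_le_r_div_twenty :
    (params hn hδ hδ' hε hε').σ ≤ (params hn hδ hδ' hε hε').r / 20 := by
  nlinarith [params_σ_le hn hδ hδ' hε hε', (params hn hδ hδ' hε hε').r_pos]

theorem params_c_mul_log_one_add_window_le {w : ℝ} (hw : (params hn hδ hδ' hε hε').r ≤ w) :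
    (params hn hδ hδ' hε hε').c * Real.log (1 + window n / w) ≤
      ((params hn hδ hδ' hε hε').σ - (params hn hδ hδ' hε hε').c) *
        Real.log (1 + ε * window n / (w + window n)) := by
  have hw0 : 0 < w := (LogParams.r_pos _).trans_le hw
  have hσ : (params hn hδ hδ' hε hε').σ - (params hn hδ hδ' hε hε').c =
      (params hn hδ hδ' hε hε').c * (17 / 10 / ε - 1) := by
    change 17 / 10 * δ * √(Real.log n) / logRange n - δ * ε * √(Real.log n) / logRange n =
      δ * ε * √(Real.log n) / logRange n * (17 / 10 / ε - 1)
    field_simp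
  have hscale : ε * (window n / w) / (1 + window n / w) = ε * window n / (w + window n) := by
    field_simp
  rw [hσ, mul_assoc, ← hscale]
  exact mul_le_mul_of_nonneg_left (log_one_add_le_mul_log hε hε' (by positivity)
    (window_div_le hn hw)) (LogParams.c_pos _).le

theorem params_energy_le : (params hn hδ hδ' hε hε').energy ≤ 8 * (logRange n + 526 / 1000) := by
  have hr := forty_le_innerRadius hn
  have hinv : 1 / (2 * (innerRadius n - 1 / 2)) ≤ 13 / 1000 := by
    rw [div_le_iff₀ (by linarith)]
    linarith
  change 8 * (1 / 2 + (Real.log ((n - 1) / (innerRadius n - 1 / 2)) +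
    1 / (2 * (innerRadius n - 1 / 2)))) ≤ _
  linarith [log_div_innerRadius_sub_half_le hn]

theorem params_σ_sq_mul_energy_le :
    101 / 100 * (params hn hδ hδ' hε hε').σ ^ 2 * (params hn hδ hδ' hε hε').energy ≤
      120 * δ ^ 2 := by
  have hσ : (params hn hδ hδ' hε hε').σ ^ 2 =
      289 / 100 * δ ^ 2 * (Real.log n / logRange n ^ 2) := by
    change (17 / 10 * δ * √(Real.log n) / logRange n) ^ 2 = _
    rw [div_pow, mul_pow, mul_pow, Real.sq_sqrt (by linarith [five_le_log hn])]
    ring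
  calc _ ≤ 101 / 100 * (params hn hδ hδ' hε hε').σ ^ 2 * (8 * (logRange n + 526 / 1000)) :=
        mul_le_mul_of_nonneg_left (params_energy_le hn hδ hδ' hε hε') (by positivity)
    _ = 101 / 100 * (289 / 100) * 8 * δ ^ 2 *
        (Real.log n / logRange n ^ 2 * (logRange n + 526 / 1000)) := by
        rw [hσ]
        ring
    _ ≤ 101 / 100 * (289 / 100) * 8 * δ ^ 2 * (513 / 100) := by
        gcongr
        exact log_div_logRange_sq_mul_le hn
    _ ≤ 120 * δ ^ 2 := by nlinarith [sq_nonneg δ]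

theorem gibbs_compl_goodSet_params_le {z : ℝ} (hz : 0 ≤ z) (hzε : z * ε ≤ 1 / 48) (Y : Config) :
    gibbs z (box n) Y
      ((params hn hδ hδ' hε hε').goodSet (params_R_add_one_le hn hδ hδ' hε hε') √n)ᶜ ≤
        ENNReal.ofReal (1 / n) := by
  have hq : 0 ≤ z * (2 * Real.pi * ((ε + ε ^ 2) * Real.exp 1)) := by positivity
  have hsqrt : √n ≤ n := (Real.sqrt_le_left (by linarith)).2 (by nlinarith)
  have hwindow : √2 * √n + window n ≤ (params hn hδ hδ' hε hε').r + 1 := by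
    change _ ≤ innerRadius n + 1
    rw [innerRadius]
    linarith [window_le hn]
  refine ((params hn hδ hδ' hε hε').gibbs_compl_goodSet_le z _ hε (window_pos hn)
    (fun w hw => params_c_mul_log_one_add_window_le hn hδ hδ' hε hε' hw) hsqrt hwindow Y).trans ?_
  rw [← ENNReal.ofReal_mul hz, ← ENNReal.ofReal_pow hq, ← ENNReal.ofReal_mul (pow_nonneg hq _)]
  exact ENNReal.ofReal_le_ofReal
    (pow_window_mul_le hn hq (mul_lintegral_gapWeight_le hε.le hε' hzε))

end Parameters

end HardDisk

end

open HardDisk in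
theorem theorem1_general (z δ ε n : ℝ) (e : Plane) (hz : 0 ≤ z) (hδ : 0 < δ) (hδ' : δ ≤ 1 / 2)
    (hε : 0 < ε) (hε' : ε ≤ 1 / 4) (hzε : z * ε ≤ 1 / 48) (hn : 200 ≤ n) (he : ‖e‖ = 1) :
    ∃ (t : Config → Plane → ℝ) (T Tbar : Config → Config) (G : Set Config) (φ φbar : Config → ℝ),
      (∀ X x, 0 ≤ t X x) ∧
      (∀ X, (T X).carrier = (fun x => x + t X x • e) '' X.carrier) ∧
      (∀ X, (Tbar X).carrier = (fun x => x - t X x • e) '' X.carrier) ∧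
      Measurable T ∧ Measurable Tbar ∧ MeasurableSet G ∧
      (∀ X, ∀ x ∉ box n, t X x = 0) ∧
      (∀ X ∈ G, ∀ x ∈ X.carrier ∩ box √n, t X x = δ * ε * √(Real.log n)) ∧
      (∀ X : Config, ∀ x ∈ X.carrier, ∀ y ∈ X.carrier, |t X x - t X y| ≤ δ * dist x y) ∧
      (∀ Y ∈ hardCore, gibbs z (box n) Y Gᶜ ≤ ENNReal.ofReal (1 / n)) ∧
      (Function.Bijective T ∧ T '' hardCore = hardCore) ∧
      (Function.Bijective Tbar ∧ Tbar '' hardCore = hardCore) ∧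
      (∀ Y ∈ hardCore, IsImageDensity (gibbs z (box n) Y) T φ ∧
        IsImageDensity (gibbs z (box n) Y) Tbar φbar) ∧
      (∀ Y ∈ hardCore, (∀ᵐ X ∂(gibbs z (box n) Y), 0 < φ X * φbar X) ∧
        Integrable (fun X => Real.log (φ X * φbar X)) (gibbs z (box n) Y) ∧
        ∫ X, |Real.log (φ X * φbar X)| ∂(gibbs z (box n) Y) ≤ 120 * δ ^ 2) := by
  let p := params hn hδ hδ' hε hε'
  have hp : p.R + 1 ≤ n := params_R_add_one_le hn hδ hδ' hε hε'
  let P := p.profile n hp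
  have hsmooth := p.smoothOff hp
  have hσ := params_σ_le_r_div_twenty hn hδ hδ' hε hε'
  have he' : ‖-e‖ = 1 := by rwa [norm_neg]
  refine ⟨P.time, P.move e, P.move (-e), p.goodSet hp √n, P.jacobian e, P.jacobian (-e),
    P.time_nonneg, fun X => rfl, P.carrier_move_neg e, P.measurable_move he,
    P.measurable_move he', p.measurableSet_goodSet hp √n,
    fun X x => shiftTime_of_notMem X,
    fun X hX x hx => (hX x hx.1 hx.2).trans (params_c_mul_log hn hδ hδ' hε hε'),
    fun X x hx y hy => (P.abs_time_sub_le X hx hy).trans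
      (mul_le_mul_of_nonneg_right (params_ρ_le hn hδ hδ' hε hε') dist_nonneg),
    fun Y _ => gibbs_compl_goodSet_params_le hn hδ hδ' hε hε' hz hzε Y,
    ⟨P.bijective_move he, P.image_hardCore he⟩, ⟨P.bijective_move he', P.image_hardCore he'⟩,
    fun Y _ => ⟨P.isImageDensity hsmooth he Y z, P.isImageDensity hsmooth he' Y z⟩,
    fun Y _ => ⟨.of_forall fun X => mul_pos (P.jacobian_pos e X) (P.jacobian_pos (-e) X),
      p.integrable_log_jacobian hp hσ he z Y,
      (p.integral_abs_log_jacobian_le hp hσ he z Y).trans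
        (params_σ_sq_mul_energy_le hn hδ hδ' hε hε')⟩⟩

theorem theorem1 (z δ : ℝ) (hz : 0 < z) (hδ : 0 < δ) (hδ' : δ ≤ 1 / 2) (n : ℕ) (hn : 200 ≤ n) :
    ∃ (t : HardDisk.Config → HardDisk.Plane → ℝ)
      (T Tbar : HardDisk.Config → HardDisk.Config)
      (G : Set HardDisk.Config) (φ φbar : HardDisk.Config → ℝ),
      -- the form of the two transformations, and measurability
      (∀ X x, 0 ≤ t X x) ∧
      (∀ X, (T X).carrier = (fun x => x + t X x • HardDisk.e₁) '' X.carrier) ∧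
      (∀ X, (Tbar X).carrier = (fun x => x - t X x • HardDisk.e₁) '' X.carrier) ∧
      Measurable T ∧ Measurable Tbar ∧ MeasurableSet G ∧
      -- (1)
      (∀ X, ∀ x ∉ HardDisk.box n, t X x = 0) ∧
      -- (2)
      (∀ X ∈ G, ∀ x ∈ X.carrier ∩ HardDisk.box (Real.sqrt n),
        t X x = δ * min (1 / (48 * z)) (1 / 4) * Real.sqrt (Real.log n)) ∧
      -- (3)
      (∀ X : HardDisk.Config, ∀ x ∈ X.carrier, ∀ y ∈ X.carrier,
        |t X x - t X y| ≤ δ * dist x y) ∧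
      -- (4)
      (∀ Y ∈ HardDisk.hardCore,
        HardDisk.gibbs z (HardDisk.box n) Y Gᶜ ≤ ENNReal.ofReal (1 / n)) ∧
      -- (5), for both transformations
      (Function.Bijective T ∧ T '' HardDisk.hardCore = HardDisk.hardCore) ∧
      (Function.Bijective Tbar ∧ Tbar '' HardDisk.hardCore = HardDisk.hardCore) ∧
      -- (6), for both transformations
      (∀ Y ∈ HardDisk.hardCore,
        HardDisk.IsImageDensity (HardDisk.gibbs z (HardDisk.box n) Y) T φ ∧
        HardDisk.IsImageDensity (HardDisk.gibbs z (HardDisk.box n) Y) Tbar φbar) ∧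
      -- (7); positivity is needed because `Real.log 0 = 0` in Lean
      (∀ Y ∈ HardDisk.hardCore,
        (∀ᵐ X ∂(HardDisk.gibbs z (HardDisk.box n) Y), 0 < φ X * φbar X) ∧
        MeasureTheory.Integrable (fun X => Real.log (φ X * φbar X))
          (HardDisk.gibbs z (HardDisk.box n) Y) ∧
        ∫ X, |Real.log (φ X * φbar X)| ∂(HardDisk.gibbs z (HardDisk.box n) Y)
          ≤ 120 * δ ^ 2) := by
  have hzε : z * min (1 / (48 * z)) (1 / 4) ≤ 1 / 48 :=
    (mul_le_mul_of_nonneg_left (min_le_left _ _) hz.le).trans_eq (by field_simp)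
  exact theorem1_general z δ _ n HardDisk.e₁ hz.le hδ hδ' (by positivity) (min_le_right _ _) hzε
    (by exact_mod_cast hn) (by simp [HardDisk.e₁])
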